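/- Let $f,\hat u:\mathbb R\to\mathbb R$ be smooth, $c\in\mathbb R$, suppose the limits $\hat u_\pm=\lim_{\xi\to\pm\infty}\hat u(\xi)$ exist, and put $\phi=f'\circ\hat u$, $\phi_\pm=\phi-f'(\hat u_\pm)$ (in the application, $\hat u$ is a travelling wave with speed $c$ of $u_t=u_{xx}+f(u)$; its equation is not needed). Assume that $\phi_-$ is integrable on $(-\infty,0]$, that $\phi_+$ is integrable on $[0,\infty)$, and that all derivatives $\phi^{(p)}$, $p\ge1$, are integrable on $\mathbb R$ (so that they vanish at infinity). For $\lambda\in\mathbb C$ consider $$y'=A(\xi;\lambda)\,y,\qquad A(\xi;\lambda)=\begin{bmatrix}0&1\\ \lambda-\phi(\xi)&-c\end{bmatrix}.$$ Write $\kappa_\pm=\sqrt{c^2+4(\lambda-f'(\hat u_\pm))}$ (principal branch), $\mu_-^{[1]}=\tfrac12(-c+\kappa_-)$ and $\mu_+^{[2]}=\tfrac12(-c-\kappa_+)$. Let $y_-$ be the solution with $y_-(\xi)\to0$ and $e^{-\mu_-^{[1]}\xi}y_-(\xi)\to(1,\mu_-^{[1]})^{\top}$ as $\xi\to-\infty$,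 and $y_+$ the solution with $y_+(\xi)\to0$ and $e^{-\mu_+^{[2]}\xi}y_+(\xi)\to(1,\mu_+^{[2]})^{\top}$ as $\xi\to+\infty$. The Evans function is $D(\lambda)=y_-(0)\wedge y_+(0)=\det[\,y_-(0),y_+(0)\,]$. One step of the fourth-order Magnus method from $\xi$ with signed step length $s$ multiplies the current value by $\exp(\Omega)$, where $$\Omega=\tfrac s2(A_1+A_2)-\tfrac{\sqrt3}{12}s^2\,[A_1,A_2],\qquad A_{1,2}=A\bigl(\xi+(\tfrac12\mp\tfrac{\sqrt3}6)s;\lambda\bigr).$$ For $h>0$ and $N\in\mathbb N$ put $L=Nh$. Let $E_D$ be the error (numerical minus exact value) in $D(\lambda)$ when $y_-$ is integrated from $-L$ to $0$ in $N$ steps of length $h$, and $y_+$ from $L$ to $0$ in $N$ steps of length $-h$, both by this method and with exact starting values. Then for every $\varepsilon>0$ and $K>0$ there are constants $C$ and $h_0>0$ such that for every $h\in(0,h_0)$ there is an $N_0$ such that for all $N\ge N_0$ and all $\lambda$ with $|\arg\lambda|<\pi-\varepsilon$ and $|\lambda|\ge Kh^{-2}$: 1. $\displaystyle \Bigl|E_D+\frac{h^4}{144}\int_{-\infty}^{\infty}\phi'(x)^2\,dx\Bigr|\le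 C\bigl(h^6+|\lambda|^{-1/2}h^4+|\lambda|^{-1}h^2\bigr)$; 2. if moreover $|\lambda|\ge Kh^{-4}$, then $\displaystyle \Bigl|E_D+\frac{h^4}{144}\int_{-\infty}^{\infty}\phi'(x)^2\,dx\Bigr|\le Ch^6$; 3. $|E_D|\le Ch^4$. Thus $E_D=-\frac{h^4}{144}\int_{-\infty}^\infty(\phi')^2\,dx+O(h^6)$ up to terms that vanish as $|\lambda|\to\infty$, and the error is of fourth order in $h$, uniformly in $\lambda$; the constants do not depend on $h$, $N$ or $\lambda$, and $N_0$ does not depend on $\lambda$. -/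

import Mathlib

open MeasureTheory Filter Topology

noncomputable section

namespace EvansMagnus

/-- The potential `φ = f' ∘ û` of the linearisation about the profile `û`. -/
def potential (f u : ℝ → ℝ) : ℝ → ℝ := fun x => deriv f (u x)

/-- Coefficient matrix `A(ξ; lam)` of the eigenvalue equation `U'' + c U' + φ U = lam U`,
written as a first-order system for `y = (U, U')`. -/
def coeffMatrix (c : ℝ) (φ : ℝ → ℝ) (lam : ℂ) (x : ℝ) : Matrix (Fin 2) (Fin 2) ℂ :=
  !![0, 1; lam - (φ x : ℂ), -(c : ℂ)]

/-- `κ = √(c² + 4 (lam - m))`, principal branch, where `m` is the limit of `φ` at one end. -/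
def kappa (c m : ℝ) (lam : ℂ) : ℂ :=
  ((c : ℂ) ^ 2 + 4 * (lam - (m : ℂ))) ^ (1 / 2 : ℂ)

/-- Spatial eigenvalue `μ^[1] = (-c + κ) / 2` of the limit matrix. -/
def mu₁ (c m : ℝ) (lam : ℂ) : ℂ := (-(c : ℂ) + kappa c m lam) / 2

/-- Spatial eigenvalue `μ^[2] = (-c - κ) / 2` of the limit matrix. -/
def mu₂ (c m : ℝ) (lam : ℂ) : ℂ := (-(c : ℂ) - kappa c m lam) / 2

/-- `y` solves `y' = A y` on the whole line. -/
def IsSolution (A : ℝ → Matrix (Fin 2) (Fin 2) ℂ) (y : ℝ → Fin 2 → ℂ) : Prop :=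
  ∀ x : ℝ, HasDerivAt y ((A x).mulVec (y x)) x

/-- The solution that tends to `0` at `-∞`, normalised by
`exp (-μ₋^[1] ξ) y(ξ) → (1, μ₋^[1])` as `ξ → -∞`; here `m` is the limit of `φ` at `-∞`. -/
structure IsLeftSolution (c m : ℝ) (φ : ℝ → ℝ) (lam : ℂ) (y : ℝ → Fin 2 → ℂ) : Prop where
  solution : IsSolution (coeffMatrix c φ lam) y
  decay : Tendsto y atBot (𝓝 0)
  normalised : Tendsto (fun x : ℝ => Complex.exp (-(mu₁ c m lam * (x : ℂ))) • y x) atBot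
    (𝓝 ![1, mu₁ c m lam])

/-- The solution that tends to `0` at `+∞`, normalised by
`exp (-μ₊^[2] ξ) y(ξ) → (1, μ₊^[2])` as `ξ → +∞`; here `m` is the limit of `φ` at `+∞`. -/
structure IsRightSolution (c m : ℝ) (φ : ℝ → ℝ) (lam : ℂ) (y : ℝ → Fin 2 → ℂ) : Prop where
  solution : IsSolution (coeffMatrix c φ lam) y
  decay : Tendsto y atTop (𝓝 0)
  normalised : Tendsto (fun x : ℝ => Complex.exp (-(mu₂ c m lam * (x : ℂ))) • y x) atTop
    (𝓝 ![1, mu₂ c m lam])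

/-- The wedge product of two vectors of `ℂ²`: the determinant with columns `v` and `w`. -/
def wedge (v w : Fin 2 → ℂ) : ℂ := Matrix.det !![v 0, w 0; v 1, w 1]

/-- The first Gauss–Legendre point of the step of (signed) length `h` from `x`. -/
def gaussPoint₁ (x h : ℝ) : ℝ := x + (1 / 2 - Real.sqrt 3 / 6) * h

/-- The second Gauss–Legendre point of the step of (signed) length `h` from `x`. -/
def gaussPoint₂ (x h : ℝ) : ℝ := x + (1 / 2 + Real.sqrt 3 / 6) * h

/-- The exponent `Ω = (h/2) (A₁ + A₂) - (√3/12) h² [A₁, A₂]` of the fourth-order Magnus method,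
with `A₁`, `A₂` the values of `A` at the two Gauss–Legendre points. -/
def magnusExponent (A : ℝ → Matrix (Fin 2) (Fin 2) ℂ) (x h : ℝ) : Matrix (Fin 2) (Fin 2) ℂ :=
  ((h / 2 : ℝ) : ℂ) • (A (gaussPoint₁ x h) + A (gaussPoint₂ x h))
    - ((Real.sqrt 3 / 12 * h ^ 2 : ℝ) : ℂ) •
      (A (gaussPoint₁ x h) * A (gaussPoint₂ x h) - A (gaussPoint₂ x h) * A (gaussPoint₁ x h))

/-- `k` steps of (signed) length `h` of the fourth-order Magnus method for `y' = A y`, started at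
`x₀` from the value `y₀`. -/
def magnusIterate (A : ℝ → Matrix (Fin 2) (Fin 2) ℂ) (x₀ h : ℝ) (y₀ : Fin 2 → ℂ) :
    ℕ → Fin 2 → ℂ
  | 0 => y₀
  | k + 1 =>
    (NormedSpace.exp (magnusExponent A (x₀ + k * h) h)).mulVec (magnusIterate A x₀ h y₀ k)

/-- The error `E_D` in the Evans function: numerical value minus exact value, at `ξ = 0`. With
`L = N h`, the solution `yl` is integrated from `-L` to `0` with step `h`, and the solution `yr`
from `L` to `0` with step `-h`, both by the fourth-order Magnus method and from exact starting
values. -/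
def evansError (A : ℝ → Matrix (Fin 2) (Fin 2) ℂ) (yl yr : ℝ → Fin 2 → ℂ) (h : ℝ) (N : ℕ) : ℂ :=
  wedge (magnusIterate A (-(N * h)) h (yl (-(N * h))) N)
      (magnusIterate A (N * h) (-h) (yr (N * h)) N)
    - wedge (yl 0) (yr 0)

end EvansMagnus

end

/-!
The Evans function is a determinant, and its error is the change of a determinant under a small
perturbation of a differential equation.

*One flow on the whole line.* The step of the fourth-order Magnus method is symmetric
(`magnusExponent_symm`), and it multiplies determinants by a known exponential. The two numerical
solutions may therefore be compared at the right end point instead of at `0`: only the left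
solution is integrated, over the whole interval, and it is paired with an exact right solution
(`wedge_magnusIterate`).

*The numerical flow is a perturbed exact flow.* On each cell the exponent is `h` times a constant
matrix, whose entries involve the mean of `φ` over the Gauss points and the slope
`√3 h (φ₂ - φ₁) / 12`, which is close to `h² φ' / 12`. After removal of the first-order term by
`e^{c x / 2}` and a shift of the second component by `h² φ' / 12` times the first, the numerical
solution satisfies the exact system up to a traceless matrix `[[ε, 0], [χ, -ε]]`, where
`ε = O(h³)` and `χ = O(h)`, both uniformly and in `L¹` (`hasDerivWithinAt_gaugedCurve`).
The leading terms of the integral of `χ` over a cell telescope over the cells, except for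
`h⁴ / 144 ∫ (φ')²`, which comes from the square of the slope
(`BoundedJet.abs_accumulatedError_sub_le`).

*Exact solutions.* With `Λ = lam + c² / 4` and `q = √(Λ - φ)`, the exact solutions have
logarithmic derivatives `± q` up to `O(r⁻²)`, uniformly and in `L¹`, and their product is
`1 + O(r⁻¹)`, where `r` is comparable to `√‖lam‖` (`wkb_left`, `wkb_right`, `exactPair`). The
choice of the exact logarithmic derivatives `ρm`, `ρp` as a frame, instead of `± q`, leaves no
inhomogeneity in the coordinates `a`, `b` of the numerical solution.

*Perturbation theory.* With `j = (ρp - ρm)⁻¹`, the coordinate `b` is damped at rate `r`, and the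
perturbation acts on `a` as `a' = -j χ a` up to terms of second order. As `j` is almost constant,
because `j' = j (ρm + ρp)` is integrable of size `r⁻³`, the product `a exp (j ∫ χ)` is almost
constant (`PerturbedFrame.norm_a_le`). The exact determinant `D` is the Wronskian, and
`D j = 1 + O(r⁻¹)`; hence `D (a - 1)` is `-∫ χ` up to the stated errors
(`norm_determinant_error_le`). The error terms `h⁶`, `h⁴ / r` and `h² / r²` come out of the
products of the sizes above.
-/

namespace EvansMagnus

/-! ### Damped scalar equations -/

theorem hasDerivWithinAt_normSq_damped {p mu f : ℝ → ℂ} {x : ℝ} {s : Set ℝ}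
    (h : HasDerivWithinAt p (-(mu x) * p x + f x) s x) :
    HasDerivWithinAt (fun y => ‖p y‖ ^ 2)
      (2 * (-(mu x).re * ‖p x‖ ^ 2 + inner ℝ (p x) (f x))) s x := by
  have := h.norm_sq
  convert this using 2
  rw [inner_add_right]
  congr 1
  rw [Complex.inner, ← Complex.normSq_eq_norm_sq, Complex.normSq_apply]
  simp
  ring

/-- A scalar equation `p' = -μ p + f` with damping `Re μ ≥ r` responds to a forcing of size `F`
by at most `F / r`. -/
theorem norm_le_of_damped {p mu f : ℝ → ℂ} {x₀ x₁ r F : ℝ} (hr : 0 < r)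
    (hF : 0 ≤ F)
    (hc : ContinuousOn p (Set.Icc x₀ x₁))
    (hp : ∀ x ∈ Set.Ico x₀ x₁, HasDerivWithinAt p (-(mu x) * p x + f x) (Set.Ici x) x)
    (hmu : ∀ x ∈ Set.Ico x₀ x₁, r ≤ (mu x).re) (hf : ∀ x ∈ Set.Ico x₀ x₁, ‖f x‖ ≤ F)
    {x : ℝ} (hx : x ∈ Set.Icc x₀ x₁) : ‖p x‖ ≤ ‖p x₀‖ + F / r := by
  have hE : ∀ y : ℝ, HasDerivAt (fun y => Real.exp (r * (y - x₀)))
      (Real.exp (r * (y - x₀)) * r) y := by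
    intro y
    simpa using ((((hasDerivAt_id y).sub_const x₀).const_mul r).exp)
  have key := image_le_of_deriv_right_le_deriv_boundary
    (f := fun y => ‖p y‖ ^ 2 * Real.exp (r * (y - x₀)))
    (B := fun y => ‖p x₀‖ ^ 2 + F ^ 2 / r ^ 2 * Real.exp (r * (y - x₀)))
    (B' := fun y => F ^ 2 / r ^ 2 * (Real.exp (r * (y - x₀)) * r))
    (a := x₀) (b := x₁) (by fun_prop)
    (fun y hy => (hasDerivWithinAt_normSq_damped (hp y hy)).mul (hE y).hasDerivWithinAt)
    (by simp; positivity) (by fun_prop)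
    (fun y _ => ((hE y).hasDerivWithinAt.const_mul _).const_add _) ?_ hx
  · beta_reduce at key
    have h1 : 1 ≤ Real.exp (r * (x - x₀)) :=
      Real.one_le_exp (mul_nonneg hr.le (sub_nonneg.2 hx.1))
    set e := Real.exp (r * (x - x₀))
    have h2 : ‖p x‖ ^ 2 ≤ ‖p x₀‖ ^ 2 + F ^ 2 / r ^ 2 := by
      by_contra hcon
      push Not at hcon
      nlinarith [sq_nonneg ‖p x₀‖]
    refine abs_le_of_sq_le_sq' ?_ (by positivity) |>.2
    have : (F / r) ^ 2 = F ^ 2 / r ^ 2 := by ring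
    have h3 : 0 ≤ ‖p x₀‖ * (F / r) := by positivity
    nlinarith
  · intro y hy
    have h1 : inner ℝ (p y) (f y) ≤ ‖p y‖ * F :=
      (real_inner_le_norm _ _).trans (mul_le_mul_of_nonneg_left (hf y hy) (norm_nonneg _))
    have h2 := hmu y hy
    have h3 : 2 * (-(mu y).re * ‖p y‖ ^ 2 + inner ℝ (p y) (f y)) + ‖p y‖ ^ 2 * r ≤ F ^ 2 / r := by
      have h4 : F ^ 2 / r - (2 * (‖p y‖ * F) - r * ‖p y‖ ^ 2) = (F - r * ‖p y‖) ^ 2 / r := by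
        field_simp; ring
      have h5 : 0 ≤ (F - r * ‖p y‖) ^ 2 / r := by positivity
      nlinarith [sq_nonneg ‖p y‖]
    calc _ = (2 * (-(mu y).re * ‖p y‖ ^ 2 + inner ℝ (p y) (f y)) + ‖p y‖ ^ 2 * r)
          * Real.exp (r * (y - x₀)) := by ring
      _ ≤ F ^ 2 / r * Real.exp (r * (y - x₀)) := by gcongr
      _ = _ := by field_simp

/-- A scalar equation `p' = -μ p + f` with damping `Re μ ≥ r` gains a factor `1 / r` in `L¹`. -/
theorem integral_norm_le_of_damped {p mu f : ℝ → ℂ} {F : ℝ → ℝ} {x₀ x₁ r : ℝ} (hr : 0 < r)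
    (h01 : x₀ ≤ x₁) (hc : ContinuousOn p (Set.Icc x₀ x₁))
    (hp : ∀ x ∈ Set.Ico x₀ x₁, HasDerivWithinAt p (-(mu x) * p x + f x) (Set.Ici x) x)
    (hmu : ∀ x ∈ Set.Ico x₀ x₁, r ≤ (mu x).re) (hf : ∀ x ∈ Set.Ico x₀ x₁, ‖f x‖ ≤ F x)
    (hF : IntervalIntegrable F volume x₀ x₁) :
    r * ∫ x in x₀..x₁, ‖p x‖ ≤ ‖p x₀‖ + ∫ x in x₀..x₁, F x := by
  have hpi : IntervalIntegrable (fun x => ‖p x‖) volume x₀ x₁ :=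
    ContinuousOn.intervalIntegrable (by rw [Set.uIcc_of_le h01]; exact hc.norm)
  -- `√(‖p‖² + δ²)` replaces `‖p‖`, which is not differentiable at zeros of `p`
  have main : ∀ δ : ℝ, 0 < δ →
      r * ∫ x in x₀..x₁, ‖p x‖ ≤ ‖p x₀‖ + (∫ x in x₀..x₁, F x) + (δ + r * δ * (x₁ - x₀)) := by
    intro δ hδ
    have hpos : ∀ y, 0 < ‖p y‖ ^ 2 + δ ^ 2 := fun y => by positivity
    have hsq : ∀ y, Real.sqrt (‖p y‖ ^ 2 + δ ^ 2) ≠ 0 := fun y => (Real.sqrt_pos.2 (hpos y)).ne'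
    have hint : IntervalIntegrable (fun x => -r * ‖p x‖ + r * δ + F x) volume x₀ x₁ :=
      ((hpi.const_mul _).add intervalIntegrable_const).add hF
    have key := intervalIntegral.sub_le_integral_of_hasDeriv_right_of_le h01
      (g := fun y => Real.sqrt (‖p y‖ ^ 2 + δ ^ 2))
      (φ := fun x => -r * ‖p x‖ + r * δ + F x)
      (((hc.norm.pow 2).add continuousOn_const).sqrt)
      (fun y hy => ((((hasDerivWithinAt_normSq_damped (hp y ⟨hy.1.le, hy.2⟩)).add_const
        (δ ^ 2)).sqrt (hpos y).ne').mono Set.Ioi_subset_Ici_self))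
      ((intervalIntegrable_iff_integrableOn_Icc_of_le h01).1 hint) ?_
    · have e1 : ∫ x in x₀..x₁, (-r * ‖p x‖ + r * δ + F x) =
          -r * (∫ x in x₀..x₁, ‖p x‖) + r * δ * (x₁ - x₀) + ∫ x in x₀..x₁, F x := by
        rw [intervalIntegral.integral_add ((hpi.const_mul _).add intervalIntegrable_const) hF,
          intervalIntegral.integral_add (hpi.const_mul _) intervalIntegrable_const,
          intervalIntegral.integral_const_mul, intervalIntegral.integral_const, smul_eq_mul]
        ring
      have e2 : Real.sqrt (‖p x₀‖ ^ 2 + δ ^ 2) ≤ ‖p x₀‖ + δ := by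
        apply Real.sqrt_le_iff.2
        refine ⟨by positivity, ?_⟩
        nlinarith [mul_nonneg (norm_nonneg (p x₀)) hδ.le]
      have e3 := Real.sqrt_nonneg (‖p x₁‖ ^ 2 + δ ^ 2)
      rw [e1] at key
      linarith
    · intro y hy
      have hy' : y ∈ Set.Ico x₀ x₁ := ⟨hy.1.le, hy.2⟩
      have h1 : inner ℝ (p y) (f y) ≤ ‖p y‖ * F y :=
        (real_inner_le_norm _ _).trans (mul_le_mul_of_nonneg_left (hf y hy') (norm_nonneg _))
      have h2 := hmu y hy'
      have hF0 : 0 ≤ F y := (norm_nonneg _).trans (hf y hy')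
      set s := Real.sqrt (‖p y‖ ^ 2 + δ ^ 2) with hs
      have hs0 : 0 < s := Real.sqrt_pos.2 (hpos y)
      have hss : s ^ 2 = ‖p y‖ ^ 2 + δ ^ 2 := Real.sq_sqrt (hpos y).le
      have hs1 : ‖p y‖ ≤ s := Real.le_sqrt_of_sq_le (by nlinarith)
      have hs2 : δ ≤ s := Real.le_sqrt_of_sq_le (by nlinarith [sq_nonneg ‖p y‖])
      rw [div_le_iff₀ (by positivity)]
      have h3 : ‖p y‖ * F y ≤ s * F y := by gcongr
      have h4 : (mu y).re * ‖p y‖ ^ 2 ≥ r * ‖p y‖ ^ 2 := by gcongr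
      have h5 : r * (s ^ 2 - δ ^ 2) = r * ‖p y‖ ^ 2 := by rw [hss]; ring
      have h6 : r * (s * ‖p y‖) ≤ r * (s ^ 2) := by
        have : s * ‖p y‖ ≤ s ^ 2 := by nlinarith
        gcongr
      have h7 : r * δ ^ 2 ≤ r * (δ * s) := by
        have : δ ^ 2 ≤ δ * s := by nlinarith
        gcongr
      nlinarith
  refine le_of_forall_pos_le_add fun η hη => ?_
  have hden : 0 < 1 + r * (x₁ - x₀) := by
    have := mul_nonneg hr.le (sub_nonneg.2 h01); linarith
  refine (main (η / (1 + r * (x₁ - x₀))) (by positivity)).trans (le_of_eq ?_)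
  field_simp

/-- The fundamental inequality of calculus for right derivatives with an integrable bound. -/
theorem norm_sub_le_integral_of_right_deriv {f f' : ℝ → ℂ} {F : ℝ → ℝ} {a b : ℝ} (hab : a ≤ b)
    (hc : ContinuousOn f (Set.Icc a b))
    (hd : ∀ x ∈ Set.Ico a b, HasDerivWithinAt f (f' x) (Set.Ici x) x)
    (hf : ∀ x ∈ Set.Ico a b, ‖f' x‖ ≤ F x) (hF : IntervalIntegrable F volume a b) :
    ‖f b - f a‖ ≤ ∫ x in a..b, F x := by
  set z := f b - f a with hz
  rcases eq_or_ne z 0 with h0 | h0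
  · rw [h0, norm_zero]
    refine intervalIntegral.integral_nonneg_of_ae_restrict hab ?_
    have : ∀ᵐ x ∂(volume.restrict (Set.Icc a b)), x ≠ b := by
      refine ae_restrict_of_ae ?_
      simp [ae_iff]
    filter_upwards [this, ae_restrict_mem measurableSet_Icc] with x hx hx'
    exact (norm_nonneg _).trans (hf x ⟨hx'.1, lt_of_le_of_ne hx'.2 hx⟩)
  -- project onto the direction of the total increment, and integrate the real-valued inequality
  have key := intervalIntegral.sub_le_integral_of_hasDeriv_right_of_le hab
    (g := fun y => inner ℝ z (f y)) (g' := fun y => inner ℝ z (f' y))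
    (φ := fun x => ‖z‖ * F x) (by fun_prop)
    (fun y hy => by
      have := ((hasDerivWithinAt_const y (Set.Ici y) z).inner ℝ (hd y ⟨hy.1.le, hy.2⟩))
      simpa using this.mono Set.Ioi_subset_Ici_self)
    ((intervalIntegrable_iff_integrableOn_Icc_of_le hab).1 (hF.const_mul _))
    (fun y hy => (real_inner_le_norm _ _).trans
      (mul_le_mul_of_nonneg_left (hf y ⟨hy.1.le, hy.2⟩) (norm_nonneg _)))
  rw [← inner_sub_right, ← hz, real_inner_self_eq_norm_sq, intervalIntegral.integral_const_mul,
    sq] at key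
  exact le_of_mul_le_mul_left key (norm_pos_iff.2 h0)

/-! ### WKB amplitudes -/

/-- `φ` is continuously differentiable with derivative `φ'`, and `φ'` is bounded by `B` both
uniformly and in `L¹`. -/
structure SlowPotential (φ φ' : ℝ → ℝ) (B : ℝ) : Prop where
  hasDerivAt : ∀ x, HasDerivAt φ (φ' x) x
  continuous_deriv : Continuous φ'
  bound : ∀ x, |φ' x| ≤ B
  integral_bound : ∀ x₀ x₁, x₀ ≤ x₁ → ∫ x in x₀..x₁, |φ' x| ≤ B

/-- `q` is a differentiable branch of `√(Λ - φ)` in the right half plane, of size comparable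
to `r`. -/
structure RootBranch (φ φ' : ℝ → ℝ) (Λ : ℂ) (q : ℝ → ℂ) (r Q : ℝ) : Prop where
  sq : ∀ x, q x ^ 2 = Λ - φ x
  hasDerivAt : ∀ x, HasDerivAt q (-(φ' x : ℂ) / (2 * q x)) x
  le_re : ∀ x, r ≤ (q x).re
  norm_le : ∀ x, ‖q x‖ ≤ Q * r

/-- `w` solves `w'' = (Λ - φ) w`, with derivative `v`. -/
structure ScalarSolution (φ : ℝ → ℝ) (Λ : ℂ) (w v : ℝ → ℂ) : Prop where
  hasDerivAt : ∀ x, HasDerivAt w (v x) x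
  hasDerivAt' : ∀ x, HasDerivAt v ((Λ - φ x) * w x) x

namespace RootBranch
variable {φ φ' : ℝ → ℝ} {Λ : ℂ} {q : ℝ → ℂ} {r Q B : ℝ}

theorem le_norm (hq : RootBranch φ φ' Λ q r Q) (x : ℝ) : r ≤ ‖q x‖ :=
  (hq.le_re x).trans (Complex.re_le_norm _)

theorem ne_zero (hq : RootBranch φ φ' Λ q r Q) (hr : 0 < r) (x : ℝ) : q x ≠ 0 :=
  norm_pos_iff.1 (hr.trans_le (hq.le_norm x))

theorem continuous (hq : RootBranch φ φ' Λ q r Q) : Continuous q :=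
  continuous_iff_continuousAt.2 fun x => (hq.hasDerivAt x).continuousAt

theorem norm_gamma_le (hq : RootBranch φ φ' Λ q r Q) (hr : 0 < r) (x : ℝ) :
    ‖-(φ' x : ℂ) / (4 * q x ^ 2)‖ ≤ |φ' x| / (4 * r ^ 2) := by
  rw [norm_div, norm_neg, norm_mul, norm_pow, Complex.norm_real, Real.norm_eq_abs]
  have := hq.le_norm x
  norm_num
  gcongr

/-- The root `q` differs from a root `κ` of `Λ - m` by `O((φ - m) / r)`. -/
theorem norm_sub_le (hq : RootBranch φ φ' Λ q r Q) (hr : 0 < r) {κ : ℂ} {m : ℝ}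
    (hκ : κ ^ 2 = Λ - m) (hκr : r ≤ κ.re) (x : ℝ) :
    ‖q x - κ‖ ≤ |φ x - m| / (2 * r) := by
  have h1 : (q x - κ) * (q x + κ) = -((φ x - m : ℝ) : ℂ) := by
    push_cast
    linear_combination hq.sq x - hκ
  have h2 : 2 * r ≤ ‖q x + κ‖ := by
    refine le_trans ?_ (Complex.re_le_norm _)
    have := hq.le_re x
    simp only [Complex.add_re]; linarith
  rw [le_div_iff₀ (by positivity)]
  have h3 : ‖q x - κ‖ * ‖q x + κ‖ = |φ x - m| := by
    rw [← norm_mul, h1, norm_neg, Complex.norm_real, Real.norm_eq_abs]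
  rw [← h3]
  gcongr

end RootBranch

/-- The growing WKB amplitude `e^{-∫ q} (w' + q w)`. -/
noncomputable def wkbGrow (q w v : ℝ → ℂ) (x : ℝ) : ℂ :=
  Complex.exp (-∫ y in (0 : ℝ)..x, q y) * (v x + q x * w x)

/-- The decaying WKB amplitude `e^{-∫ q} (w' - q w)`, measured on the scale of the growing one. -/
noncomputable def wkbDecay (q w v : ℝ → ℂ) (x : ℝ) : ℂ :=
  Complex.exp (-∫ y in (0 : ℝ)..x, q y) * (v x - q x * w x)

section
variable {φ φ' : ℝ → ℝ} {Λ : ℂ} {q w v : ℝ → ℂ} {r Q B : ℝ}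

/-- The WKB amplitudes satisfy a diagonal system up to a coupling `φ' / (4 q²)`. -/
theorem hasDerivAt_wkb (hq : RootBranch φ φ' Λ q r Q) (hr : 0 < r)
    (hw : ScalarSolution φ Λ w v) (x : ℝ) :
    HasDerivAt (wkbGrow q w v)
        (-(φ' x : ℂ) / (4 * q x ^ 2) * (wkbGrow q w v x - wkbDecay q w v x)) x ∧
      HasDerivAt (wkbDecay q w v) (-(2 * q x) * wkbDecay q w v x
        + -(-(φ' x : ℂ) / (4 * q x ^ 2) * (wkbGrow q w v x - wkbDecay q w v x))) x := by
  have hE : HasDerivAt (fun x => Complex.exp (-∫ y in (0 : ℝ)..x, q y))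
      (Complex.exp (-∫ y in (0 : ℝ)..x, q y) * -(q x)) x :=
    (hq.continuous.integral_hasStrictDerivAt 0 x).hasDerivAt.neg.cexp
  have h0 := hq.ne_zero hr x
  have hs := hq.sq x
  have hqw := (hq.hasDerivAt x).mul (hw.hasDerivAt x)
  constructor
  · refine (hE.mul ((hw.hasDerivAt' x).add hqw)).congr_deriv ?_
    simp only [wkbGrow, wkbDecay, Pi.add_apply, Pi.mul_apply]
    rw [← hs]
    field_simp
    ring
  · refine (hE.mul ((hw.hasDerivAt' x).sub hqw)).congr_deriv ?_
    simp only [wkbGrow, wkbDecay, Pi.sub_apply, Pi.mul_apply]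
    rw [← hs]
    field_simp
    ring

theorem wkbGrow_sub_wkbDecay_ne_zero_iff (hq : RootBranch φ φ' Λ q r Q) (hr : 0 < r) (x : ℝ) :
    wkbGrow q w v x - wkbDecay q w v x ≠ 0 ↔ w x ≠ 0 := by
  have h0 := hq.ne_zero hr x
  have : wkbGrow q w v x - wkbDecay q w v x =
      Complex.exp (-∫ y in (0 : ℝ)..x, q y) * (2 * q x) * w x := by
    simp only [wkbGrow, wkbDecay]; ring
  rw [this]
  simp [Complex.exp_ne_zero, h0]

/-- The two WKB amplitudes are bounded by their initial size: the system they satisfy is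
damped up to a coupling of size `φ' / q²`. -/
theorem wkb_energy_le (hφ : SlowPotential φ φ' B) (hq : RootBranch φ φ' Λ q r Q) (hr : 0 < r)
    (hw : ScalarSolution φ Λ w v) {x₀ x : ℝ} (hx : x₀ ≤ x) :
    ‖wkbGrow q w v x‖ ^ 2 + ‖wkbDecay q w v x‖ ^ 2 ≤
      Real.exp (B / r ^ 2) * (‖wkbGrow q w v x₀‖ ^ 2 + ‖wkbDecay q w v x₀‖ ^ 2) := by
  set S := wkbGrow q w v
  set P := wkbDecay q w v
  have hS := fun x => (hasDerivAt_wkb hq hr hw x).1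
  have hP := fun x => (hasDerivAt_wkb hq hr hw x).2
  have hE : ∀ y : ℝ, HasDerivAt (fun y => Real.exp (-((1 / r ^ 2) * ∫ t in x₀..y, |φ' t|)))
      (Real.exp (-((1 / r ^ 2) * ∫ t in x₀..y, |φ' t|)) * -((1 / r ^ 2) * |φ' y|)) y := fun y =>
    ((hφ.continuous_deriv.abs.integral_hasStrictDerivAt x₀ y).hasDerivAt.const_mul _).neg.exp
  have hN : ∀ y, HasDerivAt (fun y => ‖S y‖ ^ 2 + ‖P y‖ ^ 2) _ y := fun y =>
    (hS y).norm_sq.add (hP y).norm_sq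
  have hNE := fun y => (hN y).mul (hE y)
  have hanti : Antitone (fun y => (‖S y‖ ^ 2 + ‖P y‖ ^ 2) *
      Real.exp (-((1 / r ^ 2) * ∫ t in x₀..y, |φ' t|))) := by
    refine antitone_of_hasDerivAt_nonpos hNE fun y => ?_
    set e := Real.exp (-((1 / r ^ 2) * ∫ t in x₀..y, |φ' t|))
    set γ := -(φ' y : ℂ) / (4 * q y ^ 2) with hγ
    have hγ' : ‖γ‖ ≤ |φ' y| / (4 * r ^ 2) := hq.norm_gamma_le hr y
    have he : 0 < e := Real.exp_pos _
    have h1 : inner ℝ (S y) (γ * (S y - P y)) ≤ ‖S y‖ * (‖γ‖ * (‖S y‖ + ‖P y‖)) := by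
      refine (real_inner_le_norm _ _).trans ?_
      rw [norm_mul]
      gcongr
      exact norm_sub_le _ _
    have h2 : inner ℝ (P y) (-(γ * (S y - P y))) ≤ ‖P y‖ * (‖γ‖ * (‖S y‖ + ‖P y‖)) := by
      refine (real_inner_le_norm _ _).trans ?_
      rw [norm_neg, norm_mul]
      gcongr
      exact norm_sub_le _ _
    have h3 : inner ℝ (P y) (-(2 * q y) * P y) ≤ 0 := by
      have : inner ℝ (P y) (-(2 * q y) * P y) = -(2 * (q y).re) * ‖P y‖ ^ 2 := by
        rw [Complex.inner, ← Complex.normSq_eq_norm_sq, Complex.normSq_apply]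
        simp; ring
      rw [this]
      have := hq.le_re y
      nlinarith [sq_nonneg ‖P y‖]
    rw [inner_add_right]
    have h4 : ‖γ‖ * (‖S y‖ + ‖P y‖) ^ 2 ≤ ‖γ‖ * (2 * (‖S y‖ ^ 2 + ‖P y‖ ^ 2)) := by
      gcongr
      nlinarith [sq_nonneg (‖S y‖ - ‖P y‖)]
    have h5 : ‖γ‖ * (‖S y‖ ^ 2 + ‖P y‖ ^ 2) ≤
        |φ' y| / (4 * r ^ 2) * (‖S y‖ ^ 2 + ‖P y‖ ^ 2) := by gcongr
    have h6 : 1 / r ^ 2 * |φ' y| = 4 * (|φ' y| / (4 * r ^ 2)) := by field_simp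
    rw [h6]
    set d := |φ' y| / (4 * r ^ 2)
    change _ ≤ (0 : ℝ)
    have h7 : 2 * inner ℝ (S y) (γ * (S y - P y)) +
        2 * (inner ℝ (P y) (-(2 * q y) * P y) + inner ℝ (P y) (-(γ * (S y - P y))))
        - 4 * d * (‖S y‖ ^ 2 + ‖P y‖ ^ 2) ≤ 0 := by nlinarith
    calc _ = e * (2 * inner ℝ (S y) (γ * (S y - P y)) +
        2 * (inner ℝ (P y) (-(2 * q y) * P y) + inner ℝ (P y) (-(γ * (S y - P y))))
        - 4 * d * (‖S y‖ ^ 2 + ‖P y‖ ^ 2)) := by ring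
      _ ≤ 0 := mul_nonpos_of_nonneg_of_nonpos he.le h7
  have key := hanti hx
  simp only [intervalIntegral.integral_same, mul_zero, neg_zero, Real.exp_zero, mul_one] at key
  have hI := hφ.integral_bound x₀ x hx
  have h1 : Real.exp (-(B / r ^ 2)) ≤ Real.exp (-((1 / r ^ 2) * ∫ t in x₀..x, |φ' t|)) := by
    apply Real.exp_le_exp.2
    rw [neg_le_neg_iff, one_div, inv_mul_eq_div]
    gcongr
  have h2 : (‖S x‖ ^ 2 + ‖P x‖ ^ 2) * Real.exp (-(B / r ^ 2)) ≤ ‖S x₀‖ ^ 2 + ‖P x₀‖ ^ 2 :=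
    (mul_le_mul_of_nonneg_left h1 (by positivity)).trans key
  rw [Real.exp_neg, ← div_eq_mul_inv, div_le_iff₀ (Real.exp_pos _)] at h2
  linarith

end

/-! ### The solution normalised at minus infinity -/

section
variable {φ φ' : ℝ → ℝ} {Λ κ : ℂ} {q w v : ℝ → ℂ} {r Q B m : ℝ}

theorem RootBranch.tendsto (hq : RootBranch φ φ' Λ q r Q) (hr : 0 < r) (hκ : κ ^ 2 = Λ - m)
    (hκr : r ≤ κ.re) {l : Filter ℝ} (hm : Tendsto φ l (𝓝 m)) : Tendsto q l (𝓝 κ) := by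
  rw [tendsto_iff_norm_sub_tendsto_zero]
  have h1 : Tendsto (fun x => |φ x - m| / (2 * r)) l (𝓝 0) := by
    have := ((hm.sub_const m).abs).div_const (2 * r)
    simpa using this
  exact squeeze_zero (fun _ => norm_nonneg _) (fun x => hq.norm_sub_le hr hκ hκr x) h1

/-- The limits of the WKB amplitudes at `-∞` for the normalised solution. The exponent
`∫ (q - κ)` accounts for the change of normalisation from `e^{κ x}` to `e^{∫ q}`. -/
theorem tendsto_wkb (hq : RootBranch φ φ' Λ q r Q) (hr : 0 < r)
    (hκ : κ ^ 2 = Λ - m) (hκr : r ≤ κ.re) (hm : Tendsto φ atBot (𝓝 m))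
    (hi : IntegrableOn (fun x => φ x - m) (Set.Iic 0))
    (hw1 : Tendsto (fun x : ℝ => Complex.exp (-(κ * x)) * w x) atBot (𝓝 1))
    (hv1 : Tendsto (fun x : ℝ => Complex.exp (-(κ * x)) * v x) atBot (𝓝 κ)) :
    IntegrableOn (fun x => q x - κ) (Set.Iic 0) ∧
    Tendsto (wkbGrow q w v) atBot
      (𝓝 (Complex.exp (∫ x in Set.Iic 0, (q x - κ)) * (2 * κ))) ∧
    Tendsto (wkbDecay q w v) atBot (𝓝 0) := by
  have hqi : IntegrableOn (fun x => q x - κ) (Set.Iic 0) := by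
    refine Integrable.mono' (hi.abs.div_const (2 * r))
      (hq.continuous.sub continuous_const).aestronglyMeasurable ?_
    exact Eventually.of_forall fun x => hq.norm_sub_le hr hκ hκr x
  have hE : Tendsto (fun x : ℝ => Complex.exp (∫ y in x..(0 : ℝ), (q y - κ))) atBot
      (𝓝 (Complex.exp (∫ x in Set.Iic 0, (q x - κ)))) :=
    (Complex.continuous_exp.tendsto _).comp
      (intervalIntegral_tendsto_integral_Iic 0 hqi tendsto_id)
  have hqt := hq.tendsto hr hκ hκr hm
  have hexp : ∀ x : ℝ, Complex.exp (-∫ y in (0 : ℝ)..x, q y) =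
      Complex.exp (∫ y in x..(0 : ℝ), (q y - κ)) * Complex.exp (-(κ * x)) := by
    intro x
    rw [← Complex.exp_add, intervalIntegral.integral_sub (hq.continuous.intervalIntegrable _ _)
      intervalIntegrable_const, intervalIntegral.integral_symm x 0,
      intervalIntegral.integral_const]
    congr 1
    simp
    ring
  refine ⟨hqi, ?_, ?_⟩
  · have h := hE.mul (hv1.add (hqt.mul hw1))
    rw [mul_one, ← two_mul] at h
    refine h.congr fun x => ?_
    rw [wkbGrow, hexp x]; ring
  · have h := hE.mul (hv1.sub (hqt.mul hw1))
    rw [mul_one, sub_self, mul_zero] at h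
    refine h.congr fun x => ?_
    rw [wkbDecay, hexp x]; ring

/-- Size of the WKB amplitudes of the solution normalised at `-∞`, relative to the limit `s` of the
growing one. -/
theorem wkb_amplitude_bounds (hφ : SlowPotential φ φ' B) (hq : RootBranch φ φ' Λ q r Q)
    (hw : ScalarSolution φ Λ w v) (hB : 1 ≤ B) (hr : 20 * B ≤ r) {s : ℂ}
    (hS : Tendsto (wkbGrow q w v) atBot (𝓝 s)) (hP : Tendsto (wkbDecay q w v) atBot (𝓝 0)) :
    (∀ x, ‖wkbGrow q w v x - s‖ ≤ B * ‖s‖ / r ^ 2) ∧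
    (∀ x, ‖wkbDecay q w v x‖ ≤ B * ‖s‖ / (2 * r ^ 3)) ∧
    (∀ x₀ x₁, x₀ ≤ x₁ → ∫ x in x₀..x₁, ‖wkbDecay q w v x‖ ≤ B * ‖s‖ / (2 * r ^ 3)) := by
  have hr0 : 0 < r := by linarith
  have hr1 : 1 ≤ r := by linarith
  have hd := fun x => (hasDerivAt_wkb hq hr0 hw x)
  have henergy : ∀ x, ‖wkbGrow q w v x‖ ^ 2 + ‖wkbDecay q w v x‖ ^ 2 ≤ (2 * ‖s‖) ^ 2 := by
    intro x
    have hlim : Tendsto (fun x₀ => Real.exp (B / r ^ 2) *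
        (‖wkbGrow q w v x₀‖ ^ 2 + ‖wkbDecay q w v x₀‖ ^ 2)) atBot
        (𝓝 (Real.exp (B / r ^ 2) * (‖s‖ ^ 2 + ‖(0 : ℂ)‖ ^ 2))) :=
      ((hS.norm.pow 2).add (hP.norm.pow 2)).const_mul _
    have h1 : ‖wkbGrow q w v x‖ ^ 2 + ‖wkbDecay q w v x‖ ^ 2 ≤
        Real.exp (B / r ^ 2) * (‖s‖ ^ 2 + ‖(0 : ℂ)‖ ^ 2) :=
      ge_of_tendsto hlim ((eventually_le_atBot x).mono fun x₀ hx₀ =>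
        wkb_energy_le hφ hq hr0 hw hx₀)
    have h2 : Real.exp (B / r ^ 2) ≤ 4 := by
      have : B / r ^ 2 ≤ 1 := by rw [div_le_one (by positivity)]; nlinarith
      have := Real.exp_le_exp.2 this
      have := Real.exp_one_lt_d9
      linarith
    rw [norm_zero] at h1
    nlinarith [sq_nonneg ‖s‖]
  have hsize : ∀ x, ‖wkbGrow q w v x - wkbDecay q w v x‖ ≤ 4 * ‖s‖ := by
    intro x
    have h1 : ‖wkbGrow q w v x‖ ≤ 2 * ‖s‖ :=
      abs_le_of_sq_le_sq' (by nlinarith [henergy x, sq_nonneg ‖wkbDecay q w v x‖])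
        (by positivity) |>.2
    have h2 : ‖wkbDecay q w v x‖ ≤ 2 * ‖s‖ :=
      abs_le_of_sq_le_sq' (by nlinarith [henergy x, sq_nonneg ‖wkbGrow q w v x‖])
        (by positivity) |>.2
    linarith [norm_sub_le (wkbGrow q w v x) (wkbDecay q w v x)]
  have hforce : ∀ x, ‖-(φ' x : ℂ) / (4 * q x ^ 2) * (wkbGrow q w v x - wkbDecay q w v x)‖ ≤
      ‖s‖ / r ^ 2 * |φ' x| := by
    intro x
    rw [norm_mul]
    calc _ ≤ |φ' x| / (4 * r ^ 2) * (4 * ‖s‖) := by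
          gcongr
          · exact hq.norm_gamma_le hr0 x
          · exact hsize x
      _ = _ := by field_simp
  have hFi : ∀ x₀ x₁, IntervalIntegrable (fun x => ‖s‖ / r ^ 2 * |φ' x|) volume x₀ x₁ :=
    fun x₀ x₁ => (continuous_const.mul hφ.continuous_deriv.abs).intervalIntegrable _ _
  have hFint : ∀ x₀ x₁, x₀ ≤ x₁ → ∫ x in x₀..x₁, ‖s‖ / r ^ 2 * |φ' x| ≤ B * ‖s‖ / r ^ 2 := by
    intro x₀ x₁ h
    rw [intervalIntegral.integral_const_mul]
    calc _ ≤ ‖s‖ / r ^ 2 * B := by gcongr; exact hφ.integral_bound _ _ h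
      _ = _ := by ring
  have hcS : Continuous (wkbGrow q w v) :=
    continuous_iff_continuousAt.2 fun x => (hd x).1.continuousAt
  have hcP : Continuous (wkbDecay q w v) :=
    continuous_iff_continuousAt.2 fun x => (hd x).2.continuousAt
  have hre : ∀ x, 2 * r ≤ (2 * q x).re := by
    intro x
    have := hq.le_re x
    simp; linarith
  refine ⟨fun x => ?_, fun x => ?_, fun x₀ x₁ h01 => ?_⟩
  · refine le_of_tendsto (tendsto_const_nhds.sub hS).norm
      ((eventually_le_atBot x).mono fun x₀ hx₀ => ?_)
    exact (norm_sub_le_integral_of_right_deriv hx₀ hcS.continuousOn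
      (fun y _ => (hd y).1.hasDerivWithinAt) (fun y _ => hforce y) (hFi _ _)).trans
      (hFint _ _ hx₀)
  · have hlim : Tendsto (fun x₀ => ‖wkbDecay q w v x₀‖ + B * ‖s‖ / r ^ 2 / (2 * r)) atBot
        (𝓝 (‖(0 : ℂ)‖ + B * ‖s‖ / r ^ 2 / (2 * r))) := hP.norm.add_const _
    have h1 := ge_of_tendsto hlim ((eventually_le_atBot x).mono fun x₀ hx₀ =>
      norm_le_of_damped (F := B * ‖s‖ / r ^ 2) (r := 2 * r) (by positivity) (by positivity)
        hcP.continuousOn (fun y _ => (hd y).2.hasDerivWithinAt) (fun y _ => hre y)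
        (fun y _ => ?_) ⟨hx₀, le_refl x⟩)
    · refine h1.trans (le_of_eq ?_)
      rw [norm_zero]; field_simp; ring
    · rw [norm_neg]
      refine (hforce y).trans ?_
      calc _ ≤ ‖s‖ / r ^ 2 * B := by gcongr; exact hφ.bound y
        _ = _ := by ring
  · have hlim : Tendsto (fun z => (‖wkbDecay q w v z‖ + B * ‖s‖ / r ^ 2) / (2 * r)) atBot
        (𝓝 ((‖(0 : ℂ)‖ + B * ‖s‖ / r ^ 2) / (2 * r))) := (hP.norm.add_const _).div_const _
    have h1 := ge_of_tendsto (b := ∫ x in x₀..x₁, ‖wkbDecay q w v x‖) hlim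
      ((eventually_le_atBot x₀).mono fun z hz => ?_)
    · refine h1.trans (le_of_eq ?_)
      rw [norm_zero]; field_simp; ring
    · rw [le_div_iff₀ (by positivity)]
      have h2 := integral_norm_le_of_damped (r := 2 * r) (by positivity) (hz.trans h01)
        hcP.continuousOn (fun y _ => (hd y).2.hasDerivWithinAt) (fun y _ => hre y)
        (fun y _ => by rw [norm_neg]; exact hforce y) (hFi _ _)
      have h3 := hFint z x₁ (hz.trans h01)
      have h4 : ∫ x in x₀..x₁, ‖wkbDecay q w v x‖ ≤ ∫ x in z..x₁, ‖wkbDecay q w v x‖ := by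
        rw [← intervalIntegral.integral_add_adjacent_intervals
          (hcP.norm.intervalIntegrable z x₀) (hcP.norm.intervalIntegrable x₀ x₁)]
        have := intervalIntegral.integral_nonneg (f := fun x => ‖wkbDecay q w v x‖) (μ := volume)
          hz fun _ _ => norm_nonneg _
        linarith
      nlinarith

/-- The solution normalised at `-∞` has no zero, its logarithmic derivative is `q + O(r⁻²)` both
uniformly and in `L¹`, and its value at `0` is `1 + O(r⁻¹)`. -/
theorem wkb_left (hφ : SlowPotential φ φ' B) (hq : RootBranch φ φ' Λ q r Q)
    (hw : ScalarSolution φ Λ w v) (hB : 1 ≤ B) (hr : 20 * B ≤ r)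
    (hκ : κ ^ 2 = Λ - m) (hκr : r ≤ κ.re) (hm : Tendsto φ atBot (𝓝 m))
    (hi : IntegrableOn (fun x => φ x - m) (Set.Iic 0))
    (hiB : ∫ x in Set.Iic 0, |φ x - m| ≤ B) (hφm : |φ 0 - m| ≤ 2 * B)
    (hw1 : Tendsto (fun x : ℝ => Complex.exp (-(κ * x)) * w x) atBot (𝓝 1))
    (hv1 : Tendsto (fun x : ℝ => Complex.exp (-(κ * x)) * v x) atBot (𝓝 κ)) :
    (∀ x, w x ≠ 0) ∧ (∀ x, ‖v x / w x - q x‖ ≤ 2 * Q * B / r ^ 2) ∧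
    (∀ x₀ x₁, x₀ ≤ x₁ → ∫ x in x₀..x₁, ‖v x / w x - q x‖ ≤ 2 * Q * B / r ^ 2) ∧
    ‖w 0 - 1‖ ≤ 20 * B / r := by
  have hr0 : 0 < r := by linarith
  have hr1 : 1 ≤ r := by linarith
  obtain ⟨hqi, hS, hP⟩ := tendsto_wkb hq hr0 hκ hκr hm hi hw1 hv1
  set I := ∫ x in Set.Iic 0, (q x - κ) with hI
  set s := Complex.exp I * (2 * κ) with hs
  obtain ⟨b1, b2, b3⟩ := wkb_amplitude_bounds hφ hq hw hB hr hS hP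
  have hκ0 : κ ≠ 0 := by
    intro h; rw [h] at hκr; simp at hκr; linarith
  have hs0 : 0 < ‖s‖ := by
    rw [norm_pos_iff, hs]
    simp [Complex.exp_ne_zero, hκ0]
  have hBr2 : B / r ^ 2 ≤ 1 / 20 := by
    rw [div_le_iff₀ (by positivity)]; nlinarith
  have hBr3 : B / (2 * r ^ 3) ≤ B / r ^ 2 / 2 := by
    rw [div_div]
    refine div_le_div_of_nonneg_left (by linarith) (by positivity) ?_
    nlinarith [mul_nonneg (sq_nonneg r) (sub_nonneg.2 hr1)]
  have hc1 : ∀ x, ‖wkbGrow q w v x - s‖ ≤ B / r ^ 2 * ‖s‖ := fun x =>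
    (b1 x).trans_eq (by ring)
  have hc2 : ∀ x, ‖wkbDecay q w v x‖ ≤ B / r ^ 2 / 2 * ‖s‖ := fun x =>
    (b2 x).trans (by rw [mul_div_right_comm]; gcongr)
  have hlow : ∀ x, ‖s‖ / 2 ≤ ‖wkbGrow q w v x - wkbDecay q w v x‖ := by
    intro x
    have h1 : ‖s‖ ≤ ‖wkbGrow q w v x - wkbDecay q w v x‖ + ‖wkbGrow q w v x - s‖
        + ‖wkbDecay q w v x‖ := by
      have : s = (wkbGrow q w v x - wkbDecay q w v x) - (wkbGrow q w v x - s)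
        + wkbDecay q w v x := by ring
      calc ‖s‖ = ‖(wkbGrow q w v x - wkbDecay q w v x) - (wkbGrow q w v x - s)
            + wkbDecay q w v x‖ := by rw [← this]
        _ ≤ _ := (norm_add_le _ _).trans (add_le_add_left (norm_sub_le _ _) _)
    have := hc1 x
    have := hc2 x
    nlinarith
  have hw0 : ∀ x, w x ≠ 0 := fun x => by
    rw [← wkbGrow_sub_wkbDecay_ne_zero_iff (v := v) hq hr0 x, ← norm_pos_iff]
    linarith [hlow x]
  have hrho : ∀ x, ‖v x / w x - q x‖ ≤ 4 * Q * r / ‖s‖ * ‖wkbDecay q w v x‖ := by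
    intro x
    have hne := norm_pos_iff.1 (lt_of_lt_of_le (by positivity) (hlow x))
    have h1 : v x / w x - q x =
        2 * q x * wkbDecay q w v x / (wkbGrow q w v x - wkbDecay q w v x) := by
      have h2 : wkbGrow q w v x - wkbDecay q w v x =
          Complex.exp (-∫ y in (0 : ℝ)..x, q y) * (2 * q x) * w x := by
        simp only [wkbGrow, wkbDecay]; ring
      rw [eq_div_iff hne, h2, wkbDecay]
      have := hw0 x
      field_simp
    rw [h1, norm_div, norm_mul, norm_mul, div_le_iff₀ (norm_pos_iff.2 hne)]
    have h3 := hq.norm_le x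
    have h4 := hlow x
    have hQ : 0 ≤ Q * r := (norm_nonneg _).trans h3
    norm_num
    calc 2 * ‖q x‖ * ‖wkbDecay q w v x‖ ≤ 2 * (Q * r) * ‖wkbDecay q w v x‖ := by gcongr
      _ = 4 * Q * r / ‖s‖ * ‖wkbDecay q w v x‖ * (‖s‖ / 2) := by field_simp; ring
      _ ≤ _ := by
        have : 0 ≤ 4 * Q * r / ‖s‖ * ‖wkbDecay q w v x‖ := by
          have : 4 * Q * r / ‖s‖ = 4 * (Q * r) / ‖s‖ := by ring
          rw [this]; positivity
        gcongr
  have hQr : 0 ≤ Q * r := (norm_nonneg _).trans (hq.norm_le 0)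
  have hQ0 : 0 ≤ Q := nonneg_of_mul_nonneg_left hQr hr0
  have hconst : 4 * Q * r / ‖s‖ * (B * ‖s‖ / (2 * r ^ 3)) = 2 * Q * B / r ^ 2 := by
    field_simp; ring
  refine ⟨hw0, fun x => ?_, fun x₀ x₁ h01 => ?_, ?_⟩
  · refine (hrho x).trans ?_
    rw [← hconst]
    gcongr
    exact b2 x
  · have hcw : Continuous w := continuous_iff_continuousAt.2 fun x => (hw.hasDerivAt x).continuousAt
    have hcv : Continuous v := continuous_iff_continuousAt.2 fun x => (hw.hasDerivAt' x).continuousAt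
    have hcP : Continuous (wkbDecay q w v) :=
      continuous_iff_continuousAt.2 fun x => (hasDerivAt_wkb hq hr0 hw x).2.continuousAt
    have h1 : ∫ x in x₀..x₁, ‖v x / w x - q x‖ ≤
        ∫ x in x₀..x₁, 4 * Q * r / ‖s‖ * ‖wkbDecay q w v x‖ :=
      intervalIntegral.integral_mono_on h01
        (((hcv.div hcw hw0).sub hq.continuous).norm.intervalIntegrable _ _)
        ((continuous_const.mul hcP.norm).intervalIntegrable _ _) fun x _ => hrho x
    refine h1.trans ?_
    rw [intervalIntegral.integral_const_mul, ← hconst]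
    gcongr
    exact b3 _ _ h01
  · have hq0 := hq.ne_zero hr0 0
    -- `w 0` is the product of the three factors `1 + e₁`, `κ / q 0` and `exp I`
    set e₁ := (wkbGrow q w v 0 - wkbDecay q w v 0) / s - 1 with he₁
    have hs0' : s ≠ 0 := norm_pos_iff.1 hs0
    have hprod : w 0 = (1 + e₁) * (κ / q 0) * Complex.exp I := by
      have h2 : wkbGrow q w v 0 - wkbDecay q w v 0 = (2 * q 0) * w 0 := by
        simp only [wkbGrow, wkbDecay, intervalIntegral.integral_same]; simp; ring
      have h3 := Complex.exp_ne_zero I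
      rw [he₁, h2, hs]
      field_simp
      ring
    have hx : B / r ^ 2 ≤ B / r := by gcongr; nlinarith
    have hBr : B / r ≤ 1 / 20 := by rw [div_le_iff₀ hr0]; linarith
    have h1 : ‖e₁‖ ≤ 2 * (B / r) := by
      have : e₁ = ((wkbGrow q w v 0 - s) - wkbDecay q w v 0) / s := by
        rw [he₁]; field_simp; ring
      rw [this, norm_div, div_le_iff₀ hs0]
      have := hc1 0
      have := hc2 0
      have := norm_sub_le (wkbGrow q w v 0 - s) (wkbDecay q w v 0)
      have : B / r ^ 2 * ‖s‖ ≤ B / r * ‖s‖ := by gcongr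
      have : 0 ≤ B / r * ‖s‖ := by positivity
      linarith
    have h2 : ‖κ / q 0 - 1‖ ≤ B / r := by
      have h3 : κ / q 0 - 1 = -((q 0 - κ) / q 0) := by field_simp; ring
      rw [h3, norm_neg, norm_div, div_le_iff₀ (norm_pos_iff.2 hq0)]
      have h4 : |φ 0 - m| / (2 * r) ≤ 2 * B / (2 * r) := by gcongr
      have h5 : 2 * B / (2 * r) = B / r := by field_simp
      have h6 : 1 ≤ ‖q 0‖ := hr1.trans (hq.le_norm 0)
      have h7 := hq.norm_sub_le hr0 hκ hκr 0
      have h8 : B / r * 1 ≤ B / r * ‖q 0‖ := by gcongr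
      linarith
    have hIn : ‖I‖ ≤ B / (2 * r) := by
      calc ‖I‖ ≤ ∫ x in Set.Iic 0, ‖q x - κ‖ := norm_integral_le_integral_norm _
        _ ≤ ∫ x in Set.Iic 0, |φ x - m| / (2 * r) := by
          refine integral_mono hqi.norm (hi.abs.div_const _) fun x => ?_
          exact hq.norm_sub_le hr0 hκ hκr x
        _ = (∫ x in Set.Iic 0, |φ x - m|) / (2 * r) := integral_div _ _
        _ ≤ _ := by gcongr
    have hIr : B / (2 * r) = B / r / 2 := by field_simp
    have h3 : ‖Complex.exp I - 1‖ ≤ B / r := by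
      have := Complex.norm_exp_sub_one_le (x := I) (by linarith)
      linarith
    set e₂ := κ / q 0 - 1 with he₂
    set e₃ := Complex.exp I - 1 with he₃
    have h4 : w 0 - 1 = e₁ + (1 + e₁) * e₂ + (1 + e₁) * (1 + e₂) * e₃ := by
      rw [hprod, he₂, he₃]; ring
    have ha : ‖1 + e₁‖ ≤ 2 := by
      have := norm_add_le (1 : ℂ) e₁
      rw [norm_one] at this; linarith
    have hb : ‖1 + e₂‖ ≤ 2 := by
      have := norm_add_le (1 : ℂ) e₂
      rw [norm_one] at this; linarith
    rw [h4]
    calc _ ≤ ‖e₁‖ + ‖(1 + e₁) * e₂‖ + ‖(1 + e₁) * (1 + e₂) * e₃‖ := norm_add₃_le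
      _ = ‖e₁‖ + ‖1 + e₁‖ * ‖e₂‖ + ‖1 + e₁‖ * ‖1 + e₂‖ * ‖e₃‖ := by simp only [norm_mul]
      _ ≤ 2 * (B / r) + 2 * (B / r) + 2 * 2 * (B / r) := by gcongr
      _ ≤ _ := by rw [mul_div_assoc]; nlinarith [div_nonneg (by linarith : 0 ≤ B) hr0.le]

end

/-! ### Perturbation of a frame of exact solutions -/

/-- The coordinates `a`, `b` of a solution of the perturbed system in the frame of two exact
solutions with logarithmic derivatives `ρm` (growing) and `ρp` (decaying), after rescaling the
second coordinate to the size of the first. The perturbation has the traceless matrix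
`[[ε, 0], [χ, -ε]]`, and `X` is a primitive of `χ`. All derivatives are right derivatives. -/
structure PerturbedFrame (a b ρm ρp : ℝ → ℂ) (χ ε X : ℝ → ℝ) (x₀ x₁ : ℝ) : Prop where
  cont_a : ContinuousOn a (Set.Icc x₀ x₁)
  cont_b : ContinuousOn b (Set.Icc x₀ x₁)
  cont_X : ContinuousOn X (Set.Icc x₀ x₁)
  cont_m : Continuous ρm
  cont_p : Continuous ρp
  deriv_a : ∀ x ∈ Set.Ico x₀ x₁, HasDerivWithinAt a ((ρp x - ρm x)⁻¹ *
    (-(χ x) * (a x + b x) + ε x * (a x * (ρm x + ρp x) + 2 * b x * ρp x))) (Set.Ici x) x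
  deriv_b : ∀ x ∈ Set.Ico x₀ x₁, HasDerivWithinAt b ((ρp x - ρm x) * b x + (ρp x - ρm x)⁻¹ *
    (χ x * (a x + b x) - ε x * (2 * a x * ρm x + b x * (ρm x + ρp x)))) (Set.Ici x) x
  deriv_X : ∀ x ∈ Set.Ico x₀ x₁, HasDerivWithinAt X (χ x) (Set.Ici x) x
  deriv_j : ∀ x, HasDerivAt (fun y => (ρp y - ρm y)⁻¹)
    ((ρp x - ρm x)⁻¹ * (ρm x + ρp x)) x

/-- Sizes in a perturbed frame, for the step `h` and the spectral scale `r`; `C` depends on neither. -/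
structure FrameBounds (ρm ρp : ℝ → ℂ) (χ ε X : ℝ → ℝ) (x₀ x₁ h r C : ℝ) : Prop where
  gap : ∀ x, r ≤ (ρm x - ρp x).re
  norm_m : ∀ x, ‖ρm x‖ ≤ C * r
  norm_p : ∀ x, ‖ρp x‖ ≤ C * r
  norm_sum : ∀ x, ‖ρm x + ρp x‖ ≤ C / r ^ 2
  int_sum : ∫ x in x₀..x₁, ‖ρm x + ρp x‖ ≤ C / r ^ 2
  abs_chi : ∀ x ∈ Set.Ico x₀ x₁, |χ x| ≤ C * h
  abs_eps : ∀ x ∈ Set.Ico x₀ x₁, |ε x| ≤ C * h ^ 3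
  intervalIntegrable_chi : IntervalIntegrable χ volume x₀ x₁
  intervalIntegrable_eps : IntervalIntegrable ε volume x₀ x₁
  int_chi : ∫ x in x₀..x₁, |χ x| ≤ C * h
  int_eps : ∫ x in x₀..x₁, |ε x| ≤ C * h ^ 3
  abs_X : ∀ x ∈ Set.Icc x₀ x₁, |X x| ≤ C * h ^ 2

section
variable {a b ρm ρp : ℝ → ℂ} {χ ε X : ℝ → ℝ} {x₀ x₁ h r C : ℝ}

theorem FrameBounds.norm_inv_le (hB : FrameBounds ρm ρp χ ε X x₀ x₁ h r C) (hr : 0 < r) (x : ℝ) :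
    ‖(ρp x - ρm x)⁻¹‖ ≤ 1 / r := by
  rw [norm_inv, ← one_div]
  have : r ≤ ‖ρp x - ρm x‖ := by
    rw [norm_sub_rev]
    exact (hB.gap x).trans (Complex.re_le_norm _)
  gcongr

/-- The decaying coordinate stays small: it is damped at rate `r / 2` and forced by `a`. -/
theorem PerturbedFrame.norm_b_le (hP : PerturbedFrame a b ρm ρp χ ε X x₀ x₁)
    (hB : FrameBounds ρm ρp χ ε X x₀ x₁ h r C) (hC : 1 ≤ C) (hr : 300 * C ^ 4 ≤ r) (hh : 0 < h)
    (hh1 : h ≤ 1) {M : ℝ} (hM : ∀ x ∈ Set.Icc x₀ x₁, ‖a x‖ ≤ M) {x : ℝ} (hx : x ∈ Set.Icc x₀ x₁) :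
    ‖b x‖ ≤ ‖b x₀‖ + 4 * C ^ 2 * M * (h / r + h ^ 3) / r := by
  have hC2 : 1 ≤ C ^ 2 := one_le_pow₀ hC
  have hC4 : C ^ 2 ≤ C ^ 4 := pow_le_pow_right₀ hC (by norm_num)
  have hr0 : 0 < r := by nlinarith
  have hr1 : 1 ≤ r := by nlinarith
  have hM0 : 0 ≤ M := (norm_nonneg _).trans (hM x hx)
  have key := norm_le_of_damped (p := b) (r := r / 2) (F := 2 * C ^ 2 * M * (h / r + h ^ 3))
    (mu := fun x => (ρm x - ρp x) -
      (ρp x - ρm x)⁻¹ * (χ x - ε x * (ρm x + ρp x)))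
    (f := fun x => (ρp x - ρm x)⁻¹ * (a x * (χ x - 2 * ε x * ρm x)))
    (by positivity) (by positivity) hP.cont_b
    (fun y hy => (hP.deriv_b y hy).congr_deriv (by ring)) ?_ ?_ hx
  · refine key.trans (le_of_eq ?_)
    field_simp; ring
  · intro y hy
    have h1 : ‖(ρp y - ρm y)⁻¹ * (χ y - ε y * (ρm y + ρp y))‖ ≤ 1 / r * (C + C * C) := by
      rw [norm_mul]
      gcongr
      · exact hB.norm_inv_le hr0 y
      · refine (norm_sub_le _ _).trans ?_
        rw [norm_mul, Complex.norm_real, Complex.norm_real, Real.norm_eq_abs, Real.norm_eq_abs]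
        have h2 := hB.abs_chi y hy
        have h3 := hB.abs_eps y hy
        have h4 := hB.norm_sum y
        have h5 : C / r ^ 2 ≤ C := div_le_self (by linarith) (one_le_pow₀ hr1)
        have h6 : h ^ 3 ≤ 1 := pow_le_one₀ hh.le hh1
        gcongr
        · nlinarith
        · nlinarith
        · linarith
    have h2 := (Complex.re_le_norm ((ρp y - ρm y)⁻¹ * (χ y - ε y * (ρm y + ρp y)))).trans h1
    have h3 := hB.gap y
    have h4 : 1 / r * (C + C * C) ≤ 1 := by
      rw [one_div, inv_mul_eq_div, div_le_one hr0]; nlinarith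
    rw [Complex.sub_re]
    nlinarith
  · intro y hy
    have h2 := hB.abs_chi y hy
    have h3 := hB.abs_eps y hy
    have h4 := hB.norm_m y
    have h5 := hM y ⟨hy.1, hy.2.le⟩
    have h6 : ‖(χ y : ℂ) - 2 * ε y * ρm y‖ ≤ C * h + 2 * (C * h ^ 3) * (C * r) := by
      refine (norm_sub_le _ _).trans ?_
      rw [norm_mul, norm_mul, Complex.norm_real, Complex.norm_real, Real.norm_eq_abs,
        Real.norm_eq_abs]
      norm_num
      gcongr
    rw [norm_mul, norm_mul]
    calc _ ≤ 1 / r * (M * (C * h + 2 * (C * h ^ 3) * (C * r))) := by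
          gcongr
          exact hB.norm_inv_le hr0 y
      _ = M * (C * (h / r) + 2 * C ^ 2 * h ^ 3) := by field_simp
      _ ≤ M * (2 * C ^ 2 * (h / r) + 2 * C ^ 2 * h ^ 3) := by
          gcongr; nlinarith
      _ = _ := by ring

/-- The growing coordinate: up to second order in the perturbation, it is multiplied by
`exp (-j X)`, where `j = (ρp - ρm)⁻¹`. -/
theorem PerturbedFrame.norm_a_le (hP : PerturbedFrame a b ρm ρp χ ε X x₀ x₁)
    (hB : FrameBounds ρm ρp χ ε X x₀ x₁ h r C) (h01 : x₀ ≤ x₁)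
    (hC : 1 ≤ C) (hr : 300 * C ^ 4 ≤ r) (hh : 0 < h) (hh1 : h ≤ 1) (hX0 : X x₀ = 0)
    (ha : ‖a x₀ - 1‖ ≤ 1 / 2) (hb : ‖b x₀‖ ≤ 1 / r) :
    ‖a x₁ * Complex.exp ((ρp x₁ - ρm x₁)⁻¹ * X x₁) - a x₀‖ ≤
      4 * C ^ 2 * ((h / r + h ^ 3) * ‖b x₀‖) + 128 * C ^ 4 * ((h / r + h ^ 3) ^ 2 / r)
        + 32 * C ^ 2 * (h ^ 2 / r ^ 3) ∧ ‖a x₁‖ ≤ 8 ∧ ‖b x₁‖ ≤ 1 := by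
  have hC2 : 1 ≤ C ^ 2 := one_le_pow₀ hC
  have hC4 : C ^ 2 ≤ C ^ 4 := pow_le_pow_right₀ hC (by norm_num)
  have hr0 : 0 < r := by nlinarith
  have hr1 : 1 ≤ r := by nlinarith
  -- `M` is bounded only at the end, by reinserting it into the estimates that it enters
  obtain ⟨xm, hxm, hmax⟩ := isCompact_Icc.exists_isMaxOn (Set.nonempty_Icc.2 h01) hP.cont_a.norm
  set M := ‖a xm‖ with hMdef
  have hM : ∀ x ∈ Set.Icc x₀ x₁, ‖a x‖ ≤ M := fun x hx => hmax hx
  have hM0 : 0 ≤ M := norm_nonneg _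
  set θ := h / r + h ^ 3 with hθ
  have hθ0 : 0 < θ := by positivity
  have hθ2 : θ ≤ 2 := by
    have h1 : h / r ≤ 1 := by rw [div_le_one hr0]; linarith
    have h2 : h ^ 3 ≤ 1 := pow_le_one₀ hh.le hh1
    linarith
  set β := ‖b x₀‖ + 4 * C ^ 2 * M * θ / r with hβ
  have hβ0 : 0 ≤ β := by positivity
  have hbβ : ∀ x ∈ Set.Icc x₀ x₁, ‖b x‖ ≤ β := fun x hx =>
    hP.norm_b_le hB hC hr hh hh1 hM hx
  have hjX : ∀ x ∈ Set.Icc x₀ x₁, ‖(ρp x - ρm x)⁻¹ * (X x : ℂ)‖ ≤ 1 / 300 := by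
    intro x hx
    rw [norm_mul, Complex.norm_real, Real.norm_eq_abs]
    have h1 := hB.abs_X x hx
    have h2 : h ^ 2 ≤ 1 := pow_le_one₀ hh.le hh1
    calc _ ≤ 1 / r * C := by
          gcongr
          · exact hB.norm_inv_le hr0 x
          · nlinarith
      _ ≤ 1 / 300 := by
          rw [one_div, inv_mul_eq_div, div_le_iff₀ hr0]; nlinarith
  have hexp : ∀ z : ℂ, ‖z‖ ≤ 1 / 300 → ‖Complex.exp z‖ ≤ 2 := by
    intro z hz
    have h1 := Complex.norm_exp_sub_one_le (x := z) (by linarith)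
    have h2 := norm_sub_norm_le (Complex.exp z) 1
    rw [norm_one] at h2
    linarith
  set F : ℝ → ℝ := fun x => 2 * β / r * |χ x| + 4 * C * β * |ε x|
      + 4 * C * h ^ 2 * M / r * ‖ρm x + ρp x‖ with hF
  have hCC : C ≤ C ^ 2 := le_self_pow₀ hC (by norm_num)
  have hi1 : IntervalIntegrable (fun x => |χ x|) volume x₀ x₁ := hB.intervalIntegrable_chi.norm
  have hi2 : IntervalIntegrable (fun x => |ε x|) volume x₀ x₁ := hB.intervalIntegrable_eps.norm
  have hi3 : IntervalIntegrable (fun x => ‖ρm x + ρp x‖) volume x₀ x₁ :=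
    (hP.cont_m.add hP.cont_p).norm.intervalIntegrable _ _
  have hFi : IntervalIntegrable F volume x₀ x₁ :=
    ((hi1.const_mul _).add (hi2.const_mul _)).add (hi3.const_mul _)
  have hF0 : ∀ x, 0 ≤ F x := fun x => by
    simp only [hF]; positivity
  have hFint : ∫ x in x₀..x₁, F x ≤ 4 * C ^ 2 * θ * β + 4 * C ^ 2 * M * (h ^ 2 / r ^ 3) := by
    have e : ∫ x in x₀..x₁, F x = 2 * β / r * (∫ x in x₀..x₁, |χ x|)
        + 4 * C * β * (∫ x in x₀..x₁, |ε x|)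
        + 4 * C * h ^ 2 * M / r * ∫ x in x₀..x₁, ‖ρm x + ρp x‖ := by
      simp only [hF]
      rw [intervalIntegral.integral_add ((hi1.const_mul _).add (hi2.const_mul _))
        (hi3.const_mul _), intervalIntegral.integral_add (hi1.const_mul _) (hi2.const_mul _)]
      simp only [intervalIntegral.integral_const_mul]
    rw [e]
    have h1 := hB.int_chi
    have h2 := hB.int_eps
    have h3 := hB.int_sum
    calc _ ≤ 2 * β / r * (C * h) + 4 * C * β * (C * h ^ 3) + 4 * C * h ^ 2 * M / r * (C / r ^ 2) := by
          gcongr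
      _ = β * (2 * C * (h / r) + 4 * C ^ 2 * h ^ 3) + 4 * C ^ 2 * M * (h ^ 2 / r ^ 3) := by
          field_simp
      _ ≤ β * (4 * C ^ 2 * (h / r) + 4 * C ^ 2 * h ^ 3) + 4 * C ^ 2 * M * (h ^ 2 / r ^ 3) := by
          gcongr; norm_num
      _ = _ := by rw [hθ]; ring
  have hjc : Continuous fun y => (ρp y - ρm y)⁻¹ :=
    continuous_iff_continuousAt.2 fun x => (hP.deriv_j x).continuousAt
  -- the product `a exp (j X)` varies only through terms of second order
  have hα : ∀ x ∈ Set.Icc x₀ x₁,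
      ‖a x * Complex.exp ((ρp x - ρm x)⁻¹ * X x) - a x₀‖ ≤
        4 * C ^ 2 * θ * β + 4 * C ^ 2 * M * (h ^ 2 / r ^ 3) := by
    intro x hx
    have hsub : Set.Icc x₀ x ⊆ Set.Icc x₀ x₁ := Set.Icc_subset_Icc_right hx.2
    have hsub' : ∀ y ∈ Set.Ico x₀ x, y ∈ Set.Ico x₀ x₁ := fun y hy => ⟨hy.1, hy.2.trans_le hx.2⟩
    have hXc : ContinuousOn (fun y => (X y : ℂ)) (Set.Icc x₀ x₁) :=
      Complex.continuous_ofReal.comp_continuousOn hP.cont_X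
    have key := norm_sub_le_integral_of_right_deriv (a := x₀) (b := x)
      (f := fun y => a y * Complex.exp ((ρp y - ρm y)⁻¹ * X y)) (F := F) hx.1
      ((hP.cont_a.mul ((hjc.continuousOn.mul hXc).cexp)).mono hsub)
      (fun y hy => (hP.deriv_a y (hsub' y hy)).mul
        (((hP.deriv_j y).hasDerivWithinAt.mul ((hP.deriv_X y (hsub' y hy)).ofReal_comp)).cexp))
      ?_ (hFi.mono_set (by
        rw [Set.uIcc_of_le hx.1, Set.uIcc_of_le h01]; exact hsub))
    · simp only [hX0, Complex.ofReal_zero, mul_zero, Complex.exp_zero, mul_one] at key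
      refine key.trans (le_trans ?_ hFint)
      exact intervalIntegral.integral_mono_interval le_rfl hx.1 hx.2
        (Eventually.of_forall hF0) hFi
    · intro y hy
      have hy' : y ∈ Set.Icc x₀ x₁ := hsub ⟨hy.1, hy.2.le⟩
      set j := (ρp y - ρm y)⁻¹ with hj
      have hj1 : ‖j‖ ≤ 1 / r := hB.norm_inv_le hr0 y
      have e : j * (-(χ y) * (a y + b y) + ε y * (a y * (ρm y + ρp y) + 2 * b y * ρp y)) *
            Complex.exp (j * X y) + a y * (Complex.exp (j * X y) *
              (j * (ρm y + ρp y) * X y + j * χ y)) =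
          Complex.exp (j * X y) * (j * (b y * (-(χ y) + 2 * ε y * ρp y)
            + a y * ((ε y + X y : ℝ) * (ρm y + ρp y)))) := by
        push_cast; ring
      refine (congrArg norm e).trans_le ?_
      rw [norm_mul, norm_mul]
      have h1 : ‖-(χ y : ℂ) + 2 * ε y * ρp y‖ ≤ |χ y| + 2 * |ε y| * (C * r) := by
        refine (norm_add_le _ _).trans ?_
        rw [norm_neg, norm_mul, norm_mul, Complex.norm_real, Complex.norm_real, Real.norm_eq_abs,
          Real.norm_eq_abs]
        norm_num
        gcongr
        exact hB.norm_p y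
      have h2 : ‖((ε y + X y : ℝ) : ℂ)‖ ≤ 2 * C * h ^ 2 := by
        rw [Complex.norm_real, Real.norm_eq_abs]
        have h3 := hB.abs_eps y (hsub' y hy)
        have h4 := hB.abs_X y hy'
        have h5 : h ^ 3 ≤ h ^ 2 := pow_le_pow_of_le_one hh.le hh1 (by norm_num)
        have h6 : C * h ^ 3 ≤ C * h ^ 2 := by gcongr
        linarith [abs_add_le (ε y) (X y)]
      calc _ ≤ 2 * (1 / r * (β * (|χ y| + 2 * |ε y| * (C * r))
              + M * (2 * C * h ^ 2 * ‖ρm y + ρp y‖))) := by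
            gcongr
            · exact hexp _ (hjX y hy')
            · refine (norm_add_le _ _).trans ?_
              rw [norm_mul, norm_mul, norm_mul]
              gcongr
              · exact hbβ y hy'
              · exact hM y hy'
        _ = F y := by simp only [hF]; field_simp; ring
  have hr4 : C ^ 4 / r ≤ 1 / 300 := by rw [div_le_iff₀ hr0]; linarith
  have hC4' : 1 ≤ C ^ 4 := one_le_pow₀ hC
  have hexpand : 4 * C ^ 2 * θ * β + 4 * C ^ 2 * M * (h ^ 2 / r ^ 3) =
      4 * C ^ 2 * (θ * ‖b x₀‖) + (16 * C ^ 4 * (θ ^ 2 / r) + 4 * C ^ 2 * (h ^ 2 / r ^ 3)) * M := by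
    rw [hβ]; field_simp; ring
  have hs1 : 4 * C ^ 2 * (θ * ‖b x₀‖) ≤ 1 / 2 := by
    have h1 : θ * ‖b x₀‖ ≤ 2 * (1 / r) := by gcongr
    have h2 : 4 * C ^ 2 * (θ * ‖b x₀‖) ≤ 4 * C ^ 4 * (2 * (1 / r)) := by gcongr
    have h3 : 4 * C ^ 4 * (2 * (1 / r)) = 8 * (C ^ 4 / r) := by ring
    linarith
  have hs2 : 16 * C ^ 4 * (θ ^ 2 / r) + 4 * C ^ 2 * (h ^ 2 / r ^ 3) ≤ 1 / 4 := by
    have h1 : θ ^ 2 ≤ 4 := by nlinarith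
    have h2 : 16 * C ^ 4 * (θ ^ 2 / r) ≤ 16 * C ^ 4 * (4 / r) := by gcongr
    have h3 : h ^ 2 / r ^ 3 ≤ 1 / r := by
      gcongr
      · exact pow_le_one₀ hh.le hh1
      · exact le_self_pow₀ hr1 (by norm_num)
    have h4 : 4 * C ^ 2 * (h ^ 2 / r ^ 3) ≤ 4 * C ^ 4 * (1 / r) := by gcongr
    have h5 : 16 * C ^ 4 * (4 / r) + 4 * C ^ 4 * (1 / r) = 68 * (C ^ 4 / r) := by ring
    linarith
  have hM8 : M ≤ 8 := by
    have h1 := hα xm hxm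
    rw [hexpand] at h1
    set e := Complex.exp ((ρp xm - ρm xm)⁻¹ * X xm) with he
    have h2 : ‖a xm * e‖ ≤ ‖a xm * e - a x₀‖ + ‖a x₀ - 1‖ + 1 := by
      have : a xm * e = (a xm * e - a x₀) + (a x₀ - 1) + 1 := by ring
      calc _ = ‖(a xm * e - a x₀) + (a x₀ - 1) + 1‖ := by rw [← this]
        _ ≤ _ := norm_add₃_le.trans (by rw [norm_one])
    have h3 : a xm = a xm * e * Complex.exp (-((ρp xm - ρm xm)⁻¹ * X xm)) := by
      rw [he, mul_assoc, ← Complex.exp_add]; simp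
    have h4 : M ≤ ‖a xm * e‖ * 2 := by
      rw [hMdef]
      conv_lhs => rw [h3]
      rw [norm_mul]
      gcongr
      exact hexp _ (by rw [norm_neg]; exact hjX xm hxm)
    nlinarith
  refine ⟨(hα x₁ ⟨h01, le_rfl⟩).trans ?_, (hM x₁ ⟨h01, le_rfl⟩).trans hM8, ?_⟩
  · rw [hexpand]
    have : (16 * C ^ 4 * (θ ^ 2 / r) + 4 * C ^ 2 * (h ^ 2 / r ^ 3)) * M ≤
        (16 * C ^ 4 * (θ ^ 2 / r) + 4 * C ^ 2 * (h ^ 2 / r ^ 3)) * 8 := by gcongr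
    linarith
  · refine (hbβ x₁ ⟨h01, le_rfl⟩).trans ?_
    have h1 : 4 * C ^ 2 * M * θ / r ≤ 4 * C ^ 4 * 8 * 2 / r := by gcongr
    have h2 : 4 * C ^ 4 * 8 * 2 / r = 64 * (C ^ 4 / r) := by ring
    have h3 : 1 / r ≤ C ^ 4 / r := by gcongr
    linarith

end

/-! ### From the growing coordinate to the determinant -/

/-- From the growing coordinate to the determinant: if the perturbation has total mass
`X₁ = E₄ + O(h⁶)`, then the determinant changes by `-E₄` up to the stated errors. -/
theorem norm_determinant_error_le {D j a₀ a₁ b₁ : ℂ} {β₀ β₁ X₁ E₄ h r C : ℝ}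
    (hC : 1 ≤ C) (hr : 300 * C ^ 4 ≤ r) (hh : 0 < h) (hh1 : h ≤ 1)
    (hj : ‖j‖ ≤ 1 / r) (hD : ‖D‖ ≤ C * r) (hg : ‖D * j - 1‖ ≤ C / r)
    (hβ₀ : |β₀| ≤ h ^ 6) (hβ₁ : |β₁| ≤ h ^ 6) (hX : |X₁ - E₄| ≤ C * h ^ 6) (hE : |E₄| ≤ C * h ^ 4)
    (ha₀ : ‖a₀ - 1‖ ≤ |β₀| / r) {b₀ : ℝ} (hb₀ : b₀ ≤ |β₀| / r)
    (ha₁ : ‖a₁ * Complex.exp (j * X₁) - a₀‖ ≤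
      4 * C ^ 2 * ((h / r + h ^ 3) * b₀) + 128 * C ^ 4 * ((h / r + h ^ 3) ^ 2 / r)
        + 32 * C ^ 2 * (h ^ 2 / r ^ 3))
    (ha₁' : ‖a₁‖ ≤ 8) (hb₁ : ‖b₁‖ ≤ 1) :
    ‖D * (a₁ - 1) + β₁ * (a₁ + b₁) * (D * j) + E₄‖ ≤
      1000 * C ^ 5 * (h ^ 6 + h ^ 4 / r + h ^ 2 / r ^ 2) := by
  have hC2 : 1 ≤ C ^ 2 := one_le_pow₀ hC
  have hC3 : 1 ≤ C ^ 3 := one_le_pow₀ hC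
  have hC4 : 1 ≤ C ^ 4 := one_le_pow₀ hC
  have hC14 : C ≤ C ^ 4 := le_self_pow₀ hC (by norm_num)
  have hr0 : 0 < r := by nlinarith
  have hr1 : 1 ≤ r := by nlinarith
  have h64 : h ^ 6 ≤ h ^ 4 := pow_le_pow_of_le_one hh.le hh1 (by norm_num)
  have h41 : h ^ 4 ≤ 1 := pow_le_one₀ hh.le hh1
  have hX4 : |X₁| ≤ 2 * C * h ^ 4 := by
    have : |X₁| ≤ |X₁ - E₄| + |E₄| := by
      simpa using abs_add_le (X₁ - E₄) E₄
    have : C * h ^ 6 ≤ C * h ^ 4 := by gcongr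
    linarith
  have hz : ‖j * X₁‖ ≤ 2 * C * h ^ 4 / r := by
    rw [norm_mul, Complex.norm_real, Real.norm_eq_abs]
    calc _ ≤ 1 / r * (2 * C * h ^ 4) := by gcongr
      _ = _ := by ring
  have hz1 : ‖-(j * (X₁ : ℂ))‖ ≤ 1 / 150 := by
    rw [norm_neg]
    refine hz.trans ?_
    rw [div_le_iff₀ hr0]
    nlinarith
  have hCr : C / r ≤ 1 := by
    rw [div_le_one hr0]; linarith
  set e := Complex.exp (-(j * X₁)) with he
  have hee : Complex.exp (j * X₁) * e = 1 := by rw [he, ← Complex.exp_add]; simp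
  have he2 : ‖e‖ ≤ 2 := by
    have h1 := Complex.norm_exp_sub_one_le (x := -(j * (X₁ : ℂ))) (by linarith)
    have h2 := norm_sub_norm_le e 1
    rw [norm_one] at h2
    linarith
  set q := Complex.exp (j * X₁) with hq
  -- `a₁` is `a₀ e` up to second order; `a₀` is `1` up to `β₀ / r`, and `e` is `1 - j X₁` up to
  -- `O(X₁² / r²)`
  have hsplit : D * (a₁ - 1) + β₁ * (a₁ + b₁) * (D * j) + E₄ =
      D * (a₁ * q - a₀) * e + D * (a₀ - 1) * e + D * (e - 1 - -(j * X₁))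
        + (-((D * j - 1) * X₁)) + (-((X₁ - E₄ : ℝ) : ℂ)) + β₁ * (a₁ + b₁) * (D * j) := by
    push_cast
    linear_combination (-D * a₁) * hee
  have t1 : ‖D * (a₁ * q - a₀) * e‖ ≤
      C * r * (4 * C ^ 2 * (2 * (h ^ 6 / r)) + 128 * C ^ 4 * ((2 * (h / r) ^ 2 + 2 * h ^ 6) / r)
        + 32 * C ^ 2 * (h ^ 2 / r ^ 3)) * 2 := by
    rw [norm_mul, norm_mul]
    have h1 : (h / r + h ^ 3) ^ 2 ≤ 2 * (h / r) ^ 2 + 2 * h ^ 6 := by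
      nlinarith [sq_nonneg (h / r - h ^ 3)]
    have h2 : h / r + h ^ 3 ≤ 2 := by
      have : h / r ≤ 1 := by rw [div_le_one hr0]; linarith
      have : h ^ 3 ≤ 1 := pow_le_one₀ hh.le hh1
      linarith
    have h3 : (h / r + h ^ 3) * b₀ ≤ 2 * (h ^ 6 / r) := by
      have h5 : b₀ ≤ h ^ 6 / r := hb₀.trans (by gcongr)
      have h6 : 0 ≤ h / r + h ^ 3 := by positivity
      calc _ ≤ (h / r + h ^ 3) * (h ^ 6 / r) := by gcongr
        _ ≤ _ := by gcongr
    gcongr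
    refine ha₁.trans ?_
    gcongr
  have t2 : ‖D * (a₀ - 1) * e‖ ≤ C * r * (h ^ 6 / r) * 2 := by
    rw [norm_mul, norm_mul]
    gcongr
    exact ha₀.trans (by gcongr)
  have t3 : ‖D * (e - 1 - -(j * X₁))‖ ≤ C * r * (2 * C * h ^ 4 / r) ^ 2 := by
    rw [norm_mul]
    gcongr
    refine (Complex.norm_exp_sub_one_sub_id_le (by linarith)).trans ?_
    rw [norm_neg]
    gcongr
  have t4 : ‖-((D * j - 1) * (X₁ : ℂ))‖ ≤ C / r * (2 * C * h ^ 4) := by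
    rw [norm_neg, norm_mul, Complex.norm_real, Real.norm_eq_abs]
    gcongr
  have t5 : ‖-((X₁ - E₄ : ℝ) : ℂ)‖ ≤ C * h ^ 6 := by
    rw [norm_neg, Complex.norm_real, Real.norm_eq_abs]
    exact hX
  have t6 : ‖β₁ * (a₁ + b₁) * (D * j)‖ ≤ h ^ 6 * (8 + 1) * 2 := by
    rw [norm_mul, norm_mul, Complex.norm_real, Real.norm_eq_abs]
    have : ‖D * j‖ ≤ 2 := by
      have h2 := norm_sub_norm_le (D * j) 1
      rw [norm_one] at h2
      linarith
    gcongr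
    exact (norm_add_le _ _).trans (by gcongr)
  rw [hsplit]
  refine (norm_add_le _ _).trans ?_
  refine (add_le_add_left (norm_add_le _ _) _).trans ?_
  refine (add_le_add_left (add_le_add_left norm_add₄_le _) _).trans ?_
  set A := h ^ 6 with hA
  have e1 : C * r * (4 * C ^ 2 * (2 * (A / r)) + 128 * C ^ 4 * ((2 * (h / r) ^ 2 + 2 * A) / r)
        + 32 * C ^ 2 * (h ^ 2 / r ^ 3)) * 2 =
      (16 * C ^ 3 + 512 * C ^ 5) * A + (512 * C ^ 5 + 64 * C ^ 3) * (h ^ 2 / r ^ 2) := by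
    field_simp; ring
  have e2 : C * r * (A / r) * 2 = 2 * C * A := by field_simp
  have e3 : C * r * (2 * C * h ^ 4 / r) ^ 2 = 4 * C ^ 3 * h ^ 4 * (h ^ 4 / r) := by
    field_simp; ring
  have e3' : 4 * C ^ 3 * h ^ 4 * (h ^ 4 / r) ≤ 4 * C ^ 3 * 1 * (h ^ 4 / r) := by gcongr
  have e4 : C / r * (2 * C * h ^ 4) = 2 * C ^ 2 * (h ^ 4 / r) := by field_simp
  have hA0 : 0 ≤ A := by positivity
  have hp : 0 ≤ h ^ 4 / r := by positivity
  have hp2 : 0 ≤ h ^ 2 / r ^ 2 := by positivity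
  have p1 : C ≤ C ^ 5 := le_self_pow₀ hC (by norm_num)
  have p2 : C ^ 2 ≤ C ^ 5 := pow_le_pow_right₀ hC (by norm_num)
  have p3 : C ^ 3 ≤ C ^ 5 := pow_le_pow_right₀ hC (by norm_num)
  have s1 : (16 * C ^ 3 + 512 * C ^ 5 + 3 * C + 18) * A ≤ 1000 * C ^ 5 * A := by
    gcongr; linarith
  have s2 : (512 * C ^ 5 + 64 * C ^ 3) * (h ^ 2 / r ^ 2) ≤ 1000 * C ^ 5 * (h ^ 2 / r ^ 2) := by
    gcongr; linarith
  have s3 : (4 * C ^ 3 + 2 * C ^ 2) * (h ^ 4 / r) ≤ 1000 * C ^ 5 * (h ^ 4 / r) := by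
    gcongr; linarith
  linarith

/-! ### The pair of exact solutions -/

section
variable {φ φ' : ℝ → ℝ} {Λ κ : ℂ} {q w v : ℝ → ℂ} {r Q B m : ℝ}

theorem SlowPotential.comp_neg (hφ : SlowPotential φ φ' B) :
    SlowPotential (fun x => φ (-x)) (fun x => -φ' (-x)) B where
  hasDerivAt x := by
    have h : HasDerivAt (fun x => φ (-x)) (φ' (-x) * -1) x :=
      (hφ.hasDerivAt (-x)).comp x (hasDerivAt_neg x)
    exact h.congr_deriv (by ring)
  continuous_deriv := (hφ.continuous_deriv.comp continuous_neg).neg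
  bound x := by rw [abs_neg]; exact hφ.bound _
  integral_bound x₀ x₁ h := by
    simp only [abs_neg]
    rw [intervalIntegral.integral_comp_neg (fun x => |φ' x|)]
    exact hφ.integral_bound _ _ (neg_le_neg h)

theorem RootBranch.comp_neg (hq : RootBranch φ φ' Λ q r Q) :
    RootBranch (fun x => φ (-x)) (fun x => -φ' (-x)) Λ (fun x => q (-x)) r Q where
  sq x := hq.sq _
  hasDerivAt x := by
    have h : HasDerivAt (fun x => q (-x)) ((-1 : ℝ) • (-(φ' (-x) : ℂ) / (2 * q (-x)))) x :=
      (hq.hasDerivAt (-x)).scomp x (hasDerivAt_neg x)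
    exact h.congr_deriv (by simp; ring)
  le_re x := hq.le_re _
  norm_le x := hq.norm_le _

theorem ScalarSolution.comp_neg (hw : ScalarSolution φ Λ w v) :
    ScalarSolution (fun x => φ (-x)) Λ (fun x => w (-x)) (fun x => -v (-x)) where
  hasDerivAt x := by
    have h : HasDerivAt (fun x => w (-x)) ((-1 : ℝ) • v (-x)) x :=
      (hw.hasDerivAt (-x)).scomp x (hasDerivAt_neg x)
    exact h.congr_deriv (by simp)
  hasDerivAt' x := by
    have h : HasDerivAt (fun x => v (-x)) ((-1 : ℝ) • ((Λ - φ (-x)) * w (-x))) x :=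
      (hw.hasDerivAt' (-x)).scomp x (hasDerivAt_neg x)
    exact h.neg.congr_deriv (by simp)

/-- The mirror image of `wkb_left`. -/
theorem wkb_right (hφ : SlowPotential φ φ' B) (hq : RootBranch φ φ' Λ q r Q)
    (hw : ScalarSolution φ Λ w v) (hB : 1 ≤ B) (hr : 20 * B ≤ r)
    (hκ : κ ^ 2 = Λ - m) (hκr : r ≤ κ.re) (hm : Tendsto φ atTop (𝓝 m))
    (hi : IntegrableOn (fun x => φ x - m) (Set.Ici 0))
    (hiB : ∫ x in Set.Ici 0, |φ x - m| ≤ B) (hφm : |φ 0 - m| ≤ 2 * B)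
    (hw1 : Tendsto (fun x : ℝ => Complex.exp (κ * x) * w x) atTop (𝓝 1))
    (hv1 : Tendsto (fun x : ℝ => Complex.exp (κ * x) * v x) atTop (𝓝 (-κ))) :
    (∀ x, w x ≠ 0) ∧ (∀ x, ‖v x / w x + q x‖ ≤ 2 * Q * B / r ^ 2) ∧
    (∀ x₀ x₁, x₀ ≤ x₁ → ∫ x in x₀..x₁, ‖v x / w x + q x‖ ≤ 2 * Q * B / r ^ 2) ∧
    ‖w 0 - 1‖ ≤ 20 * B / r := by
  have hsgn : ∀ x, ‖-v (-x) / w (-x) - q (-x)‖ = ‖v (-x) / w (-x) + q (-x)‖ := fun x => by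
    rw [← norm_neg]; congr 1; ring
  obtain ⟨h1, h2, h3, h4⟩ := wkb_left (κ := κ) (m := m) hφ.comp_neg hq.comp_neg hw.comp_neg hB hr hκ hκr
    (hm.comp tendsto_neg_atBot_atTop)
    (by
      have : IntegrableOn (fun x => φ x - m) (Set.Ici (-0)) := by simpa using hi
      exact this.comp_neg_Iic)
    (by
      rw [integral_comp_neg_Iic 0 (fun x => |φ x - m|), neg_zero, ← integral_Ici_eq_integral_Ioi]
      exact hiB)
    (by simpa using hφm)
    (by
      refine (hw1.comp tendsto_neg_atBot_atTop).congr fun x => ?_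
      simp)
    (by
      have := (hv1.comp tendsto_neg_atBot_atTop).neg
      rw [neg_neg] at this
      refine this.congr fun x => ?_
      simp)
  simp only [hsgn] at h2 h3
  refine ⟨fun x => by simpa using h1 (-x), fun x => by simpa using h2 (-x), fun x₀ x₁ h => ?_,
    by simpa using h4⟩
  have := h3 (-x₁) (-x₀) (neg_le_neg h)
  rw [intervalIntegral.integral_comp_neg (fun x => ‖v x / w x + q x‖)] at this
  simpa using this

variable {wp vp : ℝ → ℂ}

theorem ScalarSolution.hasDerivAt_div (hw : ScalarSolution φ Λ w v) (h0 : ∀ x, w x ≠ 0) (x : ℝ) :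
    HasDerivAt (fun x => v x / w x) (Λ - φ x - (v x / w x) ^ 2) x := by
  refine ((hw.hasDerivAt' x).div (hw.hasDerivAt x) (h0 x)).congr_deriv ?_
  have := h0 x
  field_simp

theorem ScalarSolution.wronskian_eq (hw : ScalarSolution φ Λ w v) (hp : ScalarSolution φ Λ wp vp)
    (x : ℝ) : w x * vp x - v x * wp x = w 0 * vp 0 - v 0 * wp 0 := by
  have hd : ∀ y, HasDerivAt (fun y => w y * vp y - v y * wp y) 0 y := fun y =>
    (((hw.hasDerivAt y).mul (hp.hasDerivAt' y)).sub
      ((hw.hasDerivAt' y).mul (hp.hasDerivAt y))).congr_deriv (by ring)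
  exact is_const_of_deriv_eq_zero (fun y => (hd y).differentiableAt) (fun y => (hd y).deriv) x 0

/-- What the WKB analysis yields for a solution `w` that grows and a solution `wp` that decays to
the right, with derivatives `v` and `vp`: the logarithmic derivatives are opposite up to `O(r⁻²)`
and well separated (`gap`), the Wronskian is `O(r)` (`norm_D`), and the product of the two
solutions is almost `1` (`norm_g`). -/
structure ExactPair (w v wp vp : ℝ → ℂ) (r C : ℝ) : Prop where
  ne_zero : ∀ x, w x ≠ 0
  ne_zero' : ∀ x, wp x ≠ 0
  gap : ∀ x, r ≤ (v x / w x - vp x / wp x).re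
  norm_m : ∀ x, ‖v x / w x‖ ≤ C * r
  norm_p : ∀ x, ‖vp x / wp x‖ ≤ C * r
  norm_sum : ∀ x, ‖v x / w x + vp x / wp x‖ ≤ C / r ^ 2
  int_sum : ∀ x₀ x₁, x₀ ≤ x₁ → ∫ x in x₀..x₁, ‖v x / w x + vp x / wp x‖ ≤ C / r ^ 2
  norm_D : ‖w 0 * vp 0 - v 0 * wp 0‖ ≤ C * r
  norm_g : ∀ x, ‖w x * wp x - 1‖ ≤ C / r

/-- The WKB bounds for the two solutions separately give those for the pair. -/
theorem exactPair (hφB : ∀ x, |φ x| ≤ B)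
    (hq : RootBranch φ φ' Λ q r Q)
    (hw : ScalarSolution φ Λ w v) (hp : ScalarSolution φ Λ wp vp) (hB : 1 ≤ B) (hQ : 1 ≤ Q)
    (hr : 400 * (Q * B) ≤ r)
    (hw0 : ∀ x, w x ≠ 0) (hm1 : ∀ x, ‖v x / w x - q x‖ ≤ 2 * Q * B / r ^ 2)
    (hm2 : ∀ x₀ x₁, x₀ ≤ x₁ → ∫ x in x₀..x₁, ‖v x / w x - q x‖ ≤ 2 * Q * B / r ^ 2)
    (hm3 : ‖w 0 - 1‖ ≤ 20 * B / r)
    (hp0 : ∀ x, wp x ≠ 0) (hp1 : ∀ x, ‖vp x / wp x + q x‖ ≤ 2 * Q * B / r ^ 2)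
    (hp2 : ∀ x₀ x₁, x₀ ≤ x₁ → ∫ x in x₀..x₁, ‖vp x / wp x + q x‖ ≤ 2 * Q * B / r ^ 2)
    (hp3 : ‖wp 0 - 1‖ ≤ 20 * B / r) :
    ExactPair w v wp vp r (100 * (Q * B)) := by
  have hQB : 1 ≤ Q * B := by nlinarith
  have hBQ : B ≤ Q * B := by nlinarith
  have hQBQ : Q ≤ Q * B := by nlinarith
  have hr0 : 0 < r := by linarith
  have hr1 : 1 ≤ r := by linarith
  set E := 2 * Q * B / r ^ 2 with hE
  have hEr : E ≤ 1 / 200 / r := by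
    rw [hE, div_le_div_iff₀ (by positivity) hr0]
    nlinarith
  have hE1 : E ≤ 1 / 200 := hEr.trans (div_le_self (by norm_num) hr1)
  have hcw : Continuous fun x => v x / w x :=
    continuous_iff_continuousAt.2 fun x => (hw.hasDerivAt_div hw0 x).continuousAt
  have hcp : Continuous fun x => vp x / wp x :=
    continuous_iff_continuousAt.2 fun x => (hp.hasDerivAt_div hp0 x).continuousAt
  have hsum : ∀ x, ‖v x / w x + vp x / wp x‖ ≤ ‖v x / w x - q x‖ + ‖vp x / wp x + q x‖ := by
    intro x
    refine le_trans (le_of_eq ?_) (norm_add_le _ _)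
    congr 1; ring
  have h2E : 2 * E ≤ 100 * (Q * B) / r ^ 2 := by
    rw [hE, ← mul_div_assoc]
    refine div_le_div_of_nonneg_right ?_ (by positivity)
    linarith
  have hnm : ∀ x, ‖v x / w x‖ ≤ Q * r + E := by
    intro x
    have h1 : v x / w x = q x + (v x / w x - q x) := by ring
    rw [h1]
    exact (norm_add_le _ _).trans (add_le_add (hq.norm_le x) (hm1 x))
  have hnp : ∀ x, ‖vp x / wp x‖ ≤ Q * r + E := by
    intro x
    have h1 : vp x / wp x = -q x + (vp x / wp x + q x) := by ring
    rw [h1]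
    refine (norm_add_le _ _).trans (add_le_add ?_ (hp1 x))
    rw [norm_neg]; exact hq.norm_le x
  have hgap : ∀ x, r ≤ (v x / w x - vp x / wp x).re := by
    intro x
    have h1 : v x / w x - vp x / wp x =
        2 * q x + ((v x / w x - q x) - (vp x / wp x + q x)) := by ring
    have h2 := (Complex.abs_re_le_norm ((v x / w x - q x) - (vp x / wp x + q x))).trans
      (norm_sub_le _ _)
    have h3 := abs_le.1 h2
    have h4 := hq.le_re x
    rw [h1, Complex.add_re]
    have h5 : (2 * q x).re = 2 * (q x).re := by simp
    rw [h5]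
    linarith [hm1 x, hp1 x, h3.1]
  have hgap' : ∀ x, r ≤ ‖vp x / wp x - v x / w x‖ := fun x => by
    rw [norm_sub_rev]; exact (hgap x).trans (Complex.re_le_norm _)
  have hEQ : Q * r + E ≤ 2 * (Q * r) := by nlinarith
  have hBr : 20 * B / r ≤ 1 / 20 := by
    rw [div_le_iff₀ hr0]; linarith
  have hg0 : ‖w 0 * wp 0 - 1‖ ≤ 60 * B / r := by
    have h1 : w 0 * wp 0 - 1 = (w 0 - 1) + (wp 0 - 1) + (w 0 - 1) * (wp 0 - 1) := by ring
    rw [h1]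
    refine norm_add₃_le.trans ?_
    rw [norm_mul]
    have h2 : ‖w 0 - 1‖ * ‖wp 0 - 1‖ ≤ 1 * (20 * B / r) := by
      gcongr; linarith
    have h3 : 60 * B / r = 3 * (20 * B / r) := by ring
    linarith
  have hg0' : ‖w 0 * wp 0‖ ≤ 2 := by
    have h2 := norm_sub_norm_le (w 0 * wp 0) 1
    rw [norm_one] at h2
    have h3 : 60 * B / r = 3 * (20 * B / r) := by ring
    linarith
  have hD : ∀ x, w 0 * vp 0 - v 0 * wp 0 = w x * wp x * (vp x / wp x - v x / w x) := by
    intro x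
    rw [← hw.wronskian_eq hp x]
    have := hw0 x
    have := hp0 x
    field_simp
  refine ⟨hw0, hp0, hgap, fun x => ?_, fun x => ?_, fun x => ?_, fun x₀ x₁ h => ?_, ?_, fun x => ?_⟩
  · refine (hnm x).trans (hEQ.trans ?_)
    nlinarith [mul_le_mul_of_nonneg_right hQBQ hr0.le]
  · refine (hnp x).trans (hEQ.trans ?_)
    nlinarith [mul_le_mul_of_nonneg_right hQBQ hr0.le]
  · exact (hsum x).trans (by linarith [hm1 x, hp1 x])
  · have i1 : IntervalIntegrable (fun x => ‖v x / w x - q x‖) volume x₀ x₁ :=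
      (hcw.sub hq.continuous).norm.intervalIntegrable _ _
    have i2 : IntervalIntegrable (fun x => ‖vp x / wp x + q x‖) volume x₀ x₁ :=
      (hcp.add hq.continuous).norm.intervalIntegrable _ _
    calc _ ≤ ∫ x in x₀..x₁, (‖v x / w x - q x‖ + ‖vp x / wp x + q x‖) :=
          intervalIntegral.integral_mono_on h ((hcw.add hcp).norm.intervalIntegrable _ _)
            (i1.add i2) fun x _ => hsum x
      _ = (∫ x in x₀..x₁, ‖v x / w x - q x‖) + ∫ x in x₀..x₁, ‖vp x / wp x + q x‖ :=
          intervalIntegral.integral_add i1 i2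
      _ ≤ E + E := add_le_add (hm2 _ _ h) (hp2 _ _ h)
      _ ≤ _ := by linarith
  · rw [hD 0, norm_mul]
    have h1 : ‖vp 0 / wp 0 - v 0 / w 0‖ ≤ 4 * (Q * r) :=
      (norm_sub_le _ _).trans (by linarith [hnm 0, hnp 0])
    calc _ ≤ 2 * (4 * (Q * r)) := by gcongr
      _ ≤ _ := by nlinarith [mul_le_mul_of_nonneg_right hQBQ hr0.le]
  · -- the product of the two solutions varies inversely to the gap of logarithmic derivatives
    have hx := hD x
    rw [hD 0] at hx
    set G := fun y => vp y / wp y - v y / w y with hG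
    have hGne : G x ≠ 0 := norm_pos_iff.1 (hr0.trans_le (hgap' x))
    have h1 : w x * wp x - 1 = (w 0 * wp 0 - 1) + w 0 * wp 0 * ((G 0 - G x) / G x) := by
      have h2 : w x * wp x = w 0 * wp 0 * G 0 / G x := by
        rw [eq_div_iff hGne]; exact hx.symm
      rw [h2]; field_simp; ring
    have h3 : ‖q 0 - q x‖ ≤ B / r := by
      have := hq.norm_sub_le hr0 (κ := q x) (m := φ x) (hq.sq x) (hq.le_re x) 0
      refine this.trans ?_
      have h4 : |φ 0 - φ x| ≤ 2 * B := (abs_sub _ _).trans (by linarith [hφB 0, hφB x])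
      calc _ ≤ 2 * B / (2 * r) := by gcongr
        _ = _ := by field_simp
    have h4 : ‖G 0 - G x‖ ≤ 2 * (B / r) + 4 * E := by
      have h5 : G 0 - G x = -2 * (q 0 - q x) + ((vp 0 / wp 0 + q 0) - (v 0 / w 0 - q 0))
          + ((v x / w x - q x) - (vp x / wp x + q x)) := by simp only [hG]; ring
      rw [h5]
      refine norm_add₃_le.trans ?_
      rw [norm_mul, norm_neg]
      have := norm_sub_le (vp 0 / wp 0 + q 0) (v 0 / w 0 - q 0)
      have := norm_sub_le (v x / w x - q x) (vp x / wp x + q x)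
      norm_num
      linarith [hm1 0, hp1 0, hm1 x, hp1 x]
    rw [h1]
    refine (norm_add_le _ _).trans ?_
    rw [norm_mul, norm_div]
    have h6 : ‖G 0 - G x‖ / ‖G x‖ ≤ (2 * (B / r) + 4 * E) / r := by
      gcongr; exact hgap' x
    have h7 : (2 * (B / r) + 4 * E) / r ≤ 3 * (B / r) := by
      rw [div_le_iff₀ hr0]
      have : 1 / 50 / r ≤ B / r := by gcongr; linarith
      have e1 : 1 / 200 / r * 4 = 1 / 50 / r := by ring
      have e2 : 3 * (B / r) * 1 ≤ 3 * (B / r) * r := by gcongr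
      linarith
    have h8 : ‖w 0 * wp 0‖ * (‖G 0 - G x‖ / ‖G x‖) ≤ 2 * (3 * (B / r)) := by
      gcongr; linarith
    have h9 : 60 * B / r = 60 * (B / r) := by ring
    have h10 : 100 * (Q * B) / r = 100 * (Q * B / r) := by ring
    have h11 : B / r ≤ Q * B / r := by gcongr
    have h12 : 0 ≤ B / r := by positivity
    linarith

end

/-! ### Gauss–Legendre quadrature on a cell -/

/-- A sequence of functions each of which is the derivative of the one before. -/
def IsJet (d : ℕ → ℝ → ℝ) : Prop := ∀ p x, HasDerivAt (d p) (d (p + 1) x) x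

/-- The `L¹` norm of `g` on the cell `[y, y + h]`. -/
noncomputable def cellNorm (g : ℝ → ℝ) (y h : ℝ) : ℝ := ∫ x in y..(y + h), |g x|

namespace IsJet
variable {d : ℕ → ℝ → ℝ} {y h : ℝ}

theorem continuous (hd : IsJet d) (p : ℕ) : Continuous (d p) :=
  continuous_iff_continuousAt.2 fun x => (hd p x).continuousAt

theorem cellNorm_nonneg (g : ℝ → ℝ) (hh : 0 ≤ h) : 0 ≤ cellNorm g y h :=
  intervalIntegral.integral_nonneg (by linarith) fun _ _ => abs_nonneg _

theorem abs_sub_le_cellNorm (hd : IsJet d) (p : ℕ) {a b : ℝ} (ha : a ∈ Set.Icc y (y + h))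
    (hb : b ∈ Set.Icc y (y + h)) : |d p b - d p a| ≤ cellNorm (d (p + 1)) y h := by
  rw [← intervalIntegral.integral_eq_sub_of_hasDerivAt (fun x _ => hd p x)
    ((hd.continuous (p + 1)).intervalIntegrable _ _), ← Real.norm_eq_abs]
  have hh : y ≤ y + h := ha.1.trans ha.2
  refine intervalIntegral.norm_integral_le_integral_norm_uIoc.trans ?_
  rw [cellNorm, intervalIntegral.integral_of_le hh]
  refine setIntegral_mono_set ?_ (Eventually.of_forall fun _ => abs_nonneg _) ?_
  · exact ((hd.continuous (p + 1)).abs.intervalIntegrable y (y + h)).1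
  · refine LE.le.eventuallyLE ?_
    exact Set.Ioc_subset_Ioc (le_min ha.1 hb.1) (max_le ha.2 hb.2)

/-- Taylor expansion within a cell, with the remainder measured by the `L¹` norm of the last
derivative. -/
theorem taylor_cell (hd : IsJet d) (hh : 0 ≤ h) {m : ℝ} (hm : m ∈ Set.Icc y (y + h)) (n : ℕ) :
    ∀ k : ℕ, ∀ x ∈ Set.Icc y (y + h),
      |d k x - ∑ i ∈ Finset.range (n + 1), d (k + i) m * (x - m) ^ i / (i.factorial : ℝ)| ≤
        h ^ n * cellNorm (d (k + n + 1)) y h := by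
  induction n with
  | zero =>
    intro k x hx
    simpa using hd.abs_sub_le_cellNorm k hm hx
  | succ n ih =>
    intro k x hx
    have hderiv : ∀ t : ℝ, HasDerivAt
        (fun t => d k t - ∑ i ∈ Finset.range (n + 2), d (k + i) m * (t - m) ^ i / (i.factorial : ℝ))
        (d (k + 1) t - ∑ i ∈ Finset.range (n + 1),
          d (k + 1 + i) m * (t - m) ^ i / (i.factorial : ℝ)) t := by
      intro t
      refine (hd k t).sub ?_
      have h1 : ∀ i ∈ Finset.range (n + 2), HasDerivAt
          (fun t => d (k + i) m * (t - m) ^ i / (i.factorial : ℝ))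
          (d (k + i) m * ((i : ℝ) * (t - m) ^ (i - 1)) / (i.factorial : ℝ)) t := by
        intro i _
        have := ((((hasDerivAt_id t).sub_const m).pow i).const_mul (d (k + i) m)).div_const
          (i.factorial : ℝ)
        simpa using this
      refine (HasDerivAt.fun_sum h1).congr_deriv ?_
      rw [Finset.sum_range_succ']
      simp only [Nat.cast_zero, zero_mul, mul_zero, zero_div, add_zero]
      refine Finset.sum_congr rfl fun i _ => ?_
      rw [Nat.factorial_succ, show k + (i + 1) = k + 1 + i by ring]
      push_cast
      have : ((i : ℝ) + 1) ≠ 0 := by positivity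
      have : (i.factorial : ℝ) ≠ 0 := by positivity
      field_simp
    have hbd := Convex.norm_image_sub_le_of_norm_hasDerivWithin_le (s := Set.Icc y (y + h))
      (f := fun t => d k t -
        ∑ i ∈ Finset.range (n + 2), d (k + i) m * (t - m) ^ i / (i.factorial : ℝ))
      (C := h ^ n * cellNorm (d (k + 1 + n + 1)) y h)
      (fun t _ => (hderiv t).hasDerivWithinAt) (fun t ht => ih (k + 1) t ht)
      (convex_Icc _ _) hm hx
    have hzero : d k m - ∑ i ∈ Finset.range (n + 2),
        d (k + i) m * (m - m) ^ i / (i.factorial : ℝ) = 0 := by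
      rw [Finset.sum_range_succ']
      simp
    rw [hzero, sub_zero, Real.norm_eq_abs, Real.norm_eq_abs] at hbd
    refine hbd.trans ?_
    have hxm : |x - m| ≤ h := abs_le.2 ⟨by linarith [hx.1, hm.2], by linarith [hx.2, hm.1]⟩
    rw [show k + (n + 1) + 1 = k + 1 + n + 1 by ring]
    have := cellNorm_nonneg (d (k + 1 + n + 1)) (y := y) hh
    calc _ ≤ h ^ n * cellNorm (d (k + 1 + n + 1)) y h * h := by gcongr
      _ = _ := by ring

end IsJet

theorem gaussPoint_mem {y h : ℝ} (hh : 0 ≤ h) :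
    gaussPoint₁ y h ∈ Set.Icc y (y + h) ∧ gaussPoint₂ y h ∈ Set.Icc y (y + h) := by
  have h1 : Real.sqrt 3 ≤ 2 := by rw [Real.sqrt_le_left (by norm_num)]; norm_num
  have h2 : 0 ≤ Real.sqrt 3 := Real.sqrt_nonneg 3
  refine ⟨⟨?_, ?_⟩, ?_, ?_⟩ <;> simp only [gaussPoint₁, gaussPoint₂] <;> nlinarith

/-- The mean of `φ` over the two Gauss points of the step from `y`. -/
noncomputable def gaussMean (φ : ℝ → ℝ) (h y : ℝ) : ℝ :=
  (φ (gaussPoint₁ y h) + φ (gaussPoint₂ y h)) / 2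

/-- The commutator coefficient of the Magnus step from `y`, divided by `h`. It is `h² φ' / 12` to
leading order. -/
noncomputable def gaussSlope (φ : ℝ → ℝ) (h y : ℝ) : ℝ :=
  Real.sqrt 3 / 12 * h * (φ (gaussPoint₂ y h) - φ (gaussPoint₁ y h))

section
variable {d : ℕ → ℝ → ℝ} {y h : ℝ}

/-- Two-point Gauss quadrature on one cell, including the leading error term, which telescopes
over adjacent cells. -/
theorem abs_gauss_quadrature_le (hd : IsJet d) (hh : 0 ≤ h) :
    |(∫ x in y..(y + h), d 0 x) - h * gaussMean (d 0) h y
      - h ^ 4 / 4320 * (d 3 (y + h) - d 3 y)| ≤ 4 * h ^ 6 * cellNorm (d 6) y h := by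
  -- the jet is extended downwards by a primitive of `d 0`, whose increment is the integral
  have hd' : IsJet (fun p => Nat.casesOn p (fun x => ∫ t in y..x, d 0 t) d) := by
    intro p x
    cases p with
    | zero => exact ((hd.continuous 0).integral_hasStrictDerivAt y x).hasDerivAt
    | succ p => exact hd p x
  set m := y + h / 2 with hm
  have hmem : m ∈ Set.Icc y (y + h) := ⟨by linarith, by linarith⟩
  have h0 : y ∈ Set.Icc y (y + h) := ⟨le_rfl, by linarith⟩
  have h1 : y + h ∈ Set.Icc y (y + h) := ⟨by linarith, le_rfl⟩
  obtain ⟨hp1, hp2⟩ := gaussPoint_mem (y := y) hh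
  set J := cellNorm (d 6) y h with hJ
  have hJ0 : 0 ≤ J := IsJet.cellNorm_nonneg _ hh
  have r1 := hd'.taylor_cell hh hmem 6 0 (y + h) h1
  have r2 := hd'.taylor_cell hh hmem 6 0 y h0
  have r3 := hd.taylor_cell hh hmem 5 0 _ hp1
  have r4 := hd.taylor_cell hh hmem 5 0 _ hp2
  have r5 := hd.taylor_cell hh hmem 2 3 (y + h) h1
  have r6 := hd.taylor_cell hh hmem 2 3 y h0
  have e1 : y + h - m = h / 2 := by rw [hm]; ring
  have e2 : y - m = -(h / 2) := by rw [hm]; ring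
  have e3 : gaussPoint₁ y h - m = -(Real.sqrt 3 / 6 * h) := by rw [hm, gaussPoint₁]; ring
  have e4 : gaussPoint₂ y h - m = Real.sqrt 3 / 6 * h := by rw [hm, gaussPoint₂]; ring
  rw [e1] at r1 r5
  rw [e2] at r2 r6
  rw [e3] at r3
  rw [e4] at r4
  set s := Real.sqrt 3 / 6 * h with hs
  have hs2 : s ^ 2 = h ^ 2 / 12 := by
    rw [hs, mul_pow, div_pow, Real.sq_sqrt (by norm_num)]; ring
  have hs4 : s ^ 4 = h ^ 4 / 144 := by
    rw [show s ^ 4 = (s ^ 2) ^ 2 by ring, hs2]; ring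
  simp only [Finset.sum_range_succ, Finset.sum_range_zero, Nat.factorial, zero_add, Nat.cast_one,
    Nat.reduceAdd, Nat.reduceMul, Nat.cast_ofNat, Nat.succ_eq_add_one, mul_one] at r1 r2 r3 r4 r5 r6
  rw [← hJ] at r1 r2 r3 r4 r5 r6
  set F := ∫ x in y..(y + h), d 0 x
  obtain ⟨ρ₁, q1, b1⟩ : ∃ ρ, _ = ρ ∧ |ρ| ≤ _ := ⟨_, rfl, r1⟩
  obtain ⟨ρ₂, q2, b2⟩ : ∃ ρ, _ = ρ ∧ |ρ| ≤ _ := ⟨_, rfl, r2⟩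
  obtain ⟨ρ₃, q3, b3⟩ : ∃ ρ, _ = ρ ∧ |ρ| ≤ _ := ⟨_, rfl, r3⟩
  obtain ⟨ρ₄, q4, b4⟩ : ∃ ρ, _ = ρ ∧ |ρ| ≤ _ := ⟨_, rfl, r4⟩
  obtain ⟨ρ₅, q5, b5⟩ : ∃ ρ, _ = ρ ∧ |ρ| ≤ _ := ⟨_, rfl, r5⟩
  obtain ⟨ρ₆, q6, b6⟩ : ∃ ρ, _ = ρ ∧ |ρ| ≤ _ := ⟨_, rfl, r6⟩
  clear r1 r2 r3 r4 r5 r6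
  have key : F - h * gaussMean (d 0) h y - h ^ 4 / 4320 * (d 3 (y + h) - d 3 y) =
      ρ₁ - ρ₂ - h / 2 * (ρ₃ + ρ₄) - h ^ 4 / 4320 * (ρ₅ - ρ₆) := by
    have hF0 : ∫ t in y..y, d 0 t = 0 := intervalIntegral.integral_same
    rw [gaussMean]
    linear_combination q1 - q2 - h / 2 * (q3 + q4) - h ^ 4 / 4320 * (q5 - q6) + hF0
      - h * d 2 m / 2 * hs2 - h * d 4 m / 24 * hs4
  rw [key]
  have t1 := abs_sub (ρ₁ - ρ₂ - h / 2 * (ρ₃ + ρ₄)) (h ^ 4 / 4320 * (ρ₅ - ρ₆))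
  have t2 := abs_sub (ρ₁ - ρ₂) (h / 2 * (ρ₃ + ρ₄))
  have t3 := abs_sub ρ₁ ρ₂
  have t4 : |h / 2 * (ρ₃ + ρ₄)| ≤ h / 2 * (h ^ 5 * J + h ^ 5 * J) := by
    rw [abs_mul, abs_of_nonneg (by positivity : 0 ≤ h / 2)]
    gcongr
    exact (abs_add_le _ _).trans (add_le_add b3 b4)
  have t5 : |h ^ 4 / 4320 * (ρ₅ - ρ₆)| ≤ h ^ 4 / 4320 * (h ^ 2 * J + h ^ 2 * J) := by
    rw [abs_mul, abs_of_nonneg (by positivity : 0 ≤ h ^ 4 / 4320)]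
    gcongr
    exact (abs_sub _ _).trans (add_le_add b5 b6)
  have hJ6 : 0 ≤ h ^ 6 * J := by positivity
  linarith

/-- The slope of a step is `h² φ' / 12` up to `h²` times the variation of `φ'` over the cell. -/
theorem abs_gaussSlope_sub_le (hd : IsJet d) (hh : 0 ≤ h) {x : ℝ} (hx : x ∈ Set.Icc y (y + h)) :
    |gaussSlope (d 0) h y - h ^ 2 / 12 * d 1 x| ≤ h ^ 2 * cellNorm (d 2) y h := by
  set m := y + h / 2 with hm
  have hmem : m ∈ Set.Icc y (y + h) := ⟨by linarith, by linarith⟩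
  obtain ⟨hp1, hp2⟩ := gaussPoint_mem (y := y) hh
  set J := cellNorm (d 2) y h with hJ
  have hJ0 : 0 ≤ J := IsJet.cellNorm_nonneg _ hh
  have r3 := hd.taylor_cell hh hmem 1 0 _ hp1
  have r4 := hd.taylor_cell hh hmem 1 0 _ hp2
  have r5 := hd.abs_sub_le_cellNorm 1 hmem hx
  have e3 : gaussPoint₁ y h - m = -(Real.sqrt 3 / 6 * h) := by rw [hm, gaussPoint₁]; ring
  have e4 : gaussPoint₂ y h - m = Real.sqrt 3 / 6 * h := by rw [hm, gaussPoint₂]; ring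
  rw [e3] at r3
  rw [e4] at r4
  simp only [Finset.sum_range_succ, Finset.sum_range_zero, Nat.factorial, zero_add, Nat.cast_one,
    Nat.reduceAdd, Nat.succ_eq_add_one, mul_one] at r3 r4 r5
  rw [← hJ] at r3 r4 r5
  have hs : Real.sqrt 3 ^ 2 = 3 := Real.sq_sqrt (by norm_num)
  have hs2 : Real.sqrt 3 ≤ 2 := by rw [Real.sqrt_le_left (by norm_num)]; norm_num
  obtain ⟨ρ₃, q3, b3⟩ : ∃ ρ, _ = ρ ∧ |ρ| ≤ _ := ⟨_, rfl, r3⟩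
  obtain ⟨ρ₄, q4, b4⟩ : ∃ ρ, _ = ρ ∧ |ρ| ≤ _ := ⟨_, rfl, r4⟩
  have key : gaussSlope (d 0) h y - h ^ 2 / 12 * d 1 x =
      Real.sqrt 3 / 12 * h * (ρ₄ - ρ₃) - h ^ 2 / 12 * (d 1 x - d 1 m) := by
    rw [gaussSlope]
    linear_combination Real.sqrt 3 / 12 * h * (q4 - q3) + h ^ 2 * d 1 m / 36 * hs
  rw [key]
  have t1 := abs_sub (Real.sqrt 3 / 12 * h * (ρ₄ - ρ₃)) (h ^ 2 / 12 * (d 1 x - d 1 m))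
  have t2 : |Real.sqrt 3 / 12 * h * (ρ₄ - ρ₃)| ≤ 2 / 12 * h * (h ^ 1 * J + h ^ 1 * J) := by
    rw [abs_mul, abs_of_nonneg (by positivity : 0 ≤ Real.sqrt 3 / 12 * h)]
    gcongr
    exact (abs_sub _ _).trans (add_le_add b4 b3)
  have t3 : |h ^ 2 / 12 * (d 1 x - d 1 m)| ≤ h ^ 2 / 12 * J := by
    rw [abs_mul, abs_of_nonneg (by positivity : 0 ≤ h ^ 2 / 12)]
    gcongr
  have hJ6 : 0 ≤ h ^ 2 * J := by positivity
  linarith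

/-- In the mean over a cell, the error of the slope gains one order, because the Gauss points lie
symmetrically. -/
theorem abs_gaussSlope_mean_le (hd : IsJet d) (hh : 0 ≤ h) :
    |h * gaussSlope (d 0) h y - h ^ 2 / 12 * (d 0 (y + h) - d 0 y)| ≤
      h ^ 4 * cellNorm (d 3) y h := by
  set m := y + h / 2 with hm
  have hmem : m ∈ Set.Icc y (y + h) := ⟨by linarith, by linarith⟩
  have h0 : y ∈ Set.Icc y (y + h) := ⟨le_rfl, by linarith⟩
  have h1 : y + h ∈ Set.Icc y (y + h) := ⟨by linarith, le_rfl⟩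
  obtain ⟨hp1, hp2⟩ := gaussPoint_mem (y := y) hh
  set J := cellNorm (d 3) y h with hJ
  have hJ0 : 0 ≤ J := IsJet.cellNorm_nonneg _ hh
  have r3 := hd.taylor_cell hh hmem 2 0 _ hp1
  have r4 := hd.taylor_cell hh hmem 2 0 _ hp2
  have r5 := hd.taylor_cell hh hmem 2 0 (y + h) h1
  have r6 := hd.taylor_cell hh hmem 2 0 y h0
  have e1 : y + h - m = h / 2 := by rw [hm]; ring
  have e2 : y - m = -(h / 2) := by rw [hm]; ring
  have e3 : gaussPoint₁ y h - m = -(Real.sqrt 3 / 6 * h) := by rw [hm, gaussPoint₁]; ring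
  have e4 : gaussPoint₂ y h - m = Real.sqrt 3 / 6 * h := by rw [hm, gaussPoint₂]; ring
  rw [e1] at r5
  rw [e2] at r6
  rw [e3] at r3
  rw [e4] at r4
  simp only [Finset.sum_range_succ, Finset.sum_range_zero, Nat.factorial, zero_add, Nat.cast_one,
    Nat.reduceAdd, Nat.cast_ofNat, Nat.succ_eq_add_one, mul_one] at r3 r4 r5 r6
  rw [← hJ] at r3 r4 r5 r6
  have hs : Real.sqrt 3 ^ 2 = 3 := Real.sq_sqrt (by norm_num)
  have hs2 : Real.sqrt 3 ≤ 2 := by rw [Real.sqrt_le_left (by norm_num)]; norm_num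
  obtain ⟨ρ₃, q3, b3⟩ : ∃ ρ, _ = ρ ∧ |ρ| ≤ _ := ⟨_, rfl, r3⟩
  obtain ⟨ρ₄, q4, b4⟩ : ∃ ρ, _ = ρ ∧ |ρ| ≤ _ := ⟨_, rfl, r4⟩
  obtain ⟨ρ₅, q5, b5⟩ : ∃ ρ, _ = ρ ∧ |ρ| ≤ _ := ⟨_, rfl, r5⟩
  obtain ⟨ρ₆, q6, b6⟩ : ∃ ρ, _ = ρ ∧ |ρ| ≤ _ := ⟨_, rfl, r6⟩
  have key : h * gaussSlope (d 0) h y - h ^ 2 / 12 * (d 0 (y + h) - d 0 y) =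
      Real.sqrt 3 / 12 * h ^ 2 * (ρ₄ - ρ₃) - h ^ 2 / 12 * (ρ₅ - ρ₆) := by
    rw [gaussSlope]
    linear_combination Real.sqrt 3 / 12 * h ^ 2 * (q4 - q3) - h ^ 2 / 12 * (q5 - q6)
      + h ^ 3 * d 1 m / 36 * hs
  rw [key]
  have t1 := abs_sub (Real.sqrt 3 / 12 * h ^ 2 * (ρ₄ - ρ₃)) (h ^ 2 / 12 * (ρ₅ - ρ₆))
  have t2 : |Real.sqrt 3 / 12 * h ^ 2 * (ρ₄ - ρ₃)| ≤
      2 / 12 * h ^ 2 * (h ^ 2 * J + h ^ 2 * J) := by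
    rw [abs_mul, abs_of_nonneg (by positivity : 0 ≤ Real.sqrt 3 / 12 * h ^ 2)]
    gcongr
    exact (abs_sub _ _).trans (add_le_add b4 b3)
  have t3 : |h ^ 2 / 12 * (ρ₅ - ρ₆)| ≤ h ^ 2 / 12 * (h ^ 2 * J + h ^ 2 * J) := by
    rw [abs_mul, abs_of_nonneg (by positivity : 0 ≤ h ^ 2 / 12)]
    gcongr
    exact (abs_sub _ _).trans (add_le_add b5 b6)
  have hJ6 : 0 ≤ h ^ 4 * J := by positivity
  linarith

theorem abs_sub_gaussMean_le (hd : IsJet d) (hh : 0 ≤ h) {x : ℝ} (hx : x ∈ Set.Icc y (y + h)) :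
    |d 0 x - gaussMean (d 0) h y| ≤ cellNorm (d 1) y h := by
  obtain ⟨hp1, hp2⟩ := gaussPoint_mem (y := y) hh
  have r1 := hd.abs_sub_le_cellNorm 0 hp1 hx
  have r2 := hd.abs_sub_le_cellNorm 0 hp2 hx
  rw [zero_add] at r1 r2
  obtain ⟨l1, u1⟩ := abs_le.1 r1
  obtain ⟨l2, u2⟩ := abs_le.1 r2
  rw [gaussMean, abs_le]
  constructor <;> linarith

theorem abs_gaussSlope_le (hd : IsJet d) (hh : 0 ≤ h) :
    |gaussSlope (d 0) h y| ≤ h * cellNorm (d 1) y h := by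
  obtain ⟨hp1, hp2⟩ := gaussPoint_mem (y := y) hh
  have r1 := hd.abs_sub_le_cellNorm 0 hp1 hp2
  have hs2 : Real.sqrt 3 ≤ 2 := by rw [Real.sqrt_le_left (by norm_num)]; norm_num
  have hJ0 := IsJet.cellNorm_nonneg (d 1) (y := y) hh
  rw [gaussSlope, abs_mul, abs_of_nonneg (by positivity : 0 ≤ Real.sqrt 3 / 12 * h)]
  calc _ ≤ 2 / 12 * h * cellNorm (d 1) y h := by gcongr
    _ ≤ _ := by nlinarith [mul_nonneg hh hJ0]

end

/-! ### Cells of a grid -/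

/-- The index of the cell `[x₀ + i h, x₀ + (i + 1) h)` that contains `x`. -/
noncomputable def cellIndex (x₀ h x : ℝ) : ℕ := ⌊(x - x₀) / h⌋₊

/-- The left end of the cell that contains `x`. -/
noncomputable def cellStart (x₀ h x : ℝ) : ℝ := x₀ + cellIndex x₀ h x * h

section
variable {x₀ h x : ℝ}

theorem cellIndex_eq (hh : 0 < h) {i : ℕ} (hx : x ∈ Set.Ico (x₀ + i * h) (x₀ + i * h + h)) :
    cellIndex x₀ h x = i := by
  rw [cellIndex, Nat.floor_eq_iff (by
    apply div_nonneg _ hh.le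
    have : 0 ≤ (i : ℝ) * h := by positivity
    linarith [hx.1])]
  rw [le_div_iff₀ hh, div_lt_iff₀ hh]
  constructor <;> linarith [hx.1, hx.2]

theorem mem_cell (hh : 0 < h) (hx : x₀ ≤ x) :
    x ∈ Set.Ico (cellStart x₀ h x) (cellStart x₀ h x + h) := by
  have h0 : 0 ≤ (x - x₀) / h := div_nonneg (by linarith) hh.le
  have h1 := Nat.floor_le h0
  have h2 := Nat.lt_floor_add_one ((x - x₀) / h)
  rw [le_div_iff₀ hh] at h1
  rw [div_lt_iff₀ hh] at h2
  rw [cellStart, cellIndex]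
  constructor <;> linarith

theorem cellIndex_eventuallyEq (hh : 0 < h) (hx : x₀ ≤ x) :
    ∀ᶠ t in 𝓝[≥] x, cellIndex x₀ h t = cellIndex x₀ h x := by
  have h1 := mem_cell hh hx
  filter_upwards [Ico_mem_nhdsGE h1.2] with t ht
  exact cellIndex_eq hh ⟨h1.1.trans ht.1, ht.2⟩

/-- Integration, cell by cell, of a function that is continuous on each cell. -/
theorem integral_cells (hh : 0 < h) {G : ℝ → ℝ → ℝ} (hG : ∀ y, Continuous (G y)) (n : ℕ) :
    IntervalIntegrable (fun x => G (cellStart x₀ h x) x) volume x₀ (x₀ + n * h) ∧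
    ∫ x in x₀..(x₀ + n * h), G (cellStart x₀ h x) x =
      ∑ i ∈ Finset.range n, ∫ x in (x₀ + i * h)..(x₀ + i * h + h), G (x₀ + i * h) x := by
  induction n with
  | zero => simp
  | succ n ih =>
    have e : x₀ + ((n + 1 : ℕ) : ℝ) * h = x₀ + n * h + h := by push_cast; ring
    have hle : x₀ + n * h ≤ x₀ + n * h + h := by linarith
    have hcongr : ∀ x ∈ Set.Ioo (x₀ + n * h) (x₀ + n * h + h),
        G (x₀ + n * h) x = G (cellStart x₀ h x) x := by
      intro x hx
      rw [cellStart, cellIndex_eq hh ⟨hx.1.le, hx.2⟩]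
    have hint : IntervalIntegrable (fun x => G (cellStart x₀ h x) x) volume
        (x₀ + n * h) (x₀ + n * h + h) := by
      refine ((hG (x₀ + n * h)).intervalIntegrable _ _).congr_uIoo ?_
      rw [Set.uIoo_of_le hle]
      exact hcongr
    rw [e]
    refine ⟨ih.1.trans hint, ?_⟩
    rw [← intervalIntegral.integral_add_adjacent_intervals ih.1 hint, ih.2,
      Finset.sum_range_succ, intervalIntegral.integral_congr_Ioo_of_le hle hcongr]

end

/-! ### Slope and potential of a step against the exact potential -/

/-- A jet that is bounded, and bounded in `L¹`, to the order that the error analysis uses. -/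
structure BoundedJet (d : ℕ → ℝ → ℝ) (B : ℝ) : Prop where
  jet : IsJet d
  one_le : 1 ≤ B
  bound : ∀ p ≤ 3, ∀ x, |d p x| ≤ B
  integral_bound : ∀ p, 1 ≤ p → p ≤ 6 → ∀ x₀ x₁, x₀ ≤ x₁ → ∫ x in x₀..x₁, |d p x| ≤ B

/-- The excess of the slope of the Magnus step from `y` over `h² φ' / 12`. -/
noncomputable def slopeError (d : ℕ → ℝ → ℝ) (h y x : ℝ) : ℝ :=
  gaussSlope (d 0) h y - h ^ 2 / 12 * d 1 x

/-- The potential felt by the exact flow minus that felt by the numerical flow on the cell from `y`,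
in the gauge that shifts the second component by `h² φ' / 12` times the first. -/
noncomputable def potentialError (d : ℕ → ℝ → ℝ) (h y x : ℝ) : ℝ :=
  d 0 x - gaussMean (d 0) h y + h ^ 2 / 12 * d 2 x + gaussSlope (d 0) h y ^ 2
    - slopeError d h y x ^ 2

section
variable {d : ℕ → ℝ → ℝ} {B y h : ℝ}

theorem IsJet.continuous_slopeError (hd : IsJet d) (h y : ℝ) : Continuous (slopeError d h y) :=
  continuous_const.sub (continuous_const.mul (hd.continuous 1))

theorem IsJet.continuous_potentialError (hd : IsJet d) (h y : ℝ) :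
    Continuous (potentialError d h y) := by
  have h0 := hd.continuous 0
  have h2 := hd.continuous 2
  have h3 := hd.continuous_slopeError h y
  unfold potentialError
  fun_prop

namespace BoundedJet

theorem cellNorm_le (hd : BoundedJet d B) (hh : 0 ≤ h) {p : ℕ} (hp : p ≤ 3) :
    cellNorm (d p) y h ≤ h * B := by
  rw [cellNorm]
  calc _ ≤ ∫ _ in y..(y + h), B := intervalIntegral.integral_mono_on (by linarith)
        ((hd.jet.continuous p).abs.intervalIntegrable _ _) intervalIntegrable_const
        fun x _ => hd.bound p hp x
    _ = _ := by simp

theorem sum_cellNorm_le (hd : BoundedJet d B) (hh : 0 ≤ h) {p : ℕ} (hp1 : 1 ≤ p) (hp : p ≤ 6)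
    (x₀ : ℝ) (n : ℕ) : ∑ i ∈ Finset.range n, cellNorm (d p) (x₀ + i * h) h ≤ B := by
  have h1 := intervalIntegral.sum_integral_adjacent_intervals (f := fun x => |d p x|)
    (a := fun i : ℕ => x₀ + i * h) (n := n) (μ := volume)
    fun k _ => (hd.jet.continuous p).abs.intervalIntegrable _ _
  have h2 : ∀ i : ℕ, x₀ + ((i + 1 : ℕ) : ℝ) * h = x₀ + i * h + h := fun i => by push_cast; ring
  simp only [h2] at h1
  simp only [cellNorm]
  rw [h1]
  refine hd.integral_bound p hp1 hp _ _ ?_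
  have : 0 ≤ (n : ℝ) * h := by positivity
  simp; linarith

theorem abs_slopeError_le (hd : BoundedJet d B) (hh : 0 < h) {x : ℝ} (hx : x ∈ Set.Icc y (y + h)) :
    |slopeError d h y x| ≤ h ^ 2 * cellNorm (d 2) y h :=
  abs_gaussSlope_sub_le hd.jet hh.le hx

theorem abs_potentialError_le (hd : BoundedJet d B) (hh : 0 < h) (hh1 : h ≤ 1) {x : ℝ}
    (hx : x ∈ Set.Icc y (y + h)) :
    |potentialError d h y x| ≤
      2 * B * cellNorm (d 1) y h + B * cellNorm (d 2) y h + h ^ 2 * |d 2 x| := by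
  have h1 := abs_sub_gaussMean_le hd.jet hh.le hx
  have h2 := abs_gaussSlope_le hd.jet hh.le (y := y)
  have h3 := hd.abs_slopeError_le hh hx
  have hJ1 := hd.cellNorm_le hh.le (y := y) (p := 1) (by norm_num)
  have hJ2 := hd.cellNorm_le hh.le (y := y) (p := 2) (by norm_num)
  have hJ10 := IsJet.cellNorm_nonneg (d 1) (y := y) hh.le
  have hJ20 := IsJet.cellNorm_nonneg (d 2) (y := y) hh.le
  set J1 := cellNorm (d 1) y h
  set J2 := cellNorm (d 2) y h
  have hB := hd.one_le
  have hJ1B : J1 ≤ B := hJ1.trans (by nlinarith)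
  have hJ2B : J2 ≤ B := hJ2.trans (by nlinarith)
  have e1 : gaussSlope (d 0) h y ^ 2 ≤ B * J1 := by
    have h4 : |gaussSlope (d 0) h y| ≤ J1 := h2.trans (by nlinarith)
    rw [← sq_abs]
    calc _ ≤ J1 ^ 2 := by gcongr
      _ ≤ _ := by nlinarith
  have e2 : slopeError d h y x ^ 2 ≤ B * J2 := by
    have h4 : |slopeError d h y x| ≤ J2 := h3.trans (by
      have : h ^ 2 ≤ 1 := pow_le_one₀ hh.le hh1
      nlinarith)
    rw [← sq_abs]
    calc _ ≤ J2 ^ 2 := by gcongr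
      _ ≤ _ := by nlinarith
  have e3 : |h ^ 2 / 12 * d 2 x| ≤ h ^ 2 * |d 2 x| := by
    rw [abs_mul, abs_of_nonneg (by positivity)]
    gcongr
    linarith [sq_nonneg h]
  have e4 : J1 ≤ B * J1 := by nlinarith
  obtain ⟨l1, u1⟩ := abs_le.1 h1
  obtain ⟨l3, u3⟩ := abs_le.1 e3
  rw [potentialError, abs_le]
  constructor <;> nlinarith [sq_nonneg (gaussSlope (d 0) h y), sq_nonneg (slopeError d h y x)]

theorem abs_potentialError_le_mul (hd : BoundedJet d B) (hh : 0 < h) (hh1 : h ≤ 1) {x : ℝ}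
    (hx : x ∈ Set.Icc y (y + h)) :
    |potentialError d h y x| ≤ 4 * B ^ 2 * h := by
  have hB := hd.one_le
  have h1 := hd.abs_potentialError_le hh hh1 hx
  have hJ1 := hd.cellNorm_le hh.le (y := y) (p := 1) (by norm_num)
  have hJ2 := hd.cellNorm_le hh.le (y := y) (p := 2) (by norm_num)
  have h2 : h ^ 2 * |d 2 x| ≤ h * B ^ 2 := by
    have := hd.bound 2 (by norm_num) x
    calc _ ≤ h ^ 2 * B := by gcongr
      _ ≤ _ := by nlinarith [mul_pos hh (by linarith : 0 < B)]
  calc _ ≤ 2 * B * (h * B) + B * (h * B) + h * B ^ 2 := by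
        refine h1.trans ?_
        gcongr
    _ = _ := by ring

theorem integral_abs_potentialError_le (hd : BoundedJet d B) (hh : 0 < h) (hh1 : h ≤ 1) :
    ∫ x in y..(y + h), |potentialError d h y x| ≤
      h * (2 * B * cellNorm (d 1) y h + 2 * B * cellNorm (d 2) y h) := by
  have hJ20 := IsJet.cellNorm_nonneg (d 2) (y := y) hh.le
  have hB := hd.one_le
  calc _ ≤ ∫ x in y..(y + h),
          (2 * B * cellNorm (d 1) y h + B * cellNorm (d 2) y h + h ^ 2 * |d 2 x|) :=
        intervalIntegral.integral_mono_on (by linarith)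
          ((hd.jet.continuous_potentialError h y).abs.intervalIntegrable _ _)
          ((continuous_const.add
            (continuous_const.mul (hd.jet.continuous 2).abs)).intervalIntegrable _ _)
          fun x hx => hd.abs_potentialError_le hh hh1 hx
    _ = h * (2 * B * cellNorm (d 1) y h + B * cellNorm (d 2) y h) + h ^ 2 * cellNorm (d 2) y h := by
        have hi : IntervalIntegrable (fun x => h ^ 2 * |d 2 x|) volume y (y + h) :=
          (continuous_const.mul (hd.jet.continuous 2).abs).intervalIntegrable _ _
        rw [intervalIntegral.integral_add intervalIntegrable_const hi,
          intervalIntegral.integral_const, intervalIntegral.integral_const_mul, cellNorm, cellNorm]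
        simp
    _ ≤ _ := by
        have h1 : h ^ 2 * cellNorm (d 2) y h ≤ h * (B * cellNorm (d 2) y h) := by
          have : h * cellNorm (d 2) y h ≤ B * cellNorm (d 2) y h := by gcongr; linarith
          nlinarith
        linarith

theorem integral_abs_slopeError_le (hd : BoundedJet d B) (hh : 0 < h) :
    ∫ x in y..(y + h), |slopeError d h y x| ≤ h ^ 3 * cellNorm (d 2) y h := by
  calc _ ≤ ∫ _ in y..(y + h), h ^ 2 * cellNorm (d 2) y h :=
        intervalIntegral.integral_mono_on (by linarith)
          ((hd.jet.continuous_slopeError h y).abs.intervalIntegrable _ _)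
          intervalIntegrable_const
          fun x hx => hd.abs_slopeError_le hh hx
    _ = _ := by simp; ring

/-- The mean of the potential error over a cell. The first two terms telescope. -/
theorem abs_integral_potentialError_sub_le (hd : BoundedJet d B) (hh : 0 < h) :
    |(∫ x in y..(y + h), potentialError d h y x) -
      (h ^ 4 / 4320 * (d 3 (y + h) - d 3 y) + h ^ 2 / 12 * (d 1 (y + h) - d 1 y)
        + h ^ 4 / 144 * ∫ x in y..(y + h), d 1 x ^ 2)| ≤
      h ^ 6 * (4 * cellNorm (d 6) y h + B * cellNorm (d 2) y h + B * cellNorm (d 3) y h) := by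
  have hB := hd.one_le
  have hc0 := hd.jet.continuous 0
  have hc1 := hd.jet.continuous 1
  have hc2 := hd.jet.continuous 2
  have hcs := hd.jet.continuous_slopeError h y
  set J2 := cellNorm (d 2) y h with hJ2
  set J3 := cellNorm (d 3) y h with hJ3
  have hJ20 : 0 ≤ J2 := IsJet.cellNorm_nonneg _ hh.le
  have hJ30 : 0 ≤ J3 := IsJet.cellNorm_nonneg _ hh.le
  have hJ2B : J2 ≤ h * B := hd.cellNorm_le hh.le (by norm_num)
  set b := gaussSlope (d 0) h y with hb
  -- `β` is split into its value at the left end, which meets the small mean of the slope error,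
  -- and the variation over the cell, which is itself of higher order
  have hsplit : ∀ x, potentialError d h y x = (d 0 x - gaussMean (d 0) h y) + h ^ 2 / 12 * d 2 x
      + h ^ 4 / 144 * d 1 x ^ 2 + h ^ 2 / 6 * d 1 y * slopeError d h y x
      + h ^ 2 / 6 * ((d 1 x - d 1 y) * slopeError d h y x) := by
    intro x
    simp only [potentialError, slopeError]
    ring
  have i1 : IntervalIntegrable (fun x => d 0 x - gaussMean (d 0) h y) volume y (y + h) :=
    (hc0.sub continuous_const).intervalIntegrable _ _
  have i2 : IntervalIntegrable (fun x => h ^ 2 / 12 * d 2 x) volume y (y + h) :=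
    (continuous_const.mul hc2).intervalIntegrable _ _
  have i3 : IntervalIntegrable (fun x => h ^ 4 / 144 * d 1 x ^ 2) volume y (y + h) :=
    (continuous_const.mul (hc1.pow 2)).intervalIntegrable _ _
  have i4 : IntervalIntegrable (fun x => h ^ 2 / 6 * d 1 y * slopeError d h y x) volume y (y + h) :=
    (continuous_const.mul hcs).intervalIntegrable _ _
  have i5 : IntervalIntegrable (fun x => h ^ 2 / 6 * ((d 1 x - d 1 y) * slopeError d h y x))
      volume y (y + h) :=
    (continuous_const.mul ((hc1.sub continuous_const).mul hcs)).intervalIntegrable _ _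
  have hint2 : ∫ x in y..(y + h), d 2 x = d 1 (y + h) - d 1 y :=
    intervalIntegral.integral_eq_sub_of_hasDerivAt (fun x _ => hd.jet 1 x)
      (hc2.intervalIntegrable _ _)
  have hint1 : ∫ x in y..(y + h), d 1 x = d 0 (y + h) - d 0 y :=
    intervalIntegral.integral_eq_sub_of_hasDerivAt (fun x _ => hd.jet 0 x)
      (hc1.intervalIntegrable _ _)
  have hints : ∫ x in y..(y + h), slopeError d h y x =
      h * b - h ^ 2 / 12 * (d 0 (y + h) - d 0 y) := by
    have hi : IntervalIntegrable (fun x => h ^ 2 / 12 * d 1 x) volume y (y + h) :=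
      (continuous_const.mul hc1).intervalIntegrable _ _
    simp only [slopeError]
    rw [intervalIntegral.integral_sub intervalIntegrable_const hi,
      intervalIntegral.integral_const_mul, hint1]
    simp [hb]
  have htot : ∫ x in y..(y + h), potentialError d h y x =
      ((∫ x in y..(y + h), d 0 x) - h * gaussMean (d 0) h y) + h ^ 2 / 12 * (d 1 (y + h) - d 1 y)
      + h ^ 4 / 144 * (∫ x in y..(y + h), d 1 x ^ 2)
      + h ^ 2 / 6 * d 1 y * (h * b - h ^ 2 / 12 * (d 0 (y + h) - d 0 y))
      + h ^ 2 / 6 * ∫ x in y..(y + h), (d 1 x - d 1 y) * slopeError d h y x := by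
    simp_rw [hsplit]
    rw [intervalIntegral.integral_add (((i1.add i2).add i3).add i4) i5,
      intervalIntegral.integral_add ((i1.add i2).add i3) i4,
      intervalIntegral.integral_add (i1.add i2) i3, intervalIntegral.integral_add i1 i2,
      intervalIntegral.integral_sub (hc0.intervalIntegrable _ _) intervalIntegrable_const]
    simp only [intervalIntegral.integral_const_mul, hint2, hints, intervalIntegral.integral_const,
      smul_eq_mul, add_sub_cancel_left]
  have t1 := abs_gauss_quadrature_le hd.jet hh.le (y := y)
  have t2 : |h ^ 2 / 6 * d 1 y * (h * b - h ^ 2 / 12 * (d 0 (y + h) - d 0 y))| ≤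
      h ^ 2 / 6 * B * (h ^ 4 * J3) := by
    rw [abs_mul, abs_mul, abs_of_nonneg (by positivity : 0 ≤ h ^ 2 / 6)]
    gcongr
    · exact hd.bound 1 (by norm_num) y
    · exact abs_gaussSlope_mean_le hd.jet hh.le
  have t3 : |∫ x in y..(y + h), (d 1 x - d 1 y) * slopeError d h y x| ≤ J2 * (h ^ 2 * J2) * h := by
    have := intervalIntegral.norm_integral_le_of_norm_le_const (a := y) (b := y + h)
      (f := fun x => (d 1 x - d 1 y) * slopeError d h y x) (C := J2 * (h ^ 2 * J2)) ?_
    · simpa [abs_of_pos hh] using this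
    · intro x hx
      rw [Set.uIoc_of_le (by linarith)] at hx
      have hx' : x ∈ Set.Icc y (y + h) := ⟨hx.1.le, hx.2⟩
      rw [norm_mul, Real.norm_eq_abs, Real.norm_eq_abs]
      gcongr
      · exact hd.jet.abs_sub_le_cellNorm 1 ⟨le_rfl, by linarith⟩ hx'
      · exact hd.abs_slopeError_le hh hx'
  have t4 : |h ^ 2 / 6 * ∫ x in y..(y + h), (d 1 x - d 1 y) * slopeError d h y x| ≤
      h ^ 2 / 6 * (J2 * (h ^ 2 * (h * B)) * h) := by
    rw [abs_mul, abs_of_nonneg (by positivity : 0 ≤ h ^ 2 / 6)]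
    gcongr
    refine t3.trans ?_
    gcongr
  have p1 : 0 ≤ h ^ 6 * B * J3 := by positivity
  have p2 : 0 ≤ h ^ 6 * B * J2 := by positivity
  rw [htot]
  rw [abs_le] at t1 t2 t4 ⊢
  constructor <;> linarith [t1.1, t1.2, t2.1, t2.2, t4.1, t4.2]

end BoundedJet
end

/-! ### Errors accumulated along the grid -/

/-- `slopeError` on the grid of step `h` anchored at `x₀`. -/
noncomputable def gridSlopeError (d : ℕ → ℝ → ℝ) (x₀ h x : ℝ) : ℝ :=
  slopeError d h (cellStart x₀ h x) x

/-- `potentialError` on the grid of step `h` anchored at `x₀`. -/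
noncomputable def gridPotentialError (d : ℕ → ℝ → ℝ) (x₀ h x : ℝ) : ℝ :=
  potentialError d h (cellStart x₀ h x) x

/-- The accumulated potential error: the perturbation `∫ χ` to which the growing coordinate
responds. -/
noncomputable def accumulatedError (d : ℕ → ℝ → ℝ) (x₀ h x : ℝ) : ℝ :=
  ∫ t in x₀..x, gridPotentialError d x₀ h t

namespace BoundedJet
variable {d : ℕ → ℝ → ℝ} {B x₀ h : ℝ}

theorem abs_gridSlopeError_le (hd : BoundedJet d B) (hh : 0 < h) {x : ℝ} (hx : x₀ ≤ x) :
    |gridSlopeError d x₀ h x| ≤ B * h ^ 3 := by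
  refine (hd.abs_slopeError_le hh (Set.Ico_subset_Icc_self (mem_cell hh hx))).trans ?_
  calc _ ≤ h ^ 2 * (h * B) := by gcongr; exact hd.cellNorm_le hh.le (by norm_num)
    _ = _ := by ring

theorem abs_gridPotentialError_le (hd : BoundedJet d B) (hh : 0 < h) (hh1 : h ≤ 1) {x : ℝ}
    (hx : x₀ ≤ x) : |gridPotentialError d x₀ h x| ≤ 4 * B ^ 2 * h :=
  hd.abs_potentialError_le_mul hh hh1 (Set.Ico_subset_Icc_self (mem_cell hh hx))

theorem intervalIntegrable_gridSlopeError (hd : BoundedJet d B) (hh : 0 < h) (n : ℕ) :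
    IntervalIntegrable (gridSlopeError d x₀ h) volume x₀ (x₀ + n * h) :=
  (integral_cells hh (hd.jet.continuous_slopeError h) n).1

theorem intervalIntegrable_gridPotentialError (hd : BoundedJet d B) (hh : 0 < h) (n : ℕ) :
    IntervalIntegrable (gridPotentialError d x₀ h) volume x₀ (x₀ + n * h) :=
  (integral_cells hh (hd.jet.continuous_potentialError h) n).1

theorem integral_abs_gridSlopeError_le (hd : BoundedJet d B) (hh : 0 < h) (n : ℕ) :
    ∫ x in x₀..(x₀ + n * h), |gridSlopeError d x₀ h x| ≤ B * h ^ 3 := by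
  have := (integral_cells (x₀ := x₀) hh (G := fun y x => |slopeError d h y x|)
    (fun y => (hd.jet.continuous_slopeError h y).abs) n).2
  simp only [gridSlopeError]
  rw [this]
  calc _ ≤ ∑ i ∈ Finset.range n, h ^ 3 * cellNorm (d 2) (x₀ + i * h) h :=
        Finset.sum_le_sum fun i _ => hd.integral_abs_slopeError_le hh
    _ ≤ h ^ 3 * B := by
        rw [← Finset.mul_sum]
        gcongr
        exact hd.sum_cellNorm_le hh.le (by norm_num) (by norm_num) _ _
    _ = _ := by ring

theorem integral_abs_gridPotentialError_le (hd : BoundedJet d B) (hh : 0 < h) (hh1 : h ≤ 1)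
    (n : ℕ) : ∫ x in x₀..(x₀ + n * h), |gridPotentialError d x₀ h x| ≤ 4 * B ^ 2 * h := by
  have := (integral_cells (x₀ := x₀) hh (G := fun y x => |potentialError d h y x|)
    (fun y => (hd.jet.continuous_potentialError h y).abs) n).2
  have hB := hd.one_le
  simp only [gridPotentialError]
  rw [this]
  calc _ ≤ ∑ i ∈ Finset.range n, h * (2 * B * cellNorm (d 1) (x₀ + i * h) h
          + 2 * B * cellNorm (d 2) (x₀ + i * h) h) :=
        Finset.sum_le_sum fun i _ => hd.integral_abs_potentialError_le hh hh1
    _ ≤ h * (2 * B * B + 2 * B * B) := by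
        rw [← Finset.mul_sum, Finset.sum_add_distrib, ← Finset.mul_sum, ← Finset.mul_sum]
        gcongr
        · exact hd.sum_cellNorm_le hh.le (by norm_num) (by norm_num) _ _
        · exact hd.sum_cellNorm_le hh.le (by norm_num) (by norm_num) _ _
    _ = _ := by ring

/-- The accumulated error at the grid points: all but the last explicit term are boundary terms. -/
theorem abs_accumulatedError_sub_le (hd : BoundedJet d B) (hh : 0 < h) (n : ℕ) :
    |accumulatedError d x₀ h (x₀ + n * h) -
      (h ^ 4 / 4320 * (d 3 (x₀ + n * h) - d 3 x₀) + h ^ 2 / 12 * (d 1 (x₀ + n * h) - d 1 x₀)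
        + h ^ 4 / 144 * ∫ x in x₀..(x₀ + n * h), d 1 x ^ 2)| ≤ 6 * B ^ 2 * h ^ 6 := by
  have hB := hd.one_le
  have hc1 := hd.jet.continuous 1
  have h1 := (integral_cells (x₀ := x₀) hh (hd.jet.continuous_potentialError h) n).2
  have hstep : ∀ i : ℕ, x₀ + ((i + 1 : ℕ) : ℝ) * h = x₀ + i * h + h := fun i => by push_cast; ring
  have htel : ∀ f : ℝ → ℝ, ∑ i ∈ Finset.range n, (f (x₀ + i * h + h) - f (x₀ + i * h)) =
      f (x₀ + n * h) - f x₀ := by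
    intro f
    have := Finset.sum_range_sub (fun i : ℕ => f (x₀ + i * h)) n
    simpa only [hstep, Nat.cast_zero, zero_mul, add_zero] using this
  have hsq : ∫ x in x₀..(x₀ + n * h), d 1 x ^ 2 =
      ∑ i ∈ Finset.range n, ∫ x in (x₀ + i * h)..(x₀ + i * h + h), d 1 x ^ 2 := by
    have := intervalIntegral.sum_integral_adjacent_intervals (f := fun x => d 1 x ^ 2)
      (a := fun i : ℕ => x₀ + i * h) (n := n) (μ := volume)
      fun k _ => (hc1.pow 2).intervalIntegrable _ _
    simpa only [hstep, Nat.cast_zero, zero_mul, add_zero] using this.symm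
  simp only [accumulatedError, gridPotentialError]
  rw [h1, ← htel (d 3), ← htel (d 1), hsq, Finset.mul_sum, Finset.mul_sum, Finset.mul_sum,
    ← Finset.sum_add_distrib, ← Finset.sum_add_distrib, ← Finset.sum_sub_distrib]
  refine (Finset.abs_sum_le_sum_abs _ _).trans ?_
  refine (Finset.sum_le_sum fun i _ => hd.abs_integral_potentialError_sub_le hh).trans ?_
  rw [← Finset.mul_sum, Finset.sum_add_distrib, Finset.sum_add_distrib, ← Finset.mul_sum,
    ← Finset.mul_sum, ← Finset.mul_sum]
  have s6 := hd.sum_cellNorm_le hh.le (p := 6) (by norm_num) (by norm_num) x₀ n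
  have s2 := hd.sum_cellNorm_le hh.le (p := 2) (by norm_num) (by norm_num) x₀ n
  have s3 := hd.sum_cellNorm_le hh.le (p := 3) (by norm_num) (by norm_num) x₀ n
  calc _ ≤ h ^ 6 * (4 * B + B * B + B * B) := by gcongr
    _ ≤ h ^ 6 * (6 * B ^ 2) := by gcongr; nlinarith
    _ = _ := by ring

theorem integral_sq_le (hd : BoundedJet d B) {a b : ℝ} (hab : a ≤ b) :
    ∫ x in a..b, d 1 x ^ 2 ≤ B ^ 2 := by
  have hB := hd.one_le
  have hc1 := hd.jet.continuous 1
  calc _ ≤ ∫ x in a..b, B * |d 1 x| :=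
        intervalIntegral.integral_mono_on hab ((hc1.pow 2).intervalIntegrable _ _)
          ((continuous_const.mul hc1.abs).intervalIntegrable _ _) fun x _ => by
            have := hd.bound 1 (by norm_num) x
            change d 1 x ^ 2 ≤ B * |d 1 x|
            rw [← sq_abs, sq]
            gcongr
    _ = B * ∫ x in a..b, |d 1 x| := intervalIntegral.integral_const_mul _ _
    _ ≤ B * B := by gcongr; exact hd.integral_bound 1 le_rfl (by norm_num) _ _ hab
    _ = _ := by ring

theorem abs_accumulatedError_grid_le (hd : BoundedJet d B) (hh : 0 < h) (hh1 : h ≤ 1) (n : ℕ) :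
    |accumulatedError d x₀ h (x₀ + n * h)| ≤ 8 * B ^ 2 * h ^ 2 := by
  have hB := hd.one_le
  have h1 := hd.abs_accumulatedError_sub_le hh n (x₀ := x₀)
  have hle : x₀ ≤ x₀ + n * h := by
    have : 0 ≤ (n : ℝ) * h := by positivity
    linarith
  have b1 := abs_le.1 (hd.bound 1 (by norm_num) x₀)
  have b2 := abs_le.1 (hd.bound 1 (by norm_num) (x₀ + n * h))
  have b3 := abs_le.1 (hd.bound 3 (by norm_num) x₀)
  have b4 := abs_le.1 (hd.bound 3 (by norm_num) (x₀ + n * h))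
  have b5 := hd.integral_sq_le hle
  have b6 : 0 ≤ ∫ x in x₀..(x₀ + n * h), d 1 x ^ 2 :=
    intervalIntegral.integral_nonneg hle fun _ _ => sq_nonneg _
  set I := ∫ x in x₀..(x₀ + n * h), d 1 x ^ 2
  have hBB : B ≤ B ^ 2 := by nlinarith
  have t1 : |h ^ 4 / 4320 * (d 3 (x₀ + n * h) - d 3 x₀)| ≤ h ^ 4 / 4320 * (2 * B) := by
    rw [abs_mul, abs_of_nonneg (by positivity)]
    gcongr
    exact abs_le.2 ⟨by linarith, by linarith⟩
  have t2 : |h ^ 2 / 12 * (d 1 (x₀ + n * h) - d 1 x₀)| ≤ h ^ 2 / 12 * (2 * B) := by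
    rw [abs_mul, abs_of_nonneg (by positivity)]
    gcongr
    exact abs_le.2 ⟨by linarith, by linarith⟩
  have t3 : |h ^ 4 / 144 * I| ≤ h ^ 4 / 144 * B ^ 2 := by
    rw [abs_mul, abs_of_nonneg (by positivity), abs_of_nonneg b6]
    gcongr
  have h42 : h ^ 4 * B ^ 2 ≤ h ^ 2 * B ^ 2 := by
    gcongr ?_ * _
    exact pow_le_pow_of_le_one hh.le hh1 (by norm_num)
  have h62 : h ^ 6 * B ^ 2 ≤ h ^ 2 * B ^ 2 := by
    gcongr ?_ * _
    exact pow_le_pow_of_le_one hh.le hh1 (by norm_num)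
  have h4B : h ^ 4 * B ≤ h ^ 4 * B ^ 2 := by gcongr
  have h2B : h ^ 2 * B ≤ h ^ 2 * B ^ 2 := by gcongr
  rw [abs_le] at h1 t1 t2 t3 ⊢
  have hp : 0 ≤ h ^ 2 * B ^ 2 := by positivity
  constructor <;> linarith [h1.1, h1.2, t1.1, t1.2, t2.1, t2.2, t3.1, t3.2]

theorem abs_accumulatedError_le (hd : BoundedJet d B) (hh : 0 < h) (hh1 : h ≤ 1) (n : ℕ) {x : ℝ}
    (hx : x ∈ Set.Icc x₀ (x₀ + n * h)) :
    |accumulatedError d x₀ h x| ≤ 12 * B ^ 2 * h ^ 2 := by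
  have hcell := mem_cell hh hx.1
  set i := cellIndex x₀ h x with hi
  have hstart : cellStart x₀ h x = x₀ + i * h := rfl
  rw [hstart] at hcell
  have hle : x₀ ≤ x₀ + i * h := by
    have : 0 ≤ (i : ℝ) * h := by positivity
    linarith
  have hint := hd.intervalIntegrable_gridPotentialError hh n (x₀ := x₀)
  have i1 : IntervalIntegrable (gridPotentialError d x₀ h) volume x₀ (x₀ + i * h) :=
    hd.intervalIntegrable_gridPotentialError hh i
  have i2 : IntervalIntegrable (gridPotentialError d x₀ h) volume (x₀ + i * h) x := by
    refine hint.mono_set ?_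
    rw [Set.uIcc_of_le hcell.1, Set.uIcc_of_le (hx.1.trans hx.2)]
    exact Set.Icc_subset_Icc hle hx.2
  have hsplit : accumulatedError d x₀ h x = accumulatedError d x₀ h (x₀ + i * h) +
      ∫ t in (x₀ + i * h)..x, gridPotentialError d x₀ h t :=
    (intervalIntegral.integral_add_adjacent_intervals i1 i2).symm
  have h1 := hd.abs_accumulatedError_grid_le hh hh1 i (x₀ := x₀)
  have h2 := intervalIntegral.norm_integral_le_of_norm_le_const (a := x₀ + i * h) (b := x)
    (f := gridPotentialError d x₀ h) (C := 4 * B ^ 2 * h) fun t ht => by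
      rw [Set.uIoc_of_le hcell.1] at ht
      exact hd.abs_gridPotentialError_le hh hh1 (hle.trans ht.1.le)
  rw [Real.norm_eq_abs, abs_of_nonneg (by linarith [hcell.1] : 0 ≤ x - (x₀ + i * h))] at h2
  have h3 : 4 * B ^ 2 * h * (x - (x₀ + i * h)) ≤ 4 * B ^ 2 * h * h := by
    gcongr
    linarith [hcell.2]
  rw [hsplit]
  refine (abs_add_le _ _).trans ?_
  nlinarith

theorem continuousOn_accumulatedError (hd : BoundedJet d B) (hh : 0 < h) (n : ℕ) :
    ContinuousOn (accumulatedError d x₀ h) (Set.Icc x₀ (x₀ + n * h)) := by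
  have hle : x₀ ≤ x₀ + n * h := by
    have : 0 ≤ (n : ℝ) * h := by positivity
    linarith
  have hint := hd.intervalIntegrable_gridPotentialError hh n (x₀ := x₀)
  have := intervalIntegral.continuousOn_primitive_interval (a := x₀) (b := x₀ + n * h)
    (μ := volume) (f := gridPotentialError d x₀ h)
    (by rw [Set.uIcc_of_le hle]
        exact (intervalIntegrable_iff_integrableOn_Icc_of_le hle).1 hint)
  rwa [Set.uIcc_of_le hle] at this

theorem hasDerivWithinAt_accumulatedError (hd : BoundedJet d B) (hh : 0 < h) (n : ℕ) {x : ℝ}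
    (hx : x ∈ Set.Ico x₀ (x₀ + n * h)) :
    HasDerivWithinAt (accumulatedError d x₀ h) (gridPotentialError d x₀ h x) (Set.Ici x) x := by
  have hint := hd.intervalIntegrable_gridPotentialError hh n (x₀ := x₀)
  refine intervalIntegral.integral_hasDerivWithinAt_right (t := Set.Ioi x) ?_ ?_ ?_
  · refine hint.mono_set ?_
    rw [Set.uIcc_of_le hx.1, Set.uIcc_of_le (hx.1.trans hx.2.le)]
    exact Set.Icc_subset_Icc_right hx.2.le
  · refine ⟨Set.Ioc x (x₀ + n * h), Ioc_mem_nhdsGT hx.2, ?_⟩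
    exact hint.1.aestronglyMeasurable.mono_set (Set.Ioc_subset_Ioc_left hx.1)
  · have hcont : ContinuousWithinAt (potentialError d h (cellStart x₀ h x)) (Set.Ioi x) x :=
      (hd.jet.continuous_potentialError h _).continuousWithinAt
    refine hcont.congr_of_eventuallyEq ?_ rfl
    have := (cellIndex_eventuallyEq hh hx.1).filter_mono (nhdsWithin_mono x Set.Ioi_subset_Ici_self)
    filter_upwards [this] with t ht
    simp only [gridPotentialError, cellStart, ht]

end BoundedJet

/-! ### The Magnus flow -/

section
open scoped Matrix.Norms.Operator

theorem hasDerivAt_exp_smul_mulVec (M : Matrix (Fin 2) (Fin 2) ℂ) (v : Fin 2 → ℂ) (t : ℝ) :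
    HasDerivAt (fun t : ℝ => (NormedSpace.exp (t • M)).mulVec v)
      (M.mulVec ((NormedSpace.exp (t • M)).mulVec v)) t := by
  let l : Matrix (Fin 2) (Fin 2) ℂ →ₗ[ℝ] (Fin 2 → ℂ) :=
    { toFun := fun M => M.mulVec v
      map_add' := fun M N => Matrix.add_mulVec M N v
      map_smul' := fun r M => Matrix.smul_mulVec r M v }
  have h1 := hasDerivAt_exp_smul_const' (𝕂 := ℝ) M t
  have h2 := (LinearMap.toContinuousLinearMap l).hasFDerivAt.comp_hasDerivAt t h1
  refine h2.congr_deriv ?_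
  change (M * NormedSpace.exp (t • M)).mulVec v = _
  rw [Matrix.mulVec_mulVec]

end

/-- Liouville's formula for the wedge product of two vectors of `ℂ²`. -/
theorem wedge_exp_mulVec (M : Matrix (Fin 2) (Fin 2) ℂ) (v w : Fin 2 → ℂ) :
    wedge ((NormedSpace.exp M).mulVec v) ((NormedSpace.exp M).mulVec w) =
      Complex.exp (M 0 0 + M 1 1) * wedge v w := by
  set f : ℝ → ℂ := fun t => Complex.exp (-(M 0 0 + M 1 1) * t) *
    wedge ((NormedSpace.exp (t • M)).mulVec v) ((NormedSpace.exp (t • M)).mulVec w) with hf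
  have hd : ∀ t, HasDerivAt f 0 t := by
    intro t
    have h1 : HasDerivAt (fun t : ℝ => Complex.exp (-(M 0 0 + M 1 1) * t))
        (Complex.exp (-(M 0 0 + M 1 1) * t) * (-(M 0 0 + M 1 1) * 1)) t :=
      ((hasDerivAt_id t).ofReal_comp.const_mul _).cexp
    have hv := hasDerivAt_pi.1 (hasDerivAt_exp_smul_mulVec M v t)
    have hw := hasDerivAt_pi.1 (hasDerivAt_exp_smul_mulVec M w t)
    have h2 := h1.mul (((hv 0).mul (hw 1)).sub ((hw 0).mul (hv 1)))
    simp only [hf, wedge, Matrix.det_fin_two_of]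
    refine h2.congr_deriv ?_
    simp only [Pi.sub_apply, Pi.mul_apply, Matrix.mulVec, dotProduct, Fin.sum_univ_two]
    ring
  have hconst := is_const_of_deriv_eq_zero (fun t => (hd t).differentiableAt)
    (fun t => (hd t).deriv) 1 0
  simp only [hf, one_smul, zero_smul, NormedSpace.exp_zero, Matrix.one_mulVec, Complex.ofReal_one,
    Complex.ofReal_zero, mul_one, mul_zero, Complex.exp_zero, one_mul] at hconst
  rw [← hconst, ← mul_assoc, ← Complex.exp_add]
  simp

/-- The generator of the numerical flow on the step from `y`: the Magnus exponent divided by the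
step length. -/
noncomputable def stepGenerator (c : ℝ) (φ : ℝ → ℝ) (lam : ℂ) (h y : ℝ) :
    Matrix (Fin 2) (Fin 2) ℂ :=
  !![(gaussSlope φ h y : ℂ), 1;
    lam - gaussMean φ h y - c * gaussSlope φ h y, -(c : ℂ) - gaussSlope φ h y]

theorem magnusExponent_coeffMatrix (c : ℝ) (φ : ℝ → ℝ) (lam : ℂ) (y h : ℝ) :
    magnusExponent (coeffMatrix c φ lam) y h = h • stepGenerator c φ lam h y := by
  ext i j
  fin_cases i <;> fin_cases j <;>
  · simp [magnusExponent, coeffMatrix, stepGenerator, gaussMean, gaussSlope]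
    ring

theorem exp_mulVec_exp_neg_mulVec (M : Matrix (Fin 2) (Fin 2) ℂ) (v : Fin 2 → ℂ) :
    (NormedSpace.exp M).mulVec ((NormedSpace.exp (-M)).mulVec v) = v := by
  have hu : IsUnit (NormedSpace.exp M).det :=
    (Matrix.isUnit_iff_isUnit_det _).1 (Matrix.isUnit_exp M)
  rw [Matrix.mulVec_mulVec, Matrix.exp_neg, Matrix.mul_nonsing_inv _ hu, Matrix.one_mulVec]

/-- The Gauss–Legendre Magnus step is symmetric: the step back inverts the step forth. -/
theorem magnusExponent_symm (A : ℝ → Matrix (Fin 2) (Fin 2) ℂ) (y h : ℝ) :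
    magnusExponent A (y + h) (-h) = -magnusExponent A y h := by
  have h1 : gaussPoint₁ (y + h) (-h) = gaussPoint₂ y h := by
    simp only [gaussPoint₁, gaussPoint₂]; ring
  have h2 : gaussPoint₂ (y + h) (-h) = gaussPoint₁ y h := by
    simp only [gaussPoint₁, gaussPoint₂]; ring
  simp only [magnusExponent, h1, h2]
  rw [neg_sq, neg_div, Complex.ofReal_neg, neg_smul, add_comm (A (gaussPoint₂ y h))]
  module

section
variable {c : ℝ} {φ : ℝ → ℝ} {lam : ℂ} {h : ℝ}

/-- Integrating the right solution back to `0` or the left one on to `N h` gives the same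
determinant, up to the factor of Liouville's formula. -/
theorem wedge_magnusIterate (N : ℕ) (yl yr : Fin 2 → ℂ) :
    wedge (magnusIterate (coeffMatrix c φ lam) (-(N * h)) h yl N)
      (magnusIterate (coeffMatrix c φ lam) (N * h) (-h) yr N) =
    Complex.exp (c * (N * h : ℝ)) *
      wedge (magnusIterate (coeffMatrix c φ lam) (-(N * h)) h yl (N + N)) yr := by
  set A := coeffMatrix c φ lam with hA
  have key : ∀ j ≤ N, wedge (magnusIterate A (-(N * h)) h yl N)
      (magnusIterate A (N * h) (-h) yr N) = Complex.exp (c * (j * h : ℝ)) *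
        wedge (magnusIterate A (-(N * h)) h yl (N + j)) (magnusIterate A (N * h) (-h) yr (N - j)) := by
    intro j
    induction j with
    | zero => simp
    | succ j ih =>
      intro hj
      rw [ih (by omega)]
      obtain ⟨k, hk⟩ : ∃ k, N = j + 1 + k := ⟨N - (j + 1), by omega⟩
      have e1 : N - j = k + 1 := by omega
      have e2 : N - (j + 1) = k := by omega
      have hNk : (N : ℝ) = j + 1 + k := by rw [hk]; push_cast; ring
      have hback : magnusIterate A (N * h) (-h) yr k =
          (NormedSpace.exp (magnusExponent A (j * h) h)).mulVec
            (magnusIterate A (N * h) (-h) yr (k + 1)) := by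
        have e3 : (N : ℝ) * h + k * -h = j * h + h := by rw [hNk]; ring
        rw [magnusIterate, e3, magnusExponent_symm, exp_mulVec_exp_neg_mulVec]
      have hforth : magnusIterate A (-(N * h)) h yl (N + (j + 1)) =
          (NormedSpace.exp (magnusExponent A (j * h) h)).mulVec
            (magnusIterate A (-(N * h)) h yl (N + j)) := by
        have e3 : -((N : ℝ) * h) + ((N + j : ℕ) : ℝ) * h = j * h := by push_cast; ring
        rw [← add_assoc, magnusIterate, e3]
      rw [e1, e2, hback, hforth, wedge_exp_mulVec, ← mul_assoc, ← Complex.exp_add]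
      congr 2
      rw [magnusExponent_coeffMatrix]
      simp [stepGenerator]
      ring
  have := key N le_rfl
  rw [Nat.sub_self] at this
  exact this

/-- A continuous curve through the numerical values: on each cell, the flow of the step
generator. -/
noncomputable def magnusCurve (c : ℝ) (φ : ℝ → ℝ) (lam : ℂ) (x₀ h : ℝ) (y₀ : Fin 2 → ℂ) (x : ℝ) :
    Fin 2 → ℂ :=
  (NormedSpace.exp ((x - cellStart x₀ h x) • stepGenerator c φ lam h (cellStart x₀ h x))).mulVec
    (magnusIterate (coeffMatrix c φ lam) x₀ h y₀ (cellIndex x₀ h x))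

variable {x₀ : ℝ} {y₀ : Fin 2 → ℂ}

theorem magnusCurve_node (hh : 0 < h) (n : ℕ) :
    magnusCurve c φ lam x₀ h y₀ (x₀ + n * h) = magnusIterate (coeffMatrix c φ lam) x₀ h y₀ n := by
  have : cellIndex x₀ h (x₀ + n * h) = n := cellIndex_eq hh ⟨le_rfl, by linarith⟩
  simp [magnusCurve, cellStart, this]

theorem magnusCurve_start (hh : 0 < h) : magnusCurve c φ lam x₀ h y₀ x₀ = y₀ := by
  have := magnusCurve_node (c := c) (φ := φ) (lam := lam) (x₀ := x₀) (y₀ := y₀) hh 0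
  rwa [Nat.cast_zero, zero_mul, add_zero] at this

theorem continuousOn_magnusCurve (hh : 0 < h) (n : ℕ) :
    ContinuousOn (magnusCurve c φ lam x₀ h y₀) (Set.Icc x₀ (x₀ + n * h)) := by
  induction n with
  | zero => simp
  | succ n ih =>
    have e : x₀ + ((n + 1 : ℕ) : ℝ) * h = x₀ + n * h + h := by push_cast; ring
    have hn : 0 ≤ (n : ℝ) * h := by positivity
    set y := x₀ + n * h with hy
    have hcell : ContinuousOn (magnusCurve c φ lam x₀ h y₀) (Set.Icc y (y + h)) := by
      have hg : Continuous fun x : ℝ => (NormedSpace.exp ((x - y) • stepGenerator c φ lam h y)).mulVec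
          (magnusIterate (coeffMatrix c φ lam) x₀ h y₀ n) :=
        (continuous_iff_continuousAt.2 fun t =>
          (hasDerivAt_exp_smul_mulVec (stepGenerator c φ lam h y) _ t).continuousAt).comp
          (continuous_id.sub continuous_const)
      refine hg.continuousOn.congr fun x hx => ?_
      rcases hx.2.lt_or_eq with hlt | heq
      · have : cellIndex x₀ h x = n := cellIndex_eq hh ⟨hx.1, hlt⟩
        simp [magnusCurve, cellStart, this, hy]
      · have h1 := magnusCurve_node (c := c) (φ := φ) (lam := lam) (x₀ := x₀) (y₀ := y₀) hh (n + 1)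
        rw [e, ← heq] at h1
        rw [h1, magnusIterate, magnusExponent_coeffMatrix, ← hy, heq]
        simp
    rw [e, ← Set.Icc_union_Icc_eq_Icc (by linarith : x₀ ≤ y) (by linarith : y ≤ y + h)]
    exact ih.union_of_isClosed hcell isClosed_Icc isClosed_Icc

theorem hasDerivWithinAt_magnusCurve (hh : 0 < h) {x : ℝ} (hx : x₀ ≤ x) :
    HasDerivWithinAt (magnusCurve c φ lam x₀ h y₀)
      ((stepGenerator c φ lam h (cellStart x₀ h x)).mulVec (magnusCurve c φ lam x₀ h y₀ x))
      (Set.Ici x) x := by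
  set y := cellStart x₀ h x with hy
  have h1 : HasDerivAt (fun t : ℝ => (NormedSpace.exp ((t - y) • stepGenerator c φ lam h y)).mulVec
      (magnusIterate (coeffMatrix c φ lam) x₀ h y₀ (cellIndex x₀ h x)))
      ((1 : ℝ) • (stepGenerator c φ lam h y).mulVec (magnusCurve c φ lam x₀ h y₀ x)) x :=
    HasDerivAt.scomp (h := fun t : ℝ => t - y) x
      (hasDerivAt_exp_smul_mulVec (stepGenerator c φ lam h y)
        (magnusIterate (coeffMatrix c φ lam) x₀ h y₀ (cellIndex x₀ h x)) (x - y))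
      ((hasDerivAt_id x).sub_const y)
  rw [one_smul] at h1
  refine h1.hasDerivWithinAt.congr_of_eventuallyEq ?_ rfl
  filter_upwards [cellIndex_eventuallyEq hh hx] with t ht
  simp only [magnusCurve, cellStart, ht, hy]

end

/-! ### Coordinates relative to two exact solutions -/

section
variable {φ : ℝ → ℝ} {Λ : ℂ} {w v wp vp ζ₁ ζ₂ : ℝ → ℂ} {χ ε X : ℝ → ℝ} {x₀ x₁ r C : ℝ}

/-- The coordinate of `(ζ₁, ζ₂)` along the growing solution `(w, v)`. -/
noncomputable def growingCoord (w v wp vp ζ₁ ζ₂ : ℝ → ℂ) (x : ℝ) : ℂ :=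
  (ζ₁ x * (vp x / wp x) - ζ₂ x) * (vp x / wp x - v x / w x)⁻¹ * (w x)⁻¹

/-- The coordinate of `(ζ₁, ζ₂)` along the decaying solution `(wp, vp)`, multiplied by `wp / w`. -/
noncomputable def decayingCoord (w v wp vp ζ₁ ζ₂ : ℝ → ℂ) (x : ℝ) : ℂ :=
  (ζ₂ x - ζ₁ x * (v x / w x)) * (vp x / wp x - v x / w x)⁻¹ * (w x)⁻¹

theorem ExactPair.sub_ne_zero (hE : ExactPair w v wp vp r C) (hr : 0 < r) (x : ℝ) :
    vp x / wp x - v x / w x ≠ 0 := by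
  intro h
  have h1 := hE.gap x
  rw [← neg_sub, h] at h1
  simp at h1
  linarith

/-- Variation of constants for `(ζ₁, ζ₂)` relative to the two exact solutions. -/
theorem ExactPair.perturbedFrame (hE : ExactPair w v wp vp r C) (hr : 0 < r)
    (hw : ScalarSolution φ Λ w v) (hp : ScalarSolution φ Λ wp vp)
    (hc₁ : ContinuousOn ζ₁ (Set.Icc x₀ x₁)) (hc₂ : ContinuousOn ζ₂ (Set.Icc x₀ x₁))
    (hcX : ContinuousOn X (Set.Icc x₀ x₁))
    (h₁ : ∀ x ∈ Set.Ico x₀ x₁, HasDerivWithinAt ζ₁ (ε x * ζ₁ x + ζ₂ x) (Set.Ici x) x)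
    (h₂ : ∀ x ∈ Set.Ico x₀ x₁,
      HasDerivWithinAt ζ₂ ((Λ - φ x + χ x) * ζ₁ x - ε x * ζ₂ x) (Set.Ici x) x)
    (hX : ∀ x ∈ Set.Ico x₀ x₁, HasDerivWithinAt X (χ x) (Set.Ici x) x) :
    PerturbedFrame (growingCoord w v wp vp ζ₁ ζ₂) (decayingCoord w v wp vp ζ₁ ζ₂)
      (fun x => v x / w x) (fun x => vp x / wp x) χ ε X x₀ x₁ := by
  have hm := hw.hasDerivAt_div hE.ne_zero
  have hq := hp.hasDerivAt_div hE.ne_zero'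
  have hg := hE.sub_ne_zero hr
  have hcm : Continuous fun x => v x / w x := continuous_iff_continuousAt.2 fun x =>
    (hm x).continuousAt
  have hcq : Continuous fun x => vp x / wp x := continuous_iff_continuousAt.2 fun x =>
    (hq x).continuousAt
  have hcw : Continuous w := continuous_iff_continuousAt.2 fun x => (hw.hasDerivAt x).continuousAt
  have hcW : Continuous fun x => (w x)⁻¹ := hcw.inv₀ hE.ne_zero
  have hcj : Continuous fun x => (vp x / wp x - v x / w x)⁻¹ := (hcq.sub hcm).inv₀ hg
  have hW : ∀ x, HasDerivAt (fun x => (w x)⁻¹) (-(v x / w x) * (w x)⁻¹) x := fun x => by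
    refine ((hw.hasDerivAt x).inv (hE.ne_zero x)).congr_deriv ?_
    have := hE.ne_zero x
    field_simp
  have hj : ∀ x, HasDerivAt (fun x => (vp x / wp x - v x / w x)⁻¹)
      ((vp x / wp x - v x / w x)⁻¹ * (v x / w x + vp x / wp x)) x := fun x => by
    refine (((hq x).sub (hm x)).inv (hg x)).congr_deriv ?_
    have := hg x
    simp only [Pi.sub_apply]
    generalize vp x / wp x = p at *
    generalize v x / w x = m at *
    field_simp
    ring
  refine ⟨?_, ?_, hcX, hcm, hcq, fun x hx => ?_, fun x hx => ?_, hX, hj⟩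
  · exact (((hc₁.mul hcq.continuousOn).sub hc₂).mul hcj.continuousOn).mul hcW.continuousOn
  · exact ((hc₂.sub (hc₁.mul hcm.continuousOn)).mul hcj.continuousOn).mul hcW.continuousOn
  · have hd := ((((h₁ x hx).mul (hq x).hasDerivWithinAt).sub (h₂ x hx)).mul
      (hj x).hasDerivWithinAt).mul (hW x).hasDerivWithinAt
    refine hd.congr_deriv ?_
    have h1 : (vp x / wp x - v x / w x)⁻¹ * (vp x / wp x - v x / w x) = 1 := inv_mul_cancel₀ (hg x)
    simp only [growingCoord, decayingCoord, Pi.mul_apply, Pi.sub_apply]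
    generalize (vp x / wp x - v x / w x)⁻¹ = j at *
    generalize vp x / wp x = p at *
    generalize v x / w x = m at *
    linear_combination (-j * (w x)⁻¹ * (ε x * (ζ₁ x * p + ζ₂ x) - χ x * ζ₁ x)) * h1
  · have hd := (((h₂ x hx).sub ((h₁ x hx).mul (hm x).hasDerivWithinAt)).mul
      (hj x).hasDerivWithinAt).mul (hW x).hasDerivWithinAt
    refine hd.congr_deriv ?_
    have h1 : (vp x / wp x - v x / w x)⁻¹ * (vp x / wp x - v x / w x) = 1 := inv_mul_cancel₀ (hg x)
    simp only [growingCoord, decayingCoord, Pi.mul_apply, Pi.sub_apply]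
    generalize (vp x / wp x - v x / w x)⁻¹ = j at *
    generalize vp x / wp x = p at *
    generalize v x / w x = m at *
    linear_combination (-j * (w x)⁻¹ * (χ x * ζ₁ x - ε x * (ζ₂ x + ζ₁ x * m))) * h1

/-- At a point where `(ζ₁, ζ₂) = (w, v + β w)` the coordinates are `1 - β j` and `β j`. -/
theorem ExactPair.coord_start (hE : ExactPair w v wp vp r C) (hr : 0 < r) {x : ℝ} {β : ℂ}
    (h₁ : ζ₁ x = w x) (h₂ : ζ₂ x = v x + β * w x) :
    growingCoord w v wp vp ζ₁ ζ₂ x = 1 - β * (vp x / wp x - v x / w x)⁻¹ ∧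
      decayingCoord w v wp vp ζ₁ ζ₂ x = β * (vp x / wp x - v x / w x)⁻¹ := by
  have h0 := hE.ne_zero x
  have hv : v x = v x / w x * w x := by field_simp
  have h1 : (vp x / wp x - v x / w x)⁻¹ * (vp x / wp x - v x / w x) = 1 :=
    inv_mul_cancel₀ (hE.sub_ne_zero hr x)
  have h2 : w x * (w x)⁻¹ = 1 := mul_inv_cancel₀ h0
  simp only [growingCoord, decayingCoord, h₁, h₂]
  generalize (vp x / wp x - v x / w x)⁻¹ = j at *
  generalize vp x / wp x = p at *
  generalize v x / w x = m at *
  constructor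
  · linear_combination h1 + (p - m - β) * j * h2 - j * (w x)⁻¹ * hv
  · linear_combination β * j * h2 + j * (w x)⁻¹ * hv

/-- The Wronskian of `(ζ₁, ζ₂ - β ζ₁)` with the decaying solution, in terms of the coordinates and
of the Wronskian `D` of the exact solutions. -/
theorem ExactPair.wedge_eq (hE : ExactPair w v wp vp r C) (hr : 0 < r) {x : ℝ} {β D : ℂ}
    (hD : w x * vp x - v x * wp x = D) :
    w x * wp x = D * (vp x / wp x - v x / w x)⁻¹ ∧
    ζ₁ x * vp x - (ζ₂ x - β * ζ₁ x) * wp x - D =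
      D * (growingCoord w v wp vp ζ₁ ζ₂ x - 1)
      + β * (growingCoord w v wp vp ζ₁ ζ₂ x + decayingCoord w v wp vp ζ₁ ζ₂ x)
        * (D * (vp x / wp x - v x / w x)⁻¹) := by
  have h0 := hE.ne_zero x
  have h0' := hE.ne_zero' x
  have hv : v x = v x / w x * w x := by field_simp
  have hvp : vp x = vp x / wp x * wp x := by field_simp
  have h1 : (vp x / wp x - v x / w x)⁻¹ * (vp x / wp x - v x / w x) = 1 :=
    inv_mul_cancel₀ (hE.sub_ne_zero hr x)
  have h2 : w x * (w x)⁻¹ = 1 := mul_inv_cancel₀ h0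
  have hg : w x * wp x = D * (vp x / wp x - v x / w x)⁻¹ := by
    rw [← hD, eq_mul_inv_iff_mul_eq₀ (hE.sub_ne_zero hr x)]
    field_simp
  refine ⟨hg, ?_⟩
  have hDg : w x * wp x * (vp x / wp x - v x / w x) = D := by
    rw [hg, mul_assoc, h1, mul_one]
  rw [← hg, ← hDg]
  nth_rewrite 1 [hvp]
  simp only [growingCoord, decayingCoord]
  generalize (vp x / wp x - v x / w x)⁻¹ = j at *
  generalize vp x / wp x = p at *
  generalize v x / w x = m at *
  generalize (w x)⁻¹ = W at *
  linear_combination (-(wp x * w x * W * (ζ₁ x * p - ζ₂ x + β * ζ₁ x))) * h1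
    - wp x * (ζ₁ x * p - ζ₂ x + β * ζ₁ x) * h2

end

/-! ### The numerical flow as a perturbed Schrödinger flow -/

section
variable {c : ℝ} {φ : ℝ → ℝ} {lam : ℂ} {y : ℝ → Fin 2 → ℂ}

theorem hasDerivAt_exp_half (c x : ℝ) :
    HasDerivAt (fun x : ℝ => Complex.exp (c / 2 * x)) (c / 2 * Complex.exp (c / 2 * x)) x := by
  have h : HasDerivAt (fun x : ℝ => ((c / 2 : ℂ)) * (x : ℂ)) ((c / 2 : ℂ) * 1) x :=
    (hasDerivAt_id x).ofReal_comp.const_mul _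
  exact h.cexp.congr_deriv (by ring)

/-- The factor `e^{c x / 2}` removes the first-order term of the eigenvalue equation. -/
theorem IsSolution.scalarSolution (hy : IsSolution (coeffMatrix c φ lam) y) :
    ScalarSolution φ (lam + c ^ 2 / 4) (fun x => Complex.exp (c / 2 * x) * y x 0)
      (fun x => Complex.exp (c / 2 * x) * (y x 1 + c / 2 * y x 0)) := by
  have h := fun x => hasDerivAt_pi.1 (hy x)
  refine ⟨fun x => ?_, fun x => ?_⟩
  · refine ((hasDerivAt_exp_half c x).mul (h x 0)).congr_deriv ?_
    simp only [coeffMatrix, Matrix.mulVec, dotProduct, Fin.sum_univ_two]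
    simp
    ring
  · refine ((hasDerivAt_exp_half c x).mul ((h x 1).add ((h x 0).const_mul _))).congr_deriv ?_
    simp only [coeffMatrix, Matrix.mulVec, dotProduct, Fin.sum_univ_two, Pi.add_apply]
    simp
    ring

variable {d : ℕ → ℝ → ℝ} {x₀ h : ℝ} {y₀ : Fin 2 → ℂ}

/-- First component of the numerical curve after removal of the first-order term. -/
noncomputable def gaugedCurve₁ (c : ℝ) (d : ℕ → ℝ → ℝ) (lam : ℂ) (x₀ h : ℝ) (y₀ : Fin 2 → ℂ)
    (x : ℝ) : ℂ :=
  Complex.exp (c / 2 * x) * magnusCurve c (d 0) lam x₀ h y₀ x 0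

/-- Second component of the numerical curve after removal of the first-order term, in the gauge
shifted by the main part `h² φ' / 12` of the slope of the step. -/
noncomputable def gaugedCurve₂ (c : ℝ) (d : ℕ → ℝ → ℝ) (lam : ℂ) (x₀ h : ℝ) (y₀ : Fin 2 → ℂ)
    (x : ℝ) : ℂ :=
  Complex.exp (c / 2 * x) * (magnusCurve c (d 0) lam x₀ h y₀ x 1 +
    (c / 2 + ((h ^ 2 / 12 * d 1 x : ℝ) : ℂ)) * magnusCurve c (d 0) lam x₀ h y₀ x 0)

/-- The numerical flow is the exact flow `ζ₁' = ζ₂`, `ζ₂' = (Λ - φ) ζ₁` perturbed by a traceless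
matrix. -/
theorem hasDerivWithinAt_gaugedCurve (hd : IsJet d) (hh : 0 < h) {x : ℝ} (hx : x₀ ≤ x) :
    HasDerivWithinAt (gaugedCurve₁ c d lam x₀ h y₀)
      (gridSlopeError d x₀ h x * gaugedCurve₁ c d lam x₀ h y₀ x
        + gaugedCurve₂ c d lam x₀ h y₀ x) (Set.Ici x) x ∧
    HasDerivWithinAt (gaugedCurve₂ c d lam x₀ h y₀)
      ((lam + c ^ 2 / 4 - d 0 x + gridPotentialError d x₀ h x) * gaugedCurve₁ c d lam x₀ h y₀ x
        - gridSlopeError d x₀ h x * gaugedCurve₂ c d lam x₀ h y₀ x) (Set.Ici x) x := by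
  have hy := hasDerivWithinAt_pi.1
    (hasDerivWithinAt_magnusCurve (c := c) (φ := d 0) (lam := lam) (y₀ := y₀) hh hx)
  have he := (hasDerivAt_exp_half c x).hasDerivWithinAt (s := Set.Ici x)
  have hb : HasDerivWithinAt (fun x => (c / 2 + ((h ^ 2 / 12 * d 1 x : ℝ) : ℂ)))
      ((h ^ 2 / 12 * d 2 x : ℝ) : ℂ) (Set.Ici x) x :=
    (((hd 1 x).const_mul (h ^ 2 / 12)).ofReal_comp.const_add _).hasDerivWithinAt
  constructor
  · refine (he.mul (hy 0)).congr_deriv ?_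
    simp only [gaugedCurve₁, gaugedCurve₂, gridSlopeError, slopeError, stepGenerator,
      Matrix.mulVec, dotProduct, Fin.sum_univ_two]
    simp
    ring
  · refine (he.mul ((hy 1).add (hb.mul (hy 0)))).congr_deriv ?_
    simp only [gaugedCurve₁, gaugedCurve₂, gridSlopeError, gridPotentialError, potentialError,
      slopeError, stepGenerator, Matrix.mulVec, dotProduct, Fin.sum_univ_two, Pi.add_apply,
      Pi.mul_apply]
    simp
    ring

theorem continuousOn_gaugedCurve (hd : IsJet d) (hh : 0 < h) (n : ℕ) :
    ContinuousOn (gaugedCurve₁ c d lam x₀ h y₀) (Set.Icc x₀ (x₀ + n * h)) ∧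
    ContinuousOn (gaugedCurve₂ c d lam x₀ h y₀) (Set.Icc x₀ (x₀ + n * h)) := by
  have hy := continuousOn_pi.1
    (continuousOn_magnusCurve (c := c) (φ := d 0) (lam := lam) (x₀ := x₀) (y₀ := y₀) hh n)
  have he : Continuous fun x : ℝ => Complex.exp (c / 2 * x) :=
    continuous_iff_continuousAt.2 fun x => (hasDerivAt_exp_half c x).continuousAt
  have hb : Continuous fun x => (c / 2 + ((h ^ 2 / 12 * d 1 x : ℝ) : ℂ)) :=
    continuous_const.add (Complex.continuous_ofReal.comp (continuous_const.mul (hd.continuous 1)))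
  exact ⟨he.continuousOn.mul (hy 0),
    he.continuousOn.mul ((hy 1).add (hb.continuousOn.mul (hy 0)))⟩

end

/-! ### The error at a given spectral scale -/

section
variable {w v wp vp : ℝ → ℂ} {d : ℕ → ℝ → ℝ} {B x₀ h r C : ℝ}

theorem ExactPair.mono (hE : ExactPair w v wp vp r C) (hr : 0 < r) {C' : ℝ} (hC : C ≤ C') :
    ExactPair w v wp vp r C' :=
  ⟨hE.ne_zero, hE.ne_zero', hE.gap, fun x => (hE.norm_m x).trans (by gcongr),
    fun x => (hE.norm_p x).trans (by gcongr), fun x => (hE.norm_sum x).trans (by gcongr),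
    fun a b hab => (hE.int_sum a b hab).trans (by gcongr), hE.norm_D.trans (by gcongr),
    fun x => (hE.norm_g x).trans (by gcongr)⟩

theorem ExactPair.frameBounds (hE : ExactPair w v wp vp r C) (hd : BoundedJet d B)
    (hC : 20 * B ^ 2 ≤ C) (hh : 0 < h) (hh1 : h ≤ 1) (n : ℕ) :
    FrameBounds (fun x => v x / w x) (fun x => vp x / wp x) (gridPotentialError d x₀ h)
      (gridSlopeError d x₀ h) (accumulatedError d x₀ h) x₀ (x₀ + n * h) h r C := by
  have hB := hd.one_le
  have hBB : B ≤ B ^ 2 := by nlinarith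
  have h01 : x₀ ≤ x₀ + n * h := by
    have : 0 ≤ (n : ℝ) * h := by positivity
    linarith
  have hBC : B ≤ C := by linarith
  have hBC4 : 4 * B ^ 2 ≤ C := by linarith
  have hBC12 : 12 * B ^ 2 ≤ C := by linarith
  exact
  { gap := hE.gap
    norm_m := hE.norm_m
    norm_p := hE.norm_p
    norm_sum := hE.norm_sum
    int_sum := hE.int_sum _ _ h01
    abs_chi := fun x hx => (hd.abs_gridPotentialError_le hh hh1 hx.1).trans (by gcongr)
    abs_eps := fun x hx => (hd.abs_gridSlopeError_le hh hx.1).trans (by gcongr)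
    intervalIntegrable_chi := hd.intervalIntegrable_gridPotentialError hh n
    intervalIntegrable_eps := hd.intervalIntegrable_gridSlopeError hh n
    int_chi := (hd.integral_abs_gridPotentialError_le hh hh1 n).trans (by gcongr)
    int_eps := (hd.integral_abs_gridSlopeError_le hh n).trans (by gcongr)
    abs_X := fun x hx => (hd.abs_accumulatedError_le hh hh1 n hx).trans (by gcongr) }

/-- Once the derivatives of the potential are negligible at both ends of the interval, the
accumulated error is the leading error term. -/
theorem BoundedJet.abs_accumulatedError_sub_le_of_tails (hd : BoundedJet d B) (hh : 0 < h)
    (n : ℕ) {I : ℝ} (h10 : |d 1 x₀| ≤ h ^ 4) (h11 : |d 1 (x₀ + n * h)| ≤ h ^ 4)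
    (h30 : |d 3 x₀| ≤ h ^ 2) (h31 : |d 3 (x₀ + n * h)| ≤ h ^ 2)
    (hI : |(∫ x in x₀..(x₀ + n * h), d 1 x ^ 2) - I| ≤ h ^ 2) :
    |accumulatedError d x₀ h (x₀ + n * h) - h ^ 4 / 144 * I| ≤ 20 * B ^ 2 * h ^ 6 := by
  have hB := hd.one_le
  have hB2 : 1 ≤ B ^ 2 := one_le_pow₀ hB
  have key := hd.abs_accumulatedError_sub_le hh n (x₀ := x₀)
  set J := ∫ x in x₀..(x₀ + n * h), d 1 x ^ 2
  have e : accumulatedError d x₀ h (x₀ + n * h) - h ^ 4 / 144 * I =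
      (accumulatedError d x₀ h (x₀ + n * h) -
        (h ^ 4 / 4320 * (d 3 (x₀ + n * h) - d 3 x₀) + h ^ 2 / 12 * (d 1 (x₀ + n * h) - d 1 x₀)
        + h ^ 4 / 144 * J)) + (h ^ 4 / 4320 * (d 3 (x₀ + n * h) - d 3 x₀)
        + h ^ 2 / 12 * (d 1 (x₀ + n * h) - d 1 x₀) + h ^ 4 / 144 * (J - I)) := by ring
  have t1 : |h ^ 4 / 4320 * (d 3 (x₀ + n * h) - d 3 x₀)| ≤ h ^ 4 / 4320 * (h ^ 2 + h ^ 2) := by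
    rw [abs_mul, abs_of_nonneg (by positivity)]
    gcongr
    exact (abs_sub _ _).trans (add_le_add h31 h30)
  have t2 : |h ^ 2 / 12 * (d 1 (x₀ + n * h) - d 1 x₀)| ≤ h ^ 2 / 12 * (h ^ 4 + h ^ 4) := by
    rw [abs_mul, abs_of_nonneg (by positivity)]
    gcongr
    exact (abs_sub _ _).trans (add_le_add h11 h10)
  have t3 : |h ^ 4 / 144 * (J - I)| ≤ h ^ 4 / 144 * h ^ 2 := by
    rw [abs_mul, abs_of_nonneg (by positivity)]
    gcongr
  have h6 : h ^ 6 ≤ B ^ 2 * h ^ 6 := le_mul_of_one_le_left (by positivity) hB2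
  rw [e]
  refine (abs_add_le _ _).trans ((add_le_add key (abs_add_three _ _ _)).trans ?_)
  have := add_le_add (add_le_add t1 t2) t3
  nlinarith [this, h6, pow_pos hh 6]

/-- The error in the Evans function, for spectral scale `r` and end points so far out that the
potential is constant there to the accuracy considered. -/
theorem norm_evansError_add_le (hd : BoundedJet d B) {c I : ℝ} {lam : ℂ} {yl yr : ℝ → Fin 2 → ℂ}
    (hl : IsSolution (coeffMatrix c (d 0) lam) yl) (hr : IsSolution (coeffMatrix c (d 0) lam) yr)
    (hE : ExactPair (fun x => Complex.exp (c / 2 * x) * yl x 0)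
      (fun x => Complex.exp (c / 2 * x) * (yl x 1 + c / 2 * yl x 0))
      (fun x => Complex.exp (c / 2 * x) * yr x 0)
      (fun x => Complex.exp (c / 2 * x) * (yr x 1 + c / 2 * yr x 0)) r C)
    (hC : 20 * B ^ 2 ≤ C) (hrC : 300 * C ^ 4 ≤ r) (hh : 0 < h) (hh1 : h ≤ 1) (N : ℕ)
    (h10 : |d 1 (-(N * h))| ≤ h ^ 4) (h11 : |d 1 (N * h)| ≤ h ^ 4)
    (h30 : |d 3 (-(N * h))| ≤ h ^ 2) (h31 : |d 3 (N * h)| ≤ h ^ 2)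
    (hI : |(∫ x in (-(N * h))..(N * h), d 1 x ^ 2) - I| ≤ h ^ 2) :
    ‖evansError (coeffMatrix c (d 0) lam) yl yr h N + ((h ^ 4 / 144 * I : ℝ) : ℂ)‖ ≤
      1000 * C ^ 5 * (h ^ 6 + h ^ 4 / r + h ^ 2 / r ^ 2) := by
  have hB := hd.one_le
  have hB2 : 1 ≤ B ^ 2 := one_le_pow₀ hB
  have hC1 : 1 ≤ C := by linarith
  have hr1 : 1 ≤ r := by have : 1 ≤ C ^ 4 := one_le_pow₀ hC1; linarith
  have hr0 : 0 < r := by linarith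
  have hw := IsSolution.scalarSolution hl
  have hp := IsSolution.scalarSolution hr
  set x₀ : ℝ := -(N * h) with hx₀
  have hx₁ : x₀ + ((N + N : ℕ) : ℝ) * h = N * h := by rw [hx₀]; push_cast; ring
  have h01 : x₀ ≤ N * h := by
    have : 0 ≤ (N : ℝ) * h := by positivity
    linarith
  set w := fun x : ℝ => Complex.exp (c / 2 * x) * yl x 0 with hwdef
  set v := fun x : ℝ => Complex.exp (c / 2 * x) * (yl x 1 + c / 2 * yl x 0) with hvdef
  set wp := fun x : ℝ => Complex.exp (c / 2 * x) * yr x 0 with hwpdef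
  set vp := fun x : ℝ => Complex.exp (c / 2 * x) * (yr x 1 + c / 2 * yr x 0) with hvpdef
  set β : ℝ → ℝ := fun x => h ^ 2 / 12 * d 1 x with hβ
  set ζ₁ := gaugedCurve₁ c d lam x₀ h (yl x₀) with hζ₁
  set ζ₂ := gaugedCurve₂ c d lam x₀ h (yl x₀) with hζ₂
  have hc := continuousOn_gaugedCurve (c := c) (lam := lam) (x₀ := x₀) (y₀ := yl x₀) hd.jet hh (N + N)
  have hF : FrameBounds (fun x => v x / w x) (fun x => vp x / wp x) (gridPotentialError d x₀ h)
      (gridSlopeError d x₀ h) (accumulatedError d x₀ h) x₀ (N * h) h r C := by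
    rw [← hx₁]
    exact hE.frameBounds hd hC hh hh1 (N + N)
  have hP : PerturbedFrame (growingCoord w v wp vp ζ₁ ζ₂) (decayingCoord w v wp vp ζ₁ ζ₂)
      (fun x => v x / w x) (fun x => vp x / wp x) (gridPotentialError d x₀ h)
      (gridSlopeError d x₀ h) (accumulatedError d x₀ h) x₀ (N * h) := by
    rw [← hx₁]
    exact hE.perturbedFrame hr0 hw hp hc.1 hc.2 (hd.continuousOn_accumulatedError hh _)
      (fun x hx => (hasDerivWithinAt_gaugedCurve hd.jet hh hx.1).1)
      (fun x hx => (hasDerivWithinAt_gaugedCurve hd.jet hh hx.1).2)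
      (fun x hx => hd.hasDerivWithinAt_accumulatedError hh _ hx)
  have hstart := magnusCurve_start (c := c) (φ := d 0) (lam := lam) (x₀ := x₀) (y₀ := yl x₀) hh
  have hs := hE.coord_start (ζ₁ := ζ₁) (ζ₂ := ζ₂) hr0 (x := x₀) (β := (β x₀ : ℂ))
    (by simp only [hζ₁, gaugedCurve₁, hstart, hwdef])
    (by simp only [hζ₂, gaugedCurve₂, hstart, hwdef, hvdef, hβ]; ring)
  have hβle : ∀ x, |d 1 x| ≤ h ^ 4 → |β x| ≤ h ^ 6 := fun x hx => by
    simp only [hβ]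
    rw [abs_mul, abs_of_nonneg (by positivity)]
    calc h ^ 2 / 12 * |d 1 x| ≤ h ^ 2 / 1 * h ^ 4 := by gcongr; norm_num
      _ = h ^ 6 := by ring
  have hβ0 := hβle _ h10
  have hβ1 := hβle _ h11
  have hj := hF.norm_inv_le hr0
  have hbj : ‖(β x₀ : ℂ) * (vp x₀ / wp x₀ - v x₀ / w x₀)⁻¹‖ ≤ |β x₀| / r := by
    rw [norm_mul, Complex.norm_real, Real.norm_eq_abs, div_eq_mul_one_div |β x₀|]
    exact mul_le_mul_of_nonneg_left (hj x₀) (abs_nonneg _)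
  have ha₀ : ‖growingCoord w v wp vp ζ₁ ζ₂ x₀ - 1‖ ≤ |β x₀| / r := by
    rw [hs.1, ← norm_neg]
    simpa using hbj
  have hb₀ : ‖decayingCoord w v wp vp ζ₁ ζ₂ x₀‖ ≤ |β x₀| / r := by rw [hs.2]; exact hbj
  have hβ0' : |β x₀| ≤ 1 := hβ0.trans (pow_le_one₀ hh.le hh1)
  have hC4 : 1 ≤ C ^ 4 := one_le_pow₀ hC1
  have hmain := hP.norm_a_le hF h01 hC1 hrC hh hh1 (by simp [accumulatedError])
    (ha₀.trans (by
      rw [div_le_div_iff₀ hr0 (by norm_num)]; linarith))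
    (hb₀.trans (by gcongr))
  obtain ⟨m1, m2, m3⟩ := hmain
  have hX : |accumulatedError d x₀ h (N * h) - h ^ 4 / 144 * I| ≤ C * h ^ 6 := by
    have := hd.abs_accumulatedError_sub_le_of_tails hh (N + N) (x₀ := x₀) (I := I)
    rw [hx₁] at this
    exact (this h10 h11 h30 h31 hI).trans (by gcongr)
  have hE4 : |h ^ 4 / 144 * I| ≤ C * h ^ 4 := by
    have i1 := hd.integral_sq_le h01
    have i2 : 0 ≤ ∫ x in x₀..(N * h), d 1 x ^ 2 :=
      intervalIntegral.integral_nonneg h01 fun _ _ => sq_nonneg _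
    have h2 : h ^ 2 ≤ 1 := pow_le_one₀ hh.le hh1
    have hIC : |I| ≤ C := by
      have := abs_le.1 hI
      rw [abs_le]; constructor <;> linarith
    rw [abs_mul, abs_of_nonneg (by positivity)]
    calc h ^ 4 / 144 * |I| ≤ h ^ 4 / 1 * C := by gcongr; norm_num
      _ = C * h ^ 4 := by ring
  set D := w 0 * vp 0 - v 0 * wp 0 with hD
  have hW := hE.wedge_eq (ζ₁ := ζ₁) (ζ₂ := ζ₂) hr0 (x := N * h) (β := (β (N * h) : ℂ))
    (hw.wronskian_eq hp (N * h))
  have hfin := norm_determinant_error_le (D := D) hC1 hrC hh hh1 (hj (N * h)) hE.norm_D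
    (by rw [← hW.1]; exact hE.norm_g _) hβ0 hβ1 hX hE4 ha₀ hb₀ m1 m2 m3
  have hnum : evansError (coeffMatrix c (d 0) lam) yl yr h N =
      D * (growingCoord w v wp vp ζ₁ ζ₂ (N * h) - 1) + β (N * h) *
        (growingCoord w v wp vp ζ₁ ζ₂ (N * h) + decayingCoord w v wp vp ζ₁ ζ₂ (N * h)) *
          (D * (vp (N * h) / wp (N * h) - v (N * h) / w (N * h))⁻¹) := by
    rw [← hW.2]
    have hD0 : D = wedge (yl 0) (yr 0) := by
      simp only [hD, hwdef, hvdef, hwpdef, hvpdef, wedge, Matrix.det_fin_two_of]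
      simp
      ring
    have hend := magnusCurve_node (c := c) (φ := d 0) (lam := lam) (x₀ := x₀) (y₀ := yl x₀) hh (N + N)
    rw [hx₁] at hend
    rw [evansError, ← hx₀, hx₀, wedge_magnusIterate, ← hx₀, ← hend, ← hD0, ← hD]
    congr 1
    simp only [hζ₁, hζ₂, gaugedCurve₁, gaugedCurve₂, hwpdef, hvpdef, wedge, Matrix.det_fin_two_of, hβ]
    have hexp : Complex.exp (c * (N * h : ℝ)) =
        Complex.exp (c / 2 * (N * h : ℝ)) * Complex.exp (c / 2 * (N * h : ℝ)) := by
      rw [← Complex.exp_add]; congr 1; ring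
    rw [hexp]
    ring
  rw [hnum]
  exact hfin

end

/-! ### Norms of the potential -/

/-- A potential with limits `mm` at `-∞` and `mp` at `+∞`, together with its derivatives; `B`
bounds all norms in use. -/
structure AsymptoticPotential (d : ℕ → ℝ → ℝ) (mm mp B : ℝ) : Prop extends BoundedJet d B where
  tendsto_bot : Tendsto (d 0) atBot (𝓝 mm)
  tendsto_top : Tendsto (d 0) atTop (𝓝 mp)
  integrableOn_bot : IntegrableOn (fun x => d 0 x - mm) (Set.Iic 0)
  integrableOn_top : IntegrableOn (fun x => d 0 x - mp) (Set.Ici 0)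
  integral_bot : ∫ x in Set.Iic 0, |d 0 x - mm| ≤ B
  integral_top : ∫ x in Set.Ici 0, |d 0 x - mp| ≤ B
  abs_bot : |mm| ≤ B
  abs_top : |mp| ≤ B

theorem exists_abs_le_of_tendsto {g : ℝ → ℝ} {a b : ℝ} (hg : Continuous g)
    (ha : Tendsto g atBot (𝓝 a)) (hb : Tendsto g atTop (𝓝 b)) : ∃ B, ∀ x, |g x| ≤ B := by
  obtain ⟨B₁, h1⟩ := ha.abs.isBoundedUnder_le
  obtain ⟨B₂, h2⟩ := hb.abs.isBoundedUnder_le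
  obtain ⟨s, hs⟩ := eventually_atBot.1 (eventually_map.1 h1)
  obtain ⟨t, ht⟩ := eventually_atTop.1 (eventually_map.1 h2)
  obtain ⟨B₃, h3⟩ := (isCompact_Icc (a := s) (b := t)).exists_bound_of_continuousOn hg.continuousOn
  refine ⟨max B₃ (max B₁ B₂), fun x => ?_⟩
  rcases le_total x s with h | h
  · exact (hs x h).trans ((le_max_left _ _).trans (le_max_right _ _))
  rcases le_total t x with h' | h'
  · exact (ht x h').trans ((le_max_right _ _).trans (le_max_right _ _))
  · exact (h3 x ⟨h, h'⟩).trans (le_max_left _ _)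

section
variable {d : ℕ → ℝ → ℝ} {mm mp B : ℝ}

theorem IsJet.tendsto_zero (hd : IsJet d) (hi : ∀ p, 1 ≤ p → Integrable (d p)) {p : ℕ}
    (hp : 1 ≤ p) : Tendsto (d p) atBot (𝓝 0) ∧ Tendsto (d p) atTop (𝓝 0) :=
  ⟨tendsto_zero_of_hasDerivAt_of_integrableOn_Iic (a := 0) (fun x _ => hd p x)
    (hi (p + 1) (by omega)).integrableOn (hi p hp).integrableOn,
  tendsto_zero_of_hasDerivAt_of_integrableOn_Ioi (a := 0) (fun x _ => hd p x)
    (hi (p + 1) (by omega)).integrableOn (hi p hp).integrableOn⟩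

theorem IsJet.exists_asymptoticPotential (hd : IsJet d) (hi : ∀ p, 1 ≤ p → Integrable (d p))
    (hb : Tendsto (d 0) atBot (𝓝 mm)) (ht : Tendsto (d 0) atTop (𝓝 mp))
    (hib : IntegrableOn (fun x => d 0 x - mm) (Set.Iic 0))
    (hit : IntegrableOn (fun x => d 0 x - mp) (Set.Ici 0)) :
    ∃ B, AsymptoticPotential d mm mp B := by
  have h1 : ∀ p, ∃ B, ∀ x, |d p x| ≤ B := by
    intro p
    rcases Nat.eq_zero_or_pos p with rfl | hp
    · exact exists_abs_le_of_tendsto (hd.continuous 0) hb ht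
    · obtain ⟨hb', ht'⟩ := hd.tendsto_zero hi hp
      exact exists_abs_le_of_tendsto (hd.continuous p) hb' ht'
  choose b hb' using h1
  have hb0 : ∀ p, 0 ≤ b p := fun p => (abs_nonneg _).trans (hb' p 0)
  set J : ℕ → ℝ := fun p => ∫ x, |d p x| with hJ
  have hJ0 : ∀ p, 0 ≤ J p := fun p => integral_nonneg fun _ => abs_nonneg _
  set s := ∑ p ∈ Finset.range 7, (b p + J p) with hs
  have hsp : ∀ p < 7, b p + J p ≤ s := fun p hp =>
    Finset.single_le_sum (f := fun p => b p + J p) (fun q _ => add_nonneg (hb0 q) (hJ0 q))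
      (Finset.mem_range.2 hp)
  have hs0 : 0 ≤ s := Finset.sum_nonneg fun q _ => add_nonneg (hb0 q) (hJ0 q)
  set I₁ := ∫ x in Set.Iic 0, |d 0 x - mm| with hI₁
  set I₂ := ∫ x in Set.Ici 0, |d 0 x - mp| with hI₂
  have hI₁0 : 0 ≤ I₁ := integral_nonneg fun _ => abs_nonneg _
  have hI₂0 : 0 ≤ I₂ := integral_nonneg fun _ => abs_nonneg _
  have hm0 := abs_nonneg mm
  have hp0 := abs_nonneg mp
  refine ⟨1 + s + I₁ + I₂ + |mm| + |mp|, ⟨hd, by linarith, fun p hp x => ?_,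
    fun p hp hp' x₀ x₁ h01 => ?_⟩, hb, ht, hib, hit, by linarith, by linarith, by linarith,
    by linarith⟩
  · have := hsp p (by omega)
    have := hb' p x
    have := hJ0 p
    linarith
  · have h2 : ∫ x in x₀..x₁, |d p x| ≤ J p := by
      rw [intervalIntegral.integral_of_le h01]
      exact setIntegral_le_integral (hi p hp).abs (Eventually.of_forall fun _ => abs_nonneg _)
    have := hsp p (by omega)
    have := hb0 p
    linarith

theorem BoundedJet.slowPotential (hd : BoundedJet d B) : SlowPotential (d 0) (d 1) B :=
  ⟨hd.jet 0, hd.jet.continuous 1, hd.bound 1 (by norm_num),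
    hd.integral_bound 1 le_rfl (by norm_num)⟩

/-! ### Square roots in a sector -/

/-- In the sector `|arg z| < π - ε`, `‖z‖ + z.re`, which is twice the square of the real part of
`√z`, is comparable to `‖z‖`. -/
theorem mul_norm_le_norm_add_re {ε : ℝ} (hε : 0 < ε) {z : ℂ} (hz : |z.arg| < Real.pi - ε) :
    (1 - Real.cos ε) * ‖z‖ ≤ ‖z‖ + z.re := by
  have h1 : Real.cos (Real.pi - ε) ≤ Real.cos |z.arg| :=
    Real.cos_le_cos_of_nonneg_of_le_pi (abs_nonneg _) (by linarith) hz.le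
  rw [Real.cos_abs, Real.cos_pi_sub] at h1
  have h2 : ‖z‖ * Real.cos z.arg = z.re := Complex.norm_mul_cos_arg z
  nlinarith [norm_nonneg z]

variable {δ s t : ℝ} {lam : ℂ}

/-- A bounded real shift of a large number in a sector stays in a smaller sector. -/
theorem half_mul_norm_le_norm_add_re (hlam : δ * ‖lam‖ ≤ ‖lam‖ + lam.re)
    (hbig : 4 * s ≤ δ * ‖lam‖) (ht : |t| ≤ s) :
    δ / 2 * ‖lam‖ ≤ ‖lam + t‖ + (lam + t).re := by
  have h1 : ‖lam‖ ≤ ‖lam + t‖ + |t| := by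
    have := norm_sub_le (lam + t) (t : ℂ)
    rwa [add_sub_cancel_right, Complex.norm_real, Real.norm_eq_abs] at this
  have h2 := neg_abs_le t
  simp only [Complex.add_re, Complex.ofReal_re]
  linarith

theorem sqrt_le_re_cpow_half {z : ℂ} {ρ : ℝ} (h : 2 * ρ ≤ ‖z‖ + z.re) :
    Real.sqrt ρ ≤ (z ^ (1 / 2 : ℂ)).re := by
  rw [one_div, Complex.cpow_inv_two_re]
  exact Real.sqrt_le_sqrt (by linarith)

theorem cpow_half_sq (z : ℂ) : (z ^ (1 / 2 : ℂ)) ^ 2 = z := by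
  rw [one_div]
  exact Complex.cpow_nat_inv_pow z two_ne_zero

/-- The principal root of `lam + c² / 4 - φ`, for `lam` large in a sector. -/
theorem BoundedJet.rootBranch (hd : BoundedJet d B) (c : ℝ) (hδ : 0 < δ) (hδ2 : δ ≤ 2)
    (hlam : δ * ‖lam‖ ≤ ‖lam‖ + lam.re) (hbig : 4 * (c ^ 2 / 4 + B) ≤ δ * ‖lam‖) :
    RootBranch (d 0) (d 1) (lam + c ^ 2 / 4)
      (fun x => (lam + c ^ 2 / 4 - d 0 x) ^ (1 / 2 : ℂ))
      (Real.sqrt δ / 2 * Real.sqrt ‖lam‖) (4 / Real.sqrt δ) := by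
  have hB := hd.one_le
  have hlam0 : 0 < ‖lam‖ := by
    by_contra h
    nlinarith [sq_nonneg c, norm_nonneg lam]
  have hδs : 0 < Real.sqrt δ := Real.sqrt_pos.2 hδ
  have hr : Real.sqrt (δ / 4 * ‖lam‖) = Real.sqrt δ / 2 * Real.sqrt ‖lam‖ := by
    rw [Real.sqrt_mul (by positivity), Real.sqrt_div hδ.le]
    congr 2
    rw [show (4 : ℝ) = 2 ^ 2 by norm_num, Real.sqrt_sq (by norm_num)]
  have hz : ∀ x, lam + c ^ 2 / 4 - d 0 x = lam + ((c ^ 2 / 4 - d 0 x : ℝ) : ℂ) := fun x => by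
    push_cast; ring
  have ht : ∀ x, |c ^ 2 / 4 - d 0 x| ≤ c ^ 2 / 4 + B := fun x => by
    refine (abs_sub _ _).trans (add_le_add (abs_of_nonneg (by positivity)).le ?_)
    exact hd.bound 0 (by norm_num) x
  have hre : ∀ x, Real.sqrt (δ / 4 * ‖lam‖) ≤ ((lam + c ^ 2 / 4 - d 0 x) ^ (1 / 2 : ℂ)).re := by
    intro x
    have := half_mul_norm_le_norm_add_re hlam hbig (ht x)
    rw [hz x]
    exact sqrt_le_re_cpow_half (by linarith)
  refine ⟨fun x => cpow_half_sq _, fun x => ?_, fun x => hr ▸ hre x, fun x => ?_⟩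
  · have hslit : lam + c ^ 2 / 4 - d 0 x ∈ Complex.slitPlane := by
      have := half_mul_norm_le_norm_add_re hlam hbig (ht x)
      rw [← hz x] at this
      rw [Complex.mem_slitPlane_iff_not_le_zero]
      intro hle
      obtain ⟨h1, h2⟩ := Complex.le_def.1 hle
      have h3 : ‖lam + c ^ 2 / 4 - d 0 x‖ = |(lam + c ^ 2 / 4 - d 0 x).re| :=
        Complex.abs_re_eq_norm.2 h2 |>.symm
      rw [h3, abs_of_nonpos h1] at this
      have : 0 < δ / 2 * ‖lam‖ := by positivity
      linarith
    have h1 : HasDerivAt (fun x => lam + c ^ 2 / 4 - (d 0 x : ℂ)) (-(d 1 x : ℂ)) x :=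
      ((hd.jet 0 x).ofReal_comp).const_sub _
    have hne : (lam + c ^ 2 / 4 - d 0 x) ^ (1 / 2 : ℂ) ≠ 0 := by
      intro h0
      have := hre x
      rw [h0, Complex.zero_re] at this
      exact absurd this (not_le.2 (Real.sqrt_pos.2 (by positivity)))
    have hpow := ((hasDerivAt_id (lam + c ^ 2 / 4 - (d 0 x : ℂ))).cpow_const (c := (1 / 2 : ℂ))
      hslit).comp x h1
    refine hpow.congr_deriv ?_
    simp only [id_eq]
    have h2 : (lam + c ^ 2 / 4 - d 0 x) ^ ((1 / 2 : ℂ) - 1) =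
        ((lam + c ^ 2 / 4 - d 0 x) ^ (1 / 2 : ℂ))⁻¹ := by
      rw [← Complex.cpow_neg]; congr 1; norm_num
    rw [h2]
    field_simp
  · have h1 : ‖(lam + c ^ 2 / 4 - d 0 x) ^ (1 / 2 : ℂ)‖ ^ 2 ≤ (2 * Real.sqrt ‖lam‖) ^ 2 := by
      rw [← norm_pow, cpow_half_sq, mul_pow, Real.sq_sqrt hlam0.le, hz x]
      refine (norm_add_le _ _).trans ?_
      rw [Complex.norm_real, Real.norm_eq_abs]
      have := ht x
      nlinarith
    have h2 := (pow_le_pow_iff_left₀ (norm_nonneg _) (by positivity) two_ne_zero).1 h1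
    calc _ ≤ 2 * Real.sqrt ‖lam‖ := h2
      _ = _ := by field_simp; norm_num

end

/-! ### Exact solutions for large spectral parameter -/

section
variable {c m : ℝ} {φ : ℝ → ℝ} {lam : ℂ} {y : ℝ → Fin 2 → ℂ} {d : ℕ → ℝ → ℝ} {mm mp B δ : ℝ}

theorem half_kappa_sq (c m : ℝ) (lam : ℂ) :
    (kappa c m lam / 2) ^ 2 = lam + c ^ 2 / 4 - m := by
  rw [div_pow, kappa, cpow_half_sq]
  ring

theorem le_re_half_kappa (hδ : 0 < δ) (hlam : δ * ‖lam‖ ≤ ‖lam‖ + lam.re)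
    (hbig : 4 * (c ^ 2 / 4 + B) ≤ δ * ‖lam‖) (hm : |m| ≤ B) :
    Real.sqrt δ / 2 * Real.sqrt ‖lam‖ ≤ (kappa c m lam / 2).re := by
  have ht : |c ^ 2 / 4 - m| ≤ c ^ 2 / 4 + B :=
    (abs_sub _ _).trans (add_le_add (abs_of_nonneg (by positivity)).le hm)
  have h1 := half_mul_norm_le_norm_add_re hlam hbig ht
  have h2 : (c : ℂ) ^ 2 + 4 * (lam - m) = (4 : ℝ) * (lam + ((c ^ 2 / 4 - m : ℝ) : ℂ)) := by
    push_cast; ring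
  have h3 : Real.sqrt (δ * ‖lam‖) ≤ (kappa c m lam).re := by
    rw [kappa, h2]
    refine sqrt_le_re_cpow_half ?_
    rw [norm_mul, Complex.re_ofReal_mul, Complex.norm_real]
    norm_num at h1 ⊢
    linarith
  rw [Real.sqrt_mul hδ.le] at h3
  have : (kappa c m lam / 2).re = (kappa c m lam).re / 2 := by simp
  rw [this]
  linarith

/-- The normalisation at `-∞` in terms of the scalar solution. -/
theorem IsLeftSolution.tendsto (h : IsLeftSolution c m φ lam y) :
    Tendsto (fun x : ℝ => Complex.exp (-(kappa c m lam / 2 * x)) *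
      (Complex.exp (c / 2 * x) * y x 0)) atBot (𝓝 1) ∧
    Tendsto (fun x : ℝ => Complex.exp (-(kappa c m lam / 2 * x)) *
      (Complex.exp (c / 2 * x) * (y x 1 + c / 2 * y x 0))) atBot (𝓝 (kappa c m lam / 2)) := by
  have h0 := (tendsto_pi_nhds.1 h.normalised) 0
  have h1 := (tendsto_pi_nhds.1 h.normalised) 1
  have he : ∀ x : ℝ, Complex.exp (-(mu₁ c m lam * x)) =
      Complex.exp (-(kappa c m lam / 2 * x)) * Complex.exp (c / 2 * x) := fun x => by
    rw [← Complex.exp_add, mu₁]; congr 1; ring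
  simp only [Pi.smul_apply, smul_eq_mul, he, Matrix.cons_val_zero, Matrix.cons_val_one] at h0 h1
  refine ⟨h0.congr fun x => by ring, ?_⟩
  have h2 := h1.add (h0.const_mul ((c : ℂ) / 2))
  have e : mu₁ c m lam + c / 2 * 1 = kappa c m lam / 2 := by rw [mu₁]; ring
  rw [e] at h2
  exact h2.congr fun x => by ring

/-- The normalisation at `+∞` in terms of the scalar solution. -/
theorem IsRightSolution.tendsto (h : IsRightSolution c m φ lam y) :
    Tendsto (fun x : ℝ => Complex.exp (kappa c m lam / 2 * x) *
      (Complex.exp (c / 2 * x) * y x 0)) atTop (𝓝 1) ∧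
    Tendsto (fun x : ℝ => Complex.exp (kappa c m lam / 2 * x) *
      (Complex.exp (c / 2 * x) * (y x 1 + c / 2 * y x 0))) atTop (𝓝 (-(kappa c m lam / 2))) := by
  have h0 := (tendsto_pi_nhds.1 h.normalised) 0
  have h1 := (tendsto_pi_nhds.1 h.normalised) 1
  have he : ∀ x : ℝ, Complex.exp (-(mu₂ c m lam * x)) =
      Complex.exp (kappa c m lam / 2 * x) * Complex.exp (c / 2 * x) := fun x => by
    rw [← Complex.exp_add, mu₂]; congr 1; ring
  simp only [Pi.smul_apply, smul_eq_mul, he, Matrix.cons_val_zero, Matrix.cons_val_one] at h0 h1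
  refine ⟨h0.congr fun x => by ring, ?_⟩
  have h2 := h1.add (h0.const_mul ((c : ℂ) / 2))
  have e : mu₂ c m lam + c / 2 * 1 = -(kappa c m lam / 2) := by rw [mu₂]; ring
  rw [e] at h2
  exact h2.congr fun x => by ring

theorem AsymptoticPotential.exactPair (hd : AsymptoticPotential d mm mp B) (hδ : 0 < δ)
    (hδ2 : δ ≤ 2) (hlam : δ * ‖lam‖ ≤ ‖lam‖ + lam.re)
    (hbig : 4 * (c ^ 2 / 4 + B) ≤ δ * ‖lam‖)
    (hr : 400 * (4 / Real.sqrt δ * B) ≤ Real.sqrt δ / 2 * Real.sqrt ‖lam‖)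
    {yl yr : ℝ → Fin 2 → ℂ} (hl : IsLeftSolution c mm (d 0) lam yl)
    (hy : IsRightSolution c mp (d 0) lam yr) :
    ExactPair (fun x => Complex.exp (c / 2 * x) * yl x 0)
      (fun x => Complex.exp (c / 2 * x) * (yl x 1 + c / 2 * yl x 0))
      (fun x => Complex.exp (c / 2 * x) * yr x 0)
      (fun x => Complex.exp (c / 2 * x) * (yr x 1 + c / 2 * yr x 0))
      (Real.sqrt δ / 2 * Real.sqrt ‖lam‖) (100 * (4 / Real.sqrt δ * B)) := by
  have hB := hd.one_le
  have hQ : 1 ≤ 4 / Real.sqrt δ := by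
    rw [one_le_div (Real.sqrt_pos.2 hδ), Real.sqrt_le_left (by norm_num)]
    linarith
  have hr20 : 20 * B ≤ Real.sqrt δ / 2 * Real.sqrt ‖lam‖ := by nlinarith
  have hb := hd.toBoundedJet.bound 0 (by norm_num)
  have h0 : ∀ m : ℝ, |m| ≤ B → |d 0 0 - m| ≤ 2 * B := fun m hm => by
    have := (abs_sub (d 0 0) m).trans (add_le_add (hb 0) hm)
    linarith
  have hq := hd.toBoundedJet.rootBranch c hδ hδ2 hlam hbig
  have hw := IsSolution.scalarSolution hl.solution
  have hp := IsSolution.scalarSolution hy.solution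
  obtain ⟨l1, l2, l3, l4⟩ := wkb_left hd.toBoundedJet.slowPotential hq hw hB hr20
    (half_kappa_sq c mm lam) (le_re_half_kappa hδ hlam hbig hd.abs_bot) hd.tendsto_bot
    hd.integrableOn_bot hd.integral_bot (h0 mm hd.abs_bot) hl.tendsto.1 hl.tendsto.2
  obtain ⟨r1, r2, r3, r4⟩ := wkb_right hd.toBoundedJet.slowPotential hq hp hB hr20
    (half_kappa_sq c mp lam) (le_re_half_kappa hδ hlam hbig hd.abs_top) hd.tendsto_top
    hd.integrableOn_top hd.integral_top (h0 mp hd.abs_top) hy.tendsto.1 hy.tendsto.2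
  exact EvansMagnus.exactPair hb hq hw hp hB hQ hr l1 l2 l3 l4 r1 r2 r3 r4

/-- For long intervals, the derivatives at the ends and the tails of `∫ (φ')²` are negligible. -/
theorem AsymptoticPotential.exists_length (hd : AsymptoticPotential d mm mp B)
    (hi : ∀ p, 1 ≤ p → Integrable (d p)) {h : ℝ} (hh : 0 < h) :
    ∃ N₀ : ℕ, ∀ N : ℕ, N₀ ≤ N →
      |d 1 (-(N * h))| ≤ h ^ 4 ∧ |d 1 (N * h)| ≤ h ^ 4 ∧
      |d 3 (-(N * h))| ≤ h ^ 2 ∧ |d 3 (N * h)| ≤ h ^ 2 ∧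
      |(∫ x in (-(N * h))..(N * h), d 1 x ^ 2) - ∫ x, d 1 x ^ 2| ≤ h ^ 2 := by
  have hN : Tendsto (fun N : ℕ => (N : ℝ) * h) atTop atTop :=
    tendsto_natCast_atTop_atTop.atTop_mul_const hh
  have hN' : Tendsto (fun N : ℕ => -((N : ℝ) * h)) atTop atBot := tendsto_neg_atTop_atBot.comp hN
  have ev : ∀ {g : ℝ → ℝ} {u : ℕ → ℝ} {l : Filter ℝ} {e : ℝ}, Tendsto g l (𝓝 0) →
      Tendsto u atTop l → 0 < e → ∀ᶠ N in atTop, |g (u N)| ≤ e := fun hg hu he => by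
    filter_upwards [(hg.comp hu).eventually (Metric.ball_mem_nhds 0 he)] with N hN
    rw [dist_zero_right] at hN
    exact hN.le
  have t1 := hd.jet.tendsto_zero hi (p := 1) le_rfl
  have t3 := hd.jet.tendsto_zero hi (p := 3) (by norm_num)
  have hsq : Integrable fun x => d 1 x ^ 2 := by
    refine ((hi 1 le_rfl).norm.const_mul B).mono'
      ((hd.jet.continuous 1).pow 2).aestronglyMeasurable (Eventually.of_forall fun x => ?_)
    have := hd.toBoundedJet.bound 1 (by norm_num) x
    rw [Real.norm_eq_abs, Real.norm_eq_abs, abs_pow, sq]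
    gcongr
  have tI := (intervalIntegral_tendsto_integral hsq hN' hN).sub_const (∫ x, d 1 x ^ 2)
  rw [sub_self] at tI
  have e5 : ∀ᶠ N : ℕ in atTop,
      |(∫ x in (-(N * h))..(N * h), d 1 x ^ 2) - ∫ x, d 1 x ^ 2| ≤ h ^ 2 := by
    filter_upwards [tI.eventually (Metric.ball_mem_nhds 0 (pow_pos hh 2))] with N hN
    rw [dist_zero_right] at hN
    exact hN.le
  have h4 := pow_pos hh 4
  have h2 := pow_pos hh 2
  exact eventually_atTop.1 ((ev t1.1 hN' h4).and ((ev t1.2 hN h4).and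
    ((ev t3.1 hN' h2).and ((ev t3.2 hN h2).and e5))))

/-- The error bound for all `lam` in the sector beyond a fixed radius. -/
theorem AsymptoticPotential.exists_norm_evansError_add_le (hd : AsymptoticPotential d mm mp B)
    (hi : ∀ p, 1 ≤ p → Integrable (d p)) (c : ℝ) {ε : ℝ} (hε : 0 < ε) (hεπ : ε ≤ Real.pi) :
    ∃ C R : ℝ, 0 < C ∧ 0 < R ∧ ∀ h : ℝ, 0 < h → h ≤ 1 → ∃ N₀ : ℕ, ∀ N : ℕ, N₀ ≤ N →
      ∀ lam : ℂ, |lam.arg| < Real.pi - ε → R ≤ ‖lam‖ → ∀ yl yr : ℝ → Fin 2 → ℂ,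
        IsLeftSolution c mm (d 0) lam yl → IsRightSolution c mp (d 0) lam yr →
        ‖evansError (coeffMatrix c (d 0) lam) yl yr h N
          + ((h ^ 4 / 144 * ∫ x, d 1 x ^ 2 : ℝ) : ℂ)‖ ≤
          C * (h ^ 6 + h ^ 4 / Real.sqrt ‖lam‖ + h ^ 2 / ‖lam‖) := by
  have hB := hd.one_le
  set δ := 1 - Real.cos ε with hδdef
  have hδ : 0 < δ := by
    have := Real.cos_lt_cos_of_nonneg_of_le_pi le_rfl hεπ hε
    rw [Real.cos_zero] at this
    linarith
  have hδ2 : δ ≤ 2 := by linarith [Real.neg_one_le_cos ε]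
  have hs : 0 < Real.sqrt δ := Real.sqrt_pos.2 hδ
  have hs2 : Real.sqrt δ ≤ 2 := by rw [Real.sqrt_le_left (by norm_num)]; linarith
  set Q := 4 / Real.sqrt δ with hQdef
  have hQ : 1 ≤ Q := by rw [hQdef, one_le_div hs]; linarith
  set C := 100 * (Q * B) + 20 * B ^ 2 with hC
  have hQB : 1 ≤ Q * B := by nlinarith
  have hC1 : 1 ≤ C := by linarith [sq_nonneg B]
  have hC5 : 0 < C ^ 5 := by positivity
  set ρ := 300 * C ^ 4 with hρ
  have hρC : 300 * C ≤ ρ := by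
    have : C ≤ C ^ 4 := le_self_pow₀ hC1 (by norm_num)
    linarith
  set G := 2 / Real.sqrt δ with hG
  have hG1 : 1 ≤ G := by rw [hG, one_le_div hs]; linarith
  -- the first term of the radius makes `r ≥ ρ`, the second keeps `lam + c² / 4 - φ` in a sector
  refine ⟨1000 * C ^ 5 * G ^ 2, (G * ρ) ^ 2 + 4 * (c ^ 2 / 4 + B) / δ, by positivity,
    by positivity, fun h hh hh1 => ?_⟩
  obtain ⟨N₀, hN₀⟩ := hd.exists_length hi hh
  refine ⟨N₀, fun N hN lam harg hR yl yr hl hy => ?_⟩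
  obtain ⟨a1, a2, a3, a4, a5⟩ := hN₀ N hN
  have hlam := mul_norm_le_norm_add_re hε harg
  have hlam0 : 0 < ‖lam‖ := lt_of_lt_of_le (by positivity) hR
  have hbig : 4 * (c ^ 2 / 4 + B) ≤ δ * ‖lam‖ := by
    rw [mul_comm δ, ← div_le_iff₀ hδ]
    linarith [sq_nonneg (G * ρ)]
  have hroot : G * ρ ≤ Real.sqrt ‖lam‖ := by
    refine Real.le_sqrt_of_sq_le ?_
    have : 0 ≤ 4 * (c ^ 2 / 4 + B) / δ := by positivity
    linarith
  set r := Real.sqrt δ / 2 * Real.sqrt ‖lam‖ with hr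
  have hrG : r = Real.sqrt ‖lam‖ / G := by rw [hr, hG]; field_simp
  have hρr : ρ ≤ r := by
    rw [hrG, le_div_iff₀ (by positivity)]
    linarith
  have hr0 : 0 < r := by positivity
  have hE := hd.exactPair hδ hδ2 hlam hbig (by linarith [sq_nonneg B]) hl hy
  have hE' := hE.mono (C' := C) hr0 (by linarith [sq_nonneg B])
  have hCB : 20 * B ^ 2 ≤ C := by linarith
  have key := norm_evansError_add_le hd.toBoundedJet hl.solution hy.solution hE' hCB hρr hh hh1 N
    a1 a2 a3 a4 a5
  refine key.trans ?_
  rw [mul_assoc (1000 * C ^ 5)]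
  refine mul_le_mul_of_nonneg_left ?_ (by positivity)
  have hS : 0 < Real.sqrt ‖lam‖ := Real.sqrt_pos.2 hlam0
  have e1 : h ^ 4 / r = G * (h ^ 4 / Real.sqrt ‖lam‖) := by rw [hrG]; field_simp
  have e2 : h ^ 2 / r ^ 2 = G ^ 2 * (h ^ 2 / ‖lam‖) := by
    rw [hrG, div_pow, Real.sq_sqrt hlam0.le]; field_simp
  have hG2 : G ≤ G ^ 2 := le_self_pow₀ hG1 (by norm_num)
  have hG3 : 1 ≤ G ^ 2 := one_le_pow₀ hG1
  rw [e1, e2, mul_add, mul_add]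
  gcongr
  exact le_mul_of_one_le_left (by positivity) hG3

end

/-! ### The potential of the travelling wave -/

section
variable {f u : ℝ → ℝ}

theorem contDiff_potential (hf : ContDiff ℝ ((⊤ : ℕ∞) : WithTop ℕ∞) f)
    (hu : ContDiff ℝ ((⊤ : ℕ∞) : WithTop ℕ∞) u) :
    ContDiff ℝ ((⊤ : ℕ∞) : WithTop ℕ∞) (potential f u) :=
  (contDiff_infty_iff_deriv.1 hf).2.comp hu

theorem isJet_iteratedDeriv {φ : ℝ → ℝ} (hφ : ContDiff ℝ ((⊤ : ℕ∞) : WithTop ℕ∞) φ) :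
    IsJet fun p => iteratedDeriv p φ := by
  intro p x
  have h1 : DifferentiableAt ℝ (iteratedDeriv p φ) x :=
    (hφ.differentiable_iteratedDeriv p (by exact_mod_cast WithTop.coe_lt_top p)) x
  have := h1.hasDerivAt
  rwa [← iteratedDeriv_succ] at this

end
end EvansMagnus

theorem mainTheorem4
    (f u : ℝ → ℝ) (c uMinus uPlus : ℝ)
    (hf : ContDiff ℝ ((⊤ : ℕ∞) : WithTop ℕ∞) f)
    (hu : ContDiff ℝ ((⊤ : ℕ∞) : WithTop ℕ∞) u)
    (huMinus : Tendsto u atBot (𝓝 uMinus))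
    (huPlus : Tendsto u atTop (𝓝 uPlus))
    (hMinus : IntegrableOn
      (fun x => EvansMagnus.potential f u x - deriv f uMinus) (Set.Iic 0))
    (hPlus : IntegrableOn
      (fun x => EvansMagnus.potential f u x - deriv f uPlus) (Set.Ici 0))
    (hDeriv : ∀ p : ℕ, 1 ≤ p → Integrable (iteratedDeriv p (EvansMagnus.potential f u)))
    (ε : ℝ) (hε : 0 < ε) (K : ℝ) (hK : 0 < K) :
    ∃ C h₀ : ℝ, 0 < h₀ ∧
      ∀ h : ℝ, 0 < h → h < h₀ →
        ∃ N₀ : ℕ, ∀ N : ℕ, N₀ ≤ N →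
          ∀ lam : ℂ, |lam.arg| < Real.pi - ε → K * h⁻¹ ^ 2 ≤ ‖lam‖ →
            ∀ yl yr : ℝ → Fin 2 → ℂ,
              EvansMagnus.IsLeftSolution c (deriv f uMinus)
                (EvansMagnus.potential f u) lam yl →
              EvansMagnus.IsRightSolution c (deriv f uPlus)
                (EvansMagnus.potential f u) lam yr →
              let E : ℂ := EvansMagnus.evansError
                (EvansMagnus.coeffMatrix c (EvansMagnus.potential f u) lam) yl yr h N
              let E₀ : ℝ := -(h ^ 4 / 144) *
                ∫ x : ℝ, (deriv (EvansMagnus.potential f u) x) ^ 2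
              ‖E - (E₀ : ℂ)‖ ≤
                  C * (h ^ 6 + h ^ 4 / Real.sqrt ‖lam‖ + h ^ 2 / ‖lam‖) ∧
              (K * h⁻¹ ^ 4 ≤ ‖lam‖ → ‖E - (E₀ : ℂ)‖ ≤ C * h ^ 6) ∧
              ‖E‖ ≤ C * h ^ 4 := by
  rcases lt_or_ge Real.pi ε with hεπ | hεπ
  · refine ⟨0, 1, one_pos, fun h _ _ => ⟨0, fun N _ lam harg => ?_⟩⟩
    -- the sector is empty
    linarith [abs_nonneg lam.arg]
  have hjet := EvansMagnus.isJet_iteratedDeriv (EvansMagnus.contDiff_potential hf hu)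
  have hcf : Continuous (deriv f) := (contDiff_infty_iff_deriv.1 hf).2.continuous
  obtain ⟨B, hB⟩ := hjet.exists_asymptoticPotential (mm := deriv f uMinus) (mp := deriv f uPlus)
    hDeriv
    (by
      simp only [iteratedDeriv_zero]
      exact (hcf.tendsto uMinus).comp huMinus)
    (by
      simp only [iteratedDeriv_zero]
      exact (hcf.tendsto uPlus).comp huPlus)
    (by simpa only [iteratedDeriv_zero] using hMinus)
    (by simpa only [iteratedDeriv_zero] using hPlus)
  obtain ⟨C, R, hC, hR, key⟩ := hB.exists_norm_evansError_add_le hDeriv c hε hεπ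
  simp only [iteratedDeriv_zero, iteratedDeriv_one] at key
  set φ := EvansMagnus.potential f u with hφ
  set I := ∫ x : ℝ, (deriv φ x) ^ 2 with hI
  have hI0 : 0 ≤ I := integral_nonneg fun _ => sq_nonneg _
  have hsK : 0 < Real.sqrt K := Real.sqrt_pos.2 hK
  have hCm : C ≤ C * (1 + 1 / Real.sqrt K + 1 / K) + I := by
    have : 0 ≤ C * (1 / Real.sqrt K) := by positivity
    have : 0 ≤ C * (1 / K) := by positivity
    linarith
  refine ⟨C * (1 + 1 / Real.sqrt K + 1 / K) + I, min 1 (Real.sqrt (K / R)),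
    lt_min one_pos (Real.sqrt_pos.2 (by positivity)), fun h hh hlt => ?_⟩
  have hh1 : h ≤ 1 := (hlt.trans_le (min_le_left _ _)).le
  have hhR : h ^ 2 ≤ K / R := by
    have := (hlt.trans_le (min_le_right _ _)).le
    rwa [Real.le_sqrt' hh] at this
  obtain ⟨N₀, hN₀⟩ := key h hh hh1
  refine ⟨N₀, fun N hN lam harg hlam yl yr hl hy => ?_⟩
  -- `h ≤ √(K / R)` makes the lower bound on `‖lam‖` exceed the radius `R`
  have hlow : R ≤ K * h⁻¹ ^ 2 := by
    rw [le_div_iff₀ hR] at hhR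
    rw [inv_pow, ← div_eq_mul_inv, le_div_iff₀ (by positivity)]
    linarith
  have hlam0 : 0 < ‖lam‖ := hR.trans_le (hlow.trans hlam)
  have main := hN₀ N hN lam harg (hlow.trans hlam) yl yr hl hy
  intro E E₀
  have hEE : ‖E - (E₀ : ℂ)‖ ≤ C * (h ^ 6 + h ^ 4 / Real.sqrt ‖lam‖ + h ^ 2 / ‖lam‖) := by
    refine le_trans (le_of_eq ?_) main
    congr 1
    simp only [E, E₀]
    push_cast
    ring
  -- a lower bound `K h⁻ᵏ` for `‖lam‖` turns the last two terms into powers of `h`.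
  have hpow : ∀ k : ℕ, K * h⁻¹ ^ (2 * k) ≤ ‖lam‖ →
      h ^ 4 / Real.sqrt ‖lam‖ ≤ h ^ (4 + k) * (1 / Real.sqrt K) ∧
      h ^ 2 / ‖lam‖ ≤ h ^ (2 + 2 * k) * (1 / K) := by
    intro k hk
    have h1 : K / h ^ (2 * k) ≤ ‖lam‖ := by rwa [inv_pow, ← div_eq_mul_inv] at hk
    have h2 : Real.sqrt K / h ^ k ≤ Real.sqrt ‖lam‖ := by
      refine Real.le_sqrt_of_sq_le ?_
      rw [div_pow, Real.sq_sqrt hK.le, ← pow_mul, mul_comm k]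
      exact h1
    constructor
    · calc h ^ 4 / Real.sqrt ‖lam‖ ≤ h ^ 4 / (Real.sqrt K / h ^ k) := by gcongr
        _ = _ := by rw [pow_add]; field_simp
    · calc h ^ 2 / ‖lam‖ ≤ h ^ 2 / (K / h ^ (2 * k)) := by gcongr
        _ = _ := by rw [pow_add]; field_simp
  refine ⟨hEE.trans (by gcongr), fun hlam4 => hEE.trans ?_, ?_⟩
  · obtain ⟨p1, p2⟩ := hpow 2 (by simpa using hlam4)
    norm_num only at p1 p2
    have : 0 ≤ I * h ^ 6 := by positivity
    calc C * (h ^ 6 + h ^ 4 / Real.sqrt ‖lam‖ + h ^ 2 / ‖lam‖)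
        ≤ C * (h ^ 6 + h ^ 6 * (1 / Real.sqrt K) + h ^ 6 * (1 / K)) := by gcongr
      _ ≤ _ := by linarith
  · obtain ⟨p1, p2⟩ := hpow 1 (by simpa using hlam)
    norm_num only at p1 p2
    have h54 : h ^ 5 ≤ h ^ 4 := pow_le_pow_of_le_one hh.le hh1 (by norm_num)
    have h64 : h ^ 6 ≤ h ^ 4 := pow_le_pow_of_le_one hh.le hh1 (by norm_num)
    have hE0 : ‖(E₀ : ℂ)‖ ≤ I * h ^ 4 := by
      rw [Complex.norm_real, Real.norm_eq_abs, abs_mul, abs_neg, abs_of_nonneg hI0,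
        abs_of_nonneg (by positivity)]
      nlinarith [mul_nonneg hI0 (pow_pos hh 4).le]
    have hsplit : ‖E‖ ≤ ‖E - (E₀ : ℂ)‖ + ‖(E₀ : ℂ)‖ := by
      simpa using norm_add_le (E - (E₀ : ℂ)) (E₀ : ℂ)
    calc ‖E‖ ≤ C * (h ^ 6 + h ^ 4 / Real.sqrt ‖lam‖ + h ^ 2 / ‖lam‖) + I * h ^ 4 :=
          hsplit.trans (add_le_add hEE hE0)
      _ ≤ C * (h ^ 4 + h ^ 4 * (1 / Real.sqrt K) + h ^ 4 * (1 / K)) + I * h ^ 4 := by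
          gcongr
          exact p1.trans (by gcongr)
      _ = _ := by ring
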